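/- Let $M$ be a closed (compact, without boundary, Hausdorff, not necessarily connected or orientable) piecewise-linear (PL) $n$-manifold, $n\ge 0$. Then $$\|M\|\le\sigma_\infty(M)\le\sigma(M),$$ where the three quantities are defined as follows. * A (loose) triangulation of a closed PL $n$-manifold $N$ with $m$ simplices is a realization of $N$, by a PL homeomorphism, as the gluing of $m$ copies of the standard $n$-simplex along a simplicial pairing of their facets (for $n=0$ there is nothing to glue). The $\Delta$-complexity $\sigma(N)$ is the minimal number $m$ of simplices in such a triangulation (with the convention $\min\emptyset=\infty$). * The stable $\Delta$-complexity is $\sigma_\infty(M)=\inf \sigma(\widetilde M)/d$, where the infimum is taken over all PL coverings $\widetilde M\to M$ of any finite degree $d\geq 1$. * $\|M\|$ is the simplicial volume. If $M$ is connected and oriented, then $\|M\|$ is the infimum of $\sum_i|\lambda_i|$ over all real singular cycles $\sum_i\lambda_i\sigma_i$ that represent the real fundamental class $[M]\in H_n(M;\mathbb R)$, i.e. the class whose image in $H_n(M,M\setminus\{x\};\mathbb R)$ is, for every $x\in M$, the image of the local orientation in $H_n(M,M\setminus\{x\};\mathbb Z)$; it does not depend on the orientation. If $M$ is connected and nonorientable,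 then $\|M\|$ is half the simplicial volume of the orientation double covering of $M$. In general, $\|M\|$ is the sum of the simplicial volumes of the connected components of $M$. -/

import Mathlib

open scoped ENNReal Topology Manifold

universe u

noncomputable section

namespace StableDelta

/-! ### Piecewise linear maps and piecewise linear manifolds -/

section PL

variable {X V W : Type*} [AddCommGroup V] [Module ℝ V] [AddCommGroup W] [Module ℝ W]

/-- A closed convex polyhedron: a finite intersection of closed affine half-spaces. -/
def IsPolyhedron (P : Set V) : Prop :=
  ∃ t : Finset (V →ᵃ[ℝ] ℝ), P = {v | ∀ l ∈ t, 0 ≤ l v}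

/-- With respect to the coordinates `c : X → V`, the map `f : X → W` is piecewise affine along the
filter `l`: eventually along `l`, the space is covered by finitely many closed convex polyhedra, on
each of which `f` is affine. -/
def PiecewiseAffineNear (c : X → V) (f : X → W) (l : Filter X) : Prop :=
  ∃ F : Set (Set V × (V →ᵃ[ℝ] W)), F.Finite ∧ (∀ a ∈ F, IsPolyhedron a.1) ∧
    ∀ᶠ q in l, (∃ a ∈ F, c q ∈ a.1) ∧ ∀ a ∈ F, c q ∈ a.1 → f q = a.2 (c q)

theorem IsPolyhedron.inter_preimage {P : Set V} {Q : Set W} (hP : IsPolyhedron P)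
    (hQ : IsPolyhedron Q) (A : V →ᵃ[ℝ] W) : IsPolyhedron (P ∩ A ⁻¹' Q) := by
  classical
  obtain ⟨t, rfl⟩ := hP
  obtain ⟨r, rfl⟩ := hQ
  refine ⟨t ∪ r.image (fun l => l.comp A), ?_⟩
  ext v
  simp only [Set.mem_inter_iff, Set.mem_ofPred_eq, Set.mem_preimage, Finset.mem_union,
    Finset.mem_image]
  constructor
  · rintro ⟨h1, h2⟩ l (hl | ⟨m, hm, rfl⟩)
    · exact h1 l hl
    · exact h2 m hm
  · intro h
    exact ⟨fun l hl => h l (Or.inl hl), fun m hm => h _ (Or.inr ⟨m, hm, rfl⟩)⟩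

variable [TopologicalSpace V] [TopologicalSpace W]

/-- `f` is a piecewise linear map on the set `s` (used for open sets `s` of a Euclidean space). -/
def IsPLOn (f : V → W) (s : Set V) : Prop :=
  ContinuousOn f s ∧ ∀ x ∈ s, PiecewiseAffineNear id f (𝓝[s] x)

theorem isPLOn_id (s : Set V) : IsPLOn (id : V → V) s := by
  refine ⟨continuousOn_id, fun x _ => ⟨{(Set.univ, AffineMap.id ℝ V)}, Set.finite_singleton _, ?_,
    Filter.Eventually.of_forall fun q => ?_⟩⟩
  · rintro a rfl
    exact ⟨∅, by simp⟩
  · simp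

theorem IsPLOn.comp {Z : Type*} [AddCommGroup Z] [Module ℝ Z] [TopologicalSpace Z]
    {f : V → W} {g : W → Z} {s : Set V} {t : Set W} (hf : IsPLOn f s) (hg : IsPLOn g t) :
    IsPLOn (g ∘ f) (s ∩ f ⁻¹' t) := by
  have hmaps : Set.MapsTo f (s ∩ f ⁻¹' t) t := fun x hx => hx.2
  have hfc : ContinuousOn f (s ∩ f ⁻¹' t) := hf.1.mono Set.inter_subset_left
  refine ⟨hg.1.comp hfc hmaps, fun x hx => ?_⟩
  obtain ⟨F, hFfin, hFp, hF⟩ := hf.2 x hx.1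
  obtain ⟨G, hGfin, hGp, hG⟩ := hg.2 (f x) hx.2
  refine ⟨(fun ab : (Set V × (V →ᵃ[ℝ] W)) × (Set W × (W →ᵃ[ℝ] Z)) =>
    (ab.1.1 ∩ ab.1.2 ⁻¹' ab.2.1, ab.2.2.comp ab.1.2)) '' (F ×ˢ G), (hFfin.prod hGfin).image _,
    ?_, ?_⟩
  · rintro _ ⟨⟨a, b⟩, ⟨ha, hb⟩, rfl⟩
    exact (hFp a ha).inter_preimage (hGp b hb) a.2
  · have h1 := hF.filter_mono (nhdsWithin_mono x (Set.inter_subset_left : s ∩ f ⁻¹' t ⊆ s))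
    have h2 := ((hfc x hx).tendsto_nhdsWithin hmaps).eventually hG
    filter_upwards [h1, h2] with q ⟨⟨a, ha, hqa⟩, hall⟩ ⟨⟨b, hb, hqb⟩, hall'⟩
    simp only [id] at hqa hall hqb hall'
    refine ⟨⟨_, ⟨(a, b), ⟨ha, hb⟩, rfl⟩, hqa, ?_⟩, ?_⟩
    · change a.2 q ∈ b.1
      rw [← hall a ha hqa]
      exact hqb
    · rintro _ ⟨⟨a', b'⟩, ⟨ha', hb'⟩, rfl⟩ ⟨hq1, hq2⟩
      change a'.2 q ∈ b'.1 at hq2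
      change g (f q) = b'.2 (a'.2 q)
      rw [← hall a' ha' hq1] at hq2 ⊢
      exact hall' b' hb' hq2

theorem IsPLOn.congr {f g : V → W} {s : Set V} (hf : IsPLOn f s) (h : ∀ x ∈ s, g x = f x) :
    IsPLOn g s := by
  refine ⟨hf.1.congr h, fun x hx => ?_⟩
  obtain ⟨F, hFfin, hFp, hF⟩ := hf.2 x hx
  refine ⟨F, hFfin, hFp, ?_⟩
  filter_upwards [hF, self_mem_nhdsWithin] with q hq hqs
  refine ⟨hq.1, fun a ha hqa => ?_⟩
  rw [h q hqs]
  exact hq.2 a ha hqa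

theorem isPLOn_of_locally {f : V → W} {s : Set V}
    (h : ∀ x ∈ s, ∃ v, IsOpen v ∧ x ∈ v ∧ IsPLOn f (s ∩ v)) : IsPLOn f s := by
  refine ⟨fun x hx => ?_, fun x hx => ?_⟩
  · obtain ⟨v, hv, hxv, hf⟩ := h x hx
    exact (continuousWithinAt_inter (hv.mem_nhds hxv)).1 (hf.1 x ⟨hx, hxv⟩)
  · obtain ⟨v, hv, hxv, hf⟩ := h x hx
    have := hf.2 x ⟨hx, hxv⟩
    rwa [nhdsWithin_inter_of_mem' (mem_nhdsWithin_of_mem_nhds (hv.mem_nhds hxv))] at this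

end PL

/-- Piecewise linear maps between open subsets of `ℝⁿ`. -/
def plPregroupoid (n : ℕ) : Pregroupoid (EuclideanSpace ℝ (Fin n)) where
  property f s := IsPLOn f s
  comp hf hg _ _ _ := hf.comp hg
  id_mem := isPLOn_id _
  locality _ h := isPLOn_of_locally h
  congr _ h hf := hf.congr h

/-- The structure groupoid of piecewise linear homeomorphisms between open subsets of `ℝⁿ`.
A PL `n`-manifold is a space `M` with `ChartedSpace (EuclideanSpace ℝ (Fin n)) M` and
`HasGroupoid M (plGroupoid n)`. -/
def plGroupoid (n : ℕ) : StructureGroupoid (EuclideanSpace ℝ (Fin n)) :=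
  (plPregroupoid n).groupoid

/-- A map between PL `n`-manifolds which is piecewise linear when read in charts. -/
def IsPLMap (n : ℕ) {N M : Type*} [TopologicalSpace N] [ChartedSpace (EuclideanSpace ℝ (Fin n)) N]
    [TopologicalSpace M] [ChartedSpace (EuclideanSpace ℝ (Fin n)) M] (p : N → M) : Prop :=
  Continuous p ∧
    ∀ e' ∈ atlas (EuclideanSpace ℝ (Fin n)) N, ∀ e ∈ atlas (EuclideanSpace ℝ (Fin n)) M,
      IsPLOn (e ∘ p ∘ e'.symm) (e'.target ∩ e'.symm ⁻¹' (p ⁻¹' e.source))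

/-! ### Loose triangulations, `Δ`-complexity and stable `Δ`-complexity -/

/-- The standard `k`-simplex. -/
abbrev Simplex (k : ℕ) : Type := stdSimplex ℝ (Fin (k + 1))

/-- A simplicial pairing of the facets of `m` copies of the standard `n`-simplex. The `k`-th facet
of a simplex is the one opposite to the vertex `k`. The facet `k` of the simplex `i` is glued to
the facet `perm i k k` of the simplex `nbr i k`, by the simplicial isomorphism which acts on the
vertices different from `k` as `perm i k`. (A simplicial isomorphism from the facet `k` to the
facet `k'` is the same as a permutation of the vertices taking `k` to `k'`.) The pairing is an
involution, and no facet is paired with itself. A `0`-simplex has an empty facet only, so the last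
condition is void when `n = 0`. -/
structure FacetPairing (n m : ℕ) where
  nbr : Fin m → Fin (n + 1) → Fin m
  perm : Fin m → Fin (n + 1) → Equiv.Perm (Fin (n + 1))
  nbr_nbr : ∀ i k, nbr (nbr i k) (perm i k k) = i
  perm_perm : ∀ i k, perm (nbr i k) (perm i k k) = (perm i k)⁻¹
  ne_self : n ≠ 0 → ∀ i k, (nbr i k, perm i k k) ≠ (i, k)

/-- The elementary identifications of a facet pairing: a point `p` of the facet `k` of the
simplex `i` is glued to its image in the paired facet. -/
inductive FacetPairing.Glue {n m : ℕ} (P : FacetPairing n m) :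
    (Σ _ : Fin m, Simplex n) → (Σ _ : Fin m, Simplex n) → Prop
  | mk (i : Fin m) (k : Fin (n + 1)) (p : Simplex n) (hp : p k = 0) :
      P.Glue ⟨i, p⟩ ⟨P.nbr i k, stdSimplex.map (P.perm i k) p⟩

/-- The topological space obtained from the `m` simplices by gluing their facets, with the quotient
topology. -/
abbrev FacetPairing.Realization {n m : ℕ} (P : FacetPairing n m) : Type := Quot P.Glue

/-- A (loose) triangulation of a PL `n`-manifold `M` with `m` simplices: a realization of `M` as
the gluing of `m` simplices along a facet pairing, by a homeomorphism that is piecewise linear on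
each simplex. -/
structure Triangulation (n m : ℕ) (M : Type*) [TopologicalSpace M]
    [ChartedSpace (EuclideanSpace ℝ (Fin n)) M] where
  pairing : FacetPairing n m
  homeo : pairing.Realization ≃ₜ M
  isPL : ∀ (i : Fin m) (p : Simplex n), ∀ e ∈ atlas (EuclideanSpace ℝ (Fin n)) M,
    homeo (Quot.mk _ ⟨i, p⟩) ∈ e.source →
      PiecewiseAffineNear (fun q : Simplex n => (q : Fin (n + 1) → ℝ))
        (fun q : Simplex n => e (homeo (Quot.mk _ ⟨i, q⟩))) (𝓝 p)

/-- The `Δ`-complexity `σ(M)`: the minimal number of simplices in a triangulation of `M`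
(it would be `⊤` if there were none). -/
def deltaComplexity (n : ℕ) (M : Type*) [TopologicalSpace M]
    [ChartedSpace (EuclideanSpace ℝ (Fin n)) M] : ℕ∞ :=
  ⨅ (m : ℕ) (_ : Nonempty (Triangulation n m M)), (m : ℕ∞)

/-- A finite covering of the PL `n`-manifold `M` by a PL `n`-manifold, of degree `degree`. -/
structure FiniteCovering (n : ℕ) (M : Type u) [TopologicalSpace M]
    [ChartedSpace (EuclideanSpace ℝ (Fin n)) M] where
  total : Type u
  [top : TopologicalSpace total]
  [charted : ChartedSpace (EuclideanSpace ℝ (Fin n)) total]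
  [pl : HasGroupoid total (plGroupoid n)]
  proj : total → M
  isCoveringMap : IsCoveringMap proj
  isPLMap : IsPLMap n proj
  degree : ℕ
  degree_pos : 0 < degree
  card_fiber : ∀ x : M, Nat.card (proj ⁻¹' {x}) = degree

attribute [instance] FiniteCovering.top FiniteCovering.charted FiniteCovering.pl

/-- The stable `Δ`-complexity `σ_∞(M)`: the infimum of `σ(N) / d` over all finite coverings `N → M`,
where `d` is the degree. -/
def stableDeltaComplexity (n : ℕ) (M : Type u) [TopologicalSpace M]
    [ChartedSpace (EuclideanSpace ℝ (Fin n)) M] : ℝ≥0∞ :=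
  ⨅ C : FiniteCovering n M, (deltaComplexity n C.total : ℝ≥0∞) / (C.degree : ℝ≥0∞)

/-! ### Singular chains and relative singular homology -/

section Singular

variable (A : Type*) [CommRing A] {X : Type u} [TopologicalSpace X]

/-- The `i`-th face of a singular simplex. -/
def face {k : ℕ} (i : Fin (k + 2)) (s : C(Simplex (k + 1), X)) : C(Simplex k, X) :=
  s.comp ⟨stdSimplex.map i.succAbove, stdSimplex.continuous_map _⟩

variable (X) in
/-- Singular `k`-chains of `X` with coefficients in `A`. -/
abbrev Chain (k : ℕ) : Type _ := C(Simplex k, X) →₀ A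

variable (X) in
/-- The boundary operator of singular chains; it is zero on `0`-chains. -/
def boundary : (k : ℕ) → Chain A X k →ₗ[A] Chain A X (k - 1)
  | 0 => 0
  | k + 1 => ∑ i : Fin (k + 2), (-1 : A) ^ (i : ℕ) • Finsupp.lmapDomain A A (face i)

/-- Singular chains of the subspace `S`, as chains of `X`. -/
def chainsIn (S : Set X) (k : ℕ) : Submodule A (Chain A X k) :=
  Finsupp.supported A A {s : C(Simplex k, X) | Set.range s ⊆ S}

/-- Relative cycles of the pair `(X, S)`. -/
def relCycles (S : Set X) (k : ℕ) : Submodule A (Chain A X k) :=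
  (chainsIn A S (k - 1)).comap (boundary A X k)

/-- Relative boundaries of the pair `(X, S)`. -/
def relBoundaries (S : Set X) (k : ℕ) : Submodule A (Chain A X k) :=
  chainsIn A S k ⊔ LinearMap.range (boundary A X (k + 1))

/-- A shortcut instance: submodules of the module of chains are additive groups. -/
instance {k : ℕ} (Z : Submodule A (Chain A X k)) : AddCommGroup Z := Submodule.addCommGroup Z

/-- The relative singular homology `H_k(X, S; A)`. -/
abbrev RelHomology (S : Set X) (k : ℕ) : Type _ :=
  relCycles A S k ⧸ (relBoundaries A S k).submoduleOf (relCycles A S k)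

variable {A} in
theorem chainsIn_mono {S T : Set X} (h : S ⊆ T) (k : ℕ) : chainsIn A S k ≤ chainsIn A T k :=
  Finsupp.supported_mono fun _ hs => hs.trans h

variable {A} in
theorem relCycles_mono {S T : Set X} (h : S ⊆ T) (k : ℕ) : relCycles A S k ≤ relCycles A T k :=
  Submodule.comap_mono (chainsIn_mono h _)

variable {A} in
theorem relBoundaries_mono {S T : Set X} (h : S ⊆ T) (k : ℕ) :
    relBoundaries A S k ≤ relBoundaries A T k :=
  sup_le_sup_right (chainsIn_mono h _) _

/-- The map `H_k(X, S; A) → H_k(X, T; A)` induced by an inclusion `S ⊆ T`. -/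
def RelHomology.ofSubset {S T : Set X} (h : S ⊆ T) (k : ℕ) :
    RelHomology A S k →ₗ[A] RelHomology A T k :=
  Submodule.mapQ _ _ (Submodule.inclusion (relCycles_mono h k)) fun _ hx =>
    relBoundaries_mono h k hx

end Singular

/-! ### Orientations and simplicial volume -/

/-- The local homology group `H_n(X, X ∖ {x}; ℤ)`. -/
abbrev LocalHomology (n : ℕ) {X : Type u} [TopologicalSpace X] (x : X) : Type u :=
  RelHomology ℤ ({x}ᶜ : Set X) n

/-- The restriction `H_n(X, X ∖ U; ℤ) → H_n(X, X ∖ {x}; ℤ)` for `x ∈ U`. -/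
def restrictTo (n : ℕ) {X : Type u} [TopologicalSpace X] {U : Set X} {x : X} (hx : x ∈ U) :
    RelHomology ℤ Uᶜ n →ₗ[ℤ] LocalHomology n x :=
  RelHomology.ofSubset ℤ (Set.compl_subset_compl.2 (Set.singleton_subset_iff.2 hx)) n

/-- A local orientation: a generator of the local homology group. -/
def IsLocalOrientation (n : ℕ) {X : Type u} [TopologicalSpace X] {x : X}
    (a : LocalHomology n x) : Prop :=
  Submodule.span ℤ {a} = ⊤

/-- An orientation of an `n`-manifold `X`: a locally consistent choice of local orientations. -/
structure ManifoldOrientation (n : ℕ) (X : Type u) [TopologicalSpace X] where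
  val : ∀ x : X, LocalHomology n x
  isLocalOrientation : ∀ x, IsLocalOrientation n (val x)
  locally_consistent : ∀ x : X, ∃ U : Set X, IsOpen U ∧ x ∈ U ∧
    ∃ a : RelHomology ℤ Uᶜ n, ∀ (y : X) (hy : y ∈ U), restrictTo n hy a = val y

/-- The orientation double covering of an `n`-manifold `X`: its points are the pairs of a point of
`X` and a local orientation at this point. -/
def OrientationCover (n : ℕ) (X : Type u) [TopologicalSpace X] : Type u :=
  Σ x : X, {a : LocalHomology n x // IsLocalOrientation n a}

/-- The topology of the orientation double covering is generated by the sets of all restrictions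
to the points of `U` of a class in `H_n(X, X ∖ U; ℤ)`, where `U` is open. -/
instance (n : ℕ) (X : Type u) [TopologicalSpace X] : TopologicalSpace (OrientationCover n X) :=
  TopologicalSpace.generateFrom
    {B | ∃ (U : Set X) (_ : IsOpen U) (a : RelHomology ℤ Uᶜ n),
      B = {p : OrientationCover n X | ∃ h : p.1 ∈ U, restrictTo n h a = p.2.1}}

/-- The real chain `c` represents the real fundamental class of the closed oriented `n`-manifold
`(X, o)`: it is a cycle, and for every `x` its class in `H_n(X, X ∖ {x}; ℝ)` is the image of the
local orientation `o_x ∈ H_n(X, X ∖ {x}; ℤ)` under `ℤ → ℝ`. -/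
def IsFundamentalCycle {n : ℕ} {X : Type u} [TopologicalSpace X] (o : ManifoldOrientation n X)
    (c : Chain ℝ X n) : Prop :=
  boundary ℝ X n c = 0 ∧
    ∀ x : X, ∃ b : relCycles ℤ ({x}ᶜ : Set X) n, Submodule.Quotient.mk b = o.val x ∧
      c - Finsupp.mapRange (Int.cast : ℤ → ℝ) Int.cast_zero (b : Chain ℤ X n) ∈
        relBoundaries ℝ ({x}ᶜ : Set X) n

/-- The `ℓ¹`-norm of a real singular chain. -/
def l1Norm {n : ℕ} {X : Type u} [TopologicalSpace X] (c : Chain ℝ X n) : ℝ :=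
  c.sum fun _ a => |a|

/-- The simplicial volume of a closed orientable `n`-manifold: the infimum of the `ℓ¹`-norms of
the cycles that represent the real fundamental class. It does not depend on the orientation. -/
def orientableSimplicialVolume (n : ℕ) (X : Type u) [TopologicalSpace X] : ℝ≥0∞ :=
  ⨅ (o : ManifoldOrientation n X) (c : Chain ℝ X n) (_ : IsFundamentalCycle o c),
    ENNReal.ofReal (l1Norm c)

open Classical in
/-- The simplicial volume of a closed connected `n`-manifold. In the nonorientable case it is half
the simplicial volume of the orientation double covering. -/
def connectedSimplicialVolume (n : ℕ) (X : Type u) [TopologicalSpace X] : ℝ≥0∞ :=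
  if Nonempty (ManifoldOrientation n X) then orientableSimplicialVolume n X
  else orientableSimplicialVolume n (OrientationCover n X) / 2

/-- The simplicial volume `‖M‖` of a closed `n`-manifold: the sum of the simplicial volumes of the
connected components. -/
def simplicialVolume (n : ℕ) (M : Type u) [TopologicalSpace M] : ℝ≥0∞ :=
  ∑' C : ConnectedComponents M,
    connectedSimplicialVolume n {x : M // ConnectedComponents.mk x = C}

end StableDelta

end

/-! The second inequality only uses that the identity is a covering of degree one. For the first,
let p : N → M be a covering of degree d and let N be glued from m simplices. It suffices to show
that each component C of M satisfies ‖C‖ ≤ m_C / d, where m_C is the number of simplices of N lying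
over C: every simplex lies over exactly one component, so the m_C add up to m.

Let Y be C if C is orientable, and the orientation covering of C otherwise, with its map q : Y → M.
The fibre product of N and Y over M is a local homeomorphism over Y with d-element fibres, so it
inherits an orientation from Y; it is also glued from the lifts of the simplices of N, because
simplices lift along q. There are at most e · m_C lifts, with e = 1 in the first case and e = 2 in
the second. On an oriented space glued from simplices, give each simplex the sign with which it
agrees with the orientation and sum all (n+1)! parametrizations, each weighted with the sign of its
permutation. Facets cancel in pairs, so this chain is a cycle, and it represents (n+1)! times the
fundamental class. Summing over all parametrizations avoids choosing compatible vertex orders.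
Pushed forward to Y and divided by d · (n+1)!, it is a fundamental cycle of norm at most e · m_C /
d; the factor e = 2 cancels against the half in the definition for nonorientable C
(`orientableSimplicialVolume_le`, `connectedSimplicialVolume_component_le`).

The topology needed is built from singular chains. Barycentric subdivision gives excision; a
Mayer–Vietoris induction computes the local homology of a simplex at an interior point
(`frontFace_generates`); excision transports this to any open simplex. Classes are handled as chains
modulo `relBoundaries`: an orientation becomes a family of chains β x, locally constant modulo
relative boundaries. The geometric inputs are that simplices on two sides of a common facet have
opposite signs (`HasSign.eq_neg`), that gluings lift (`SimplexGluing.nonempty_lift`), that the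
orientation space is a covering (`OrientationCover.isCoveringMap_proj`), and the degree formula
(`push_sub_mem_relBoundaries`). -/

noncomputable section

namespace StableDelta

/-! ### Singular chains -/

section Chains

variable {X Y Z : Type*} [TopologicalSpace X] [TopologicalSpace Y] [TopologicalSpace Z]

/-- The inclusion of the `i`-th facet of the standard simplex. -/
def faceMap {k : ℕ} (i : Fin (k + 2)) : C(Simplex k, Simplex (k + 1)) :=
  ⟨stdSimplex.map i.succAbove, stdSimplex.continuous_map _⟩

theorem face_eq {k : ℕ} (i : Fin (k + 2)) (s : C(Simplex (k + 1), X)) :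
    face i s = s.comp (faceMap i) := rfl

theorem map_apply_of_injective {a b : ℕ} {f : Fin (a + 1) → Fin (b + 1)}
    (hf : Function.Injective f) (p : Simplex a) (j : Fin (a + 1)) :
    stdSimplex.map f p (f j) = p j := by
  classical
  rw [stdSimplex.map_coe, FunOnFinite.linearMap_apply_apply, Finset.sum_eq_single j]
  · intro b hb hbj
    exact absurd (hf (Finset.mem_filter.1 hb).2) hbj
  · simp

theorem map_apply_of_notMem {a b : ℕ} {f : Fin (a + 1) → Fin (b + 1)}
    (p : Simplex a) {j : Fin (b + 1)} (hj : ∀ i, f i ≠ j) :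
    stdSimplex.map f p j = 0 := by
  classical
  rw [stdSimplex.map_coe, FunOnFinite.linearMap_apply_apply]
  exact Finset.sum_eq_zero fun x hx => absurd (Finset.mem_filter.1 hx).2 (hj x)

@[simp]
theorem faceMap_succAbove {k : ℕ} (i : Fin (k + 2)) (p : Simplex k) (j : Fin (k + 1)) :
    faceMap i p (i.succAbove j) = p j :=
  map_apply_of_injective Fin.succAbove_right_injective p j

@[simp]
theorem faceMap_self {k : ℕ} (i : Fin (k + 2)) (p : Simplex k) : faceMap i p i = 0 :=
  map_apply_of_notMem p (Fin.succAbove_ne i)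

theorem faceMap_comm {k : ℕ} {i j : Fin (k + 2)} (h : i ≤ j) :
    (faceMap j.succ).comp (faceMap i) = (faceMap i.castSucc).comp (faceMap (k := k) j) := by
  ext1 p
  change stdSimplex.map _ (stdSimplex.map _ p) = stdSimplex.map _ (stdSimplex.map _ p)
  rw [stdSimplex.map_comp_apply, stdSimplex.map_comp_apply]
  congr 1
  funext a
  exact congrArg (fun f => f.toOrderHom a) (SimplexCategory.δ_comp_δ h)

/-- The map of chains induced by a continuous map. -/
def push (f : C(X, Y)) (k : ℕ) : Chain ℤ X k →ₗ[ℤ] Chain ℤ Y k :=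
  Finsupp.lmapDomain ℤ ℤ fun s => f.comp s

@[simp]
theorem push_single (f : C(X, Y)) {k : ℕ} (s : C(Simplex k, X)) (a : ℤ) :
    push f k (Finsupp.single s a) = Finsupp.single (f.comp s) a :=
  Finsupp.mapDomain_single

theorem push_push (g : C(Y, Z)) (f : C(X, Y)) {k : ℕ} (c : Chain ℤ X k) :
    push g k (push f k c) = push (g.comp f) k c := by
  change Finsupp.mapDomain _ (Finsupp.mapDomain _ c) = Finsupp.mapDomain _ c
  rw [← Finsupp.mapDomain_comp]
  rfl

theorem boundary_single {A : Type*} [CommRing A] {k : ℕ} (s : C(Simplex (k + 1), X)) (a : A) :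
    boundary A X (k + 1) (Finsupp.single s a) =
      ∑ i : Fin (k + 2), (-1 : A) ^ (i : ℕ) • Finsupp.single (face i s) a := by
  simp only [boundary, LinearMap.sum_apply, LinearMap.smul_apply, Finsupp.lmapDomain_apply,
    Finsupp.mapDomain_single]

theorem boundary_zero {A : Type*} [CommRing A] (c : Chain A X 0) : boundary A X 0 c = 0 := rfl

theorem boundary_push (f : C(X, Y)) : ∀ {k : ℕ} (c : Chain ℤ X k),
    boundary ℤ Y k (push f k c) = push f (k - 1) (boundary ℤ X k c)
  | 0, c => by rw [boundary_zero, boundary_zero, map_zero]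
  | k + 1, c => by
    induction c using Finsupp.induction_linear with
    | zero => simp only [map_zero]
    | add a b ha hb => rw [map_add, map_add, map_add, ha, hb, map_add]
    | single s a =>
      rw [push_single, boundary_single, boundary_single, map_sum]
      refine Finset.sum_congr rfl fun i _ => ?_
      rw [map_smul]
      exact congrArg _ (push_single f (face i s) a).symm

/-- The boundary operator in positive degrees. -/
abbrev bd (A : Type*) [CommRing A] {X : Type*} [TopologicalSpace X] {k : ℕ} :
    Chain A X (k + 1) →ₗ[A] Chain A X k :=
  boundary A X (k + 1)

theorem bd_push (f : C(X, Y)) {k : ℕ} (c : Chain ℤ X (k + 1)) :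
    bd ℤ (push f (k + 1) c) = push f k (bd ℤ c) :=
  boundary_push f c

/-- The identity of the standard simplex, as a singular chain. -/
def idChain (k : ℕ) : Chain ℤ (Simplex k) k := Finsupp.single (ContinuousMap.id _) 1

theorem push_idChain {k : ℕ} (s : C(Simplex k, X)) : push s k (idChain k) = Finsupp.single s 1 := by
  rw [idChain, push_single]
  rfl

/-- Two linear maps on chains agree if they agree on singular simplices. -/
theorem chain_induction {k : ℕ} {M : Type*} [AddCommGroup M] (F G : Chain ℤ X k →ₗ[ℤ] M)
    (h : ∀ s : C(Simplex k, X), F (Finsupp.single s 1) = G (Finsupp.single s 1)) : F = G :=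
  Finsupp.lhom_ext' fun s => LinearMap.ext_ring (h s)

/-- The simplicial identity cancels the pairs (a, b) of facet indices: for b < a the pair is matched
with (b, a - 1), otherwise with (b + 1, a). The exponent of the sign changes by one. -/
theorem boundary_boundary_single {k : ℕ} (s : C(Simplex (k + 2), X)) :
    boundary ℤ X (k + 1) (boundary ℤ X (k + 2) (Finsupp.single s 1)) = 0 := by
  rw [boundary_single, map_sum]
  simp_rw [map_smul, boundary_single, Finset.smul_sum, smul_smul, ← pow_add]
  rw [← Finset.sum_product', Finset.univ_product_univ]
  refine Finset.sum_involution
    (fun x _ => if h : (x.2 : ℕ) < x.1 then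
        ((⟨x.2, by omega⟩ : Fin (k + 3)), (⟨x.1 - 1, by omega⟩ : Fin (k + 2)))
      else ((⟨x.2 + 1, by omega⟩ : Fin (k + 3)), (⟨x.1, by omega⟩ : Fin (k + 2))))
    ?_ ?_ (fun _ _ => Finset.mem_univ _) ?_
  · rintro ⟨a, b⟩ -
    have key : ∀ (i j : Fin (k + 2)), i ≤ j →
        face i (face j.succ s) = face j (face i.castSucc s) := by
      intro i j hij
      simp only [face_eq, ContinuousMap.comp_assoc, faceMap_comm hij]
    dsimp only
    split_ifs with h
    · have := key b ⟨a - 1, by omega⟩ (by rw [Fin.le_def]; dsimp; omega)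
      have h1 : (⟨(a : ℕ) - 1, by omega⟩ : Fin (k + 2)).succ = a := by
        ext; simp; omega
      have h2 : (⟨b, by omega⟩ : Fin (k + 3)) = b.castSucc := by ext; simp
      rw [h1] at this
      rw [h2, this, ← add_smul]
      have h3 : ((a : ℕ) + b) = (b + (a - 1)) + 1 := by omega
      rw [h3, pow_succ]
      simp
    · have := key ⟨a, by omega⟩ b (by rw [Fin.le_def]; dsimp; omega)
      have h1 : (⟨a, by omega⟩ : Fin (k + 2)).castSucc = a := by ext; simp
      have h2 : (⟨b + 1, by omega⟩ : Fin (k + 3)) = b.succ := by ext; simp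
      rw [h1] at this
      rw [h2, ← this, ← add_smul]
      have h3 : ((b.succ : Fin (k + 3)) : ℕ) + (⟨a, by omega⟩ : Fin (k + 2)) = (a + b) + 1 := by
        simp only [Fin.val_succ]; omega
      rw [h3, pow_succ]
      simp
  · rintro ⟨a, b⟩ - - h
    dsimp only at h
    split_ifs at h with h'
    · have := congrArg (fun x => (x.1 : ℕ)) h
      simp at this
      omega
    · have := congrArg (fun x => (x.1 : ℕ)) h
      simp at this
      omega
  · rintro ⟨a, b⟩ -
    dsimp only
    split_ifs with h h1 h1
    · dsimp at h1; omega
    · ext <;> simp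
      omega
    · ext <;> simp
    · dsimp at h1; omega

theorem boundary_boundary : ∀ {k : ℕ} (c : Chain ℤ X (k + 1)),
    boundary ℤ X k (boundary ℤ X (k + 1) c) = 0
  | 0, _ => rfl
  | k + 1, c => by
    have : (boundary ℤ X (k + 1)).comp (boundary ℤ X (k + 2)) = 0 :=
      chain_induction _ _ fun s => boundary_boundary_single s
    exact LinearMap.congr_fun this c

/-- The sum of the coefficients of a `0`-chain. -/
def augmentation : Chain ℤ X 0 →ₗ[ℤ] ℤ := Finsupp.linearCombination ℤ fun _ => (1 : ℤ)

@[simp]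
theorem augmentation_single (s : C(Simplex 0, X)) (a : ℤ) :
    augmentation (Finsupp.single s a) = a := by
  simp [augmentation]

theorem augmentation_boundary (c : Chain ℤ X 1) : augmentation (boundary ℤ X 1 c) = 0 := by
  have : augmentation.comp (boundary ℤ X 1) = 0 := by
    refine chain_induction _ _ fun s => ?_
    rw [LinearMap.comp_apply, boundary_single, map_sum, Fin.sum_univ_two]
    simp
  exact LinearMap.congr_fun this c

/-! ### Chains of subspaces -/

theorem mapDomain_mem_supported {α β : Type*} {f : α → β} {s : Set α} {t : Set β}
    (h : Set.MapsTo f s t) {c : α →₀ ℤ} (hc : c ∈ Finsupp.supported ℤ ℤ s) :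
    Finsupp.mapDomain f c ∈ Finsupp.supported ℤ ℤ t := by
  classical
  rw [Finsupp.mem_supported] at hc ⊢
  intro b hb
  obtain ⟨a, ha, rfl⟩ := Finset.mem_image.1 (Finsupp.mapDomain_support hb)
  exact h (hc ha)

theorem single_mem_chainsIn {A : Type*} [CommRing A] {S : Set X} {k : ℕ} {s : C(Simplex k, X)}
    (h : Set.range s ⊆ S) (a : A) : Finsupp.single s a ∈ chainsIn A S k :=
  Finsupp.single_mem_supported _ _ h

theorem push_mem_chainsIn {f : C(X, Y)} {S : Set X} {T : Set Y} (h : Set.MapsTo f S T) {k : ℕ}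
    {c : Chain ℤ X k} (hc : c ∈ chainsIn ℤ S k) : push f k c ∈ chainsIn ℤ T k := by
  refine mapDomain_mem_supported (fun s hs => ?_) hc
  rintro _ ⟨p, rfl⟩
  exact h (hs ⟨p, rfl⟩)

theorem push_mem_chainsIn_univ {f : C(X, Y)} {T : Set Y} (h : Set.range f ⊆ T) {k : ℕ}
    (c : Chain ℤ X k) : push f k c ∈ chainsIn ℤ T k :=
  push_mem_chainsIn (S := Set.univ) (fun x _ => h ⟨x, rfl⟩) fun _ _ => Set.subset_univ _

theorem mem_chainsIn_univ {A : Type*} [CommRing A] {k : ℕ} (c : Chain A X k) :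
    c ∈ chainsIn A Set.univ k :=
  fun _ _ => Set.subset_univ _

theorem chainsIn_inter {A : Type*} [CommRing A] {S T : Set X} {k : ℕ} {c : Chain A X k}
    (hS : c ∈ chainsIn A S k) (hT : c ∈ chainsIn A T k) : c ∈ chainsIn A (S ∩ T) k :=
  fun s hs => Set.subset_inter (hS hs) (hT hs)

/-- A chain whose simplices satisfy `P` is in a submodule that contains those simplices. -/
theorem mem_of_supported {A : Type*} [CommRing A] {k : ℕ} {P : Set C(Simplex k, X)}
    {c : Chain A X k} (hc : c ∈ Finsupp.supported A A P) (N : Submodule A (Chain A X k))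
    (h : ∀ s ∈ P, Finsupp.single s 1 ∈ N) : c ∈ N := by
  rw [Finsupp.supported_eq_span_single] at hc
  refine Submodule.span_le.2 ?_ hc
  rintro _ ⟨s, hs, rfl⟩
  exact h s hs

theorem boundary_mem_chainsIn {A : Type*} [CommRing A] {S : Set X} : ∀ {k : ℕ} {c : Chain A X k},
    c ∈ chainsIn A S k → boundary A X k c ∈ chainsIn A S (k - 1)
  | 0, _, _ => Submodule.zero_mem _
  | k + 1, c, hc => by
    refine mem_of_supported hc ((chainsIn A S k).comap (boundary A X (k + 1))) fun _ hs => ?_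
    rw [Submodule.mem_comap, boundary_single]
    refine Submodule.sum_mem _ fun i _ => Submodule.smul_mem _ _ (single_mem_chainsIn ?_ _)
    rintro _ ⟨p, rfl⟩
    exact hs ⟨_, rfl⟩

theorem exists_add_of_supported {A : Type*} [CommRing A] {k : ℕ} {S T : Set X}
    {c : Chain A X k}
    (hc : c ∈ Finsupp.supported A A {s : C(Simplex k, X) | Set.range s ⊆ S ∨ Set.range s ⊆ T}) :
    ∃ a ∈ chainsIn A S k, ∃ b ∈ chainsIn A T k, a + b = c := by
  refine Submodule.mem_sup.1 (mem_of_supported hc (chainsIn A S k ⊔ chainsIn A T k) ?_)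
  rintro _ (hs | hs)
  · exact Submodule.mem_sup_left (single_mem_chainsIn hs _)
  · exact Submodule.mem_sup_right (single_mem_chainsIn hs _)

/-- A chain involves finitely many simplices, each with compact, hence closed, image, so missing a
point is an open condition on the point. -/
theorem eventually_mem_chainsIn [T2Space X] {A : Type*} [CommRing A] {k : ℕ} {x : X}
    {c : Chain A X k} (hc : c ∈ chainsIn A ({x}ᶜ : Set X) k) :
    ∀ᶠ y in 𝓝 x, c ∈ chainsIn A ({y}ᶜ : Set X) k := by
  have : ∀ᶠ y in 𝓝 x, ∀ s ∈ c.support, y ∉ Set.range s := by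
    rw [Filter.eventually_all_finset]
    intro s hs
    exact (isCompact_range s.continuous).isClosed.isOpen_compl.mem_nhds
      (Set.subset_compl_singleton_iff.1 (hc hs))
  filter_upwards [this] with y hy s hs
  exact Set.subset_compl_singleton_iff.2 (hy s hs)

/-! ### Relative boundaries -/

theorem mem_relBoundaries {A : Type*} [CommRing A] {S : Set X} {k : ℕ} {c : Chain A X k} :
    c ∈ relBoundaries A S k ↔ ∃ a ∈ chainsIn A S k, ∃ d, c = a + bd A d := by
  rw [relBoundaries, Submodule.mem_sup]
  constructor
  · rintro ⟨a, ha, _, ⟨d, rfl⟩, rfl⟩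
    exact ⟨a, ha, d, rfl⟩
  · rintro ⟨a, ha, d, rfl⟩
    exact ⟨a, ha, _, ⟨d, rfl⟩, rfl⟩

theorem chainsIn_le_relBoundaries {A : Type*} [CommRing A] {S : Set X} {k : ℕ} {c : Chain A X k}
    (h : c ∈ chainsIn A S k) : c ∈ relBoundaries A S k :=
  Submodule.mem_sup_left h

theorem boundary_mem_relBoundaries {A : Type*} [CommRing A] {S : Set X} {k : ℕ}
    (d : Chain A X (k + 1)) : boundary A X (k + 1) d ∈ relBoundaries A S k :=
  Submodule.mem_sup_right ⟨d, rfl⟩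

theorem mem_relCycles {A : Type*} [CommRing A] {S : Set X} {k : ℕ} {c : Chain A X k} :
    c ∈ relCycles A S k ↔ boundary A X k c ∈ chainsIn A S (k - 1) := Iff.rfl

theorem relBoundaries_le_relCycles {S : Set X} {k : ℕ} {c : Chain ℤ X k}
    (h : c ∈ relBoundaries ℤ S k) : c ∈ relCycles ℤ S k := by
  obtain ⟨a, ha, d, rfl⟩ := mem_relBoundaries.1 h
  rw [mem_relCycles, map_add]
  rw [show boundary ℤ X k (bd ℤ d) = 0 from boundary_boundary d, add_zero]
  exact boundary_mem_chainsIn ha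

theorem push_mem_relBoundaries {f : C(X, Y)} {S : Set X} {T : Set Y} (h : Set.MapsTo f S T) {k : ℕ}
    {c : Chain ℤ X k} (hc : c ∈ relBoundaries ℤ S k) : push f k c ∈ relBoundaries ℤ T k := by
  obtain ⟨a, ha, d, rfl⟩ := mem_relBoundaries.1 hc
  refine mem_relBoundaries.2 ⟨_, push_mem_chainsIn h ha, push f (k + 1) d, ?_⟩
  rw [map_add, bd_push]

theorem push_mem_relCycles {f : C(X, Y)} {S : Set X} {T : Set Y} (h : Set.MapsTo f S T) {k : ℕ}
    {c : Chain ℤ X k} (hc : c ∈ relCycles ℤ S k) : push f k c ∈ relCycles ℤ T k := by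
  rw [mem_relCycles, boundary_push]
  exact push_mem_chainsIn h hc

/-- The same bounding chain serves all nearby points; only the remainder has to avoid them. All
arguments about local constancy of classes rest on this. -/
theorem eventually_mem_relBoundaries [T2Space X] {A : Type*} [CommRing A] {k : ℕ} {x : X}
    {c : Chain A X k} (hc : c ∈ relBoundaries A ({x}ᶜ : Set X) k) :
    ∀ᶠ y in 𝓝 x, c ∈ relBoundaries A ({y}ᶜ : Set X) k := by
  obtain ⟨a, ha, d, rfl⟩ := mem_relBoundaries.1 hc
  filter_upwards [eventually_mem_chainsIn ha] with y hy
  exact mem_relBoundaries.2 ⟨a, hy, d, rfl⟩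

theorem eventually_mem_relCycles [T2Space X] {A : Type*} [CommRing A] {k : ℕ} {x : X}
    {c : Chain A X k} (hc : c ∈ relCycles A ({x}ᶜ : Set X) k) :
    ∀ᶠ y in 𝓝 x, c ∈ relCycles A ({y}ᶜ : Set X) k :=
  eventually_mem_chainsIn (mem_relCycles.1 hc)

end Chains

/-! ### Cones in the standard simplex -/

section Cone

variable {N k : ℕ}

/-- The convex combination `t a + (1 - t) b` of two points of the standard simplex. -/
def mix (t : unitInterval) (a b : Simplex N) : Simplex N :=
  ⟨fun i => t * a i + (1 - t) * b i, fun i => add_nonneg (mul_nonneg t.2.1 (a.2.1 i))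
    (mul_nonneg (sub_nonneg.2 t.2.2) (b.2.1 i)), by
      rw [Finset.sum_add_distrib, ← Finset.mul_sum, ← Finset.mul_sum, stdSimplex.sum_eq_one,
        stdSimplex.sum_eq_one]
      ring⟩

@[simp]
theorem mix_apply (t : unitInterval) (a b : Simplex N) (i : Fin (N + 1)) :
    mix t a b i = t * a i + (1 - t) * b i := rfl

theorem simplex_ext {p q : Simplex N} (h : ∀ i, p i = q i) : p = q :=
  stdSimplex.ext (funext h)

@[fun_prop]
theorem continuous_simplex_apply (i : Fin (N + 1)) : Continuous fun p : Simplex N => p i :=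
  (continuous_apply i).comp continuous_subtype_val

theorem continuous_to_simplex {T : Type*} [TopologicalSpace T] {f : T → Simplex N}
    (h : ∀ i, Continuous fun x => f x i) : Continuous f :=
  Continuous.subtype_mk (continuous_pi h) _

theorem continuous_mix :
    Continuous fun x : unitInterval × Simplex N × Simplex N => mix x.1 x.2.1 x.2.2 := by
  refine continuous_to_simplex fun i => ?_
  have h1 : Continuous fun x : unitInterval × Simplex N × Simplex N => x.2.1 i :=
    (continuous_simplex_apply i).comp (continuous_fst.comp continuous_snd)
  have h2 : Continuous fun x : unitInterval × Simplex N × Simplex N => x.2.2 i :=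
    (continuous_simplex_apply i).comp (continuous_snd.comp continuous_snd)
  simp only [mix_apply]
  fun_prop

/-- The coordinate `p i`, as a point of the unit interval. -/
def coord (p : Simplex k) (i : Fin (k + 1)) : unitInterval :=
  ⟨p i, stdSimplex.zero_le p i, stdSimplex.le_one p i⟩

@[simp]
theorem coe_coord (p : Simplex k) (i : Fin (k + 1)) : (coord p i : ℝ) = p i := rfl

theorem sum_tail (p : Simplex (k + 1)) : ∑ i : Fin (k + 1), p i.succ = 1 - p 0 := by
  have := stdSimplex.sum_eq_one p
  rw [Fin.sum_univ_succ] at this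
  linarith

open Classical in
/-- The projection of a point of a simplex to the facet opposite to the vertex `0`. -/
def normTail (p : Simplex (k + 1)) : Simplex k :=
  if h : p 0 = 1 then stdSimplex.vertex 0 else
    ⟨fun i => p i.succ / (1 - p 0), fun i => div_nonneg (stdSimplex.zero_le p _)
      (sub_nonneg.2 (stdSimplex.le_one p 0)), by
        rw [← Finset.sum_div, sum_tail, div_self]
        exact sub_ne_zero.2 (Ne.symm h)⟩

theorem normTail_apply {p : Simplex (k + 1)} (h : p 0 ≠ 1) (i : Fin (k + 1)) :
    normTail p i = p i.succ / (1 - p 0) := by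
  rw [normTail, dif_neg h]
  rfl

/-- Free of division, and valid at the vertex `0` as well, where both sides vanish whatever the
default value of `normTail`. -/
theorem mul_normTail (p : Simplex (k + 1)) (i : Fin (k + 1)) :
    (1 - p 0) * normTail p i = p i.succ := by
  by_cases h : p 0 = 1
  · have h1 := sum_tail p
    rw [h, sub_self, Finset.sum_eq_zero_iff_of_nonneg fun j _ => stdSimplex.zero_le p _] at h1
    rw [h, h1 i (Finset.mem_univ _)]
    ring
  · rw [normTail_apply h, mul_div_cancel₀ _ (sub_ne_zero.2 (Ne.symm h))]

theorem continuousAt_normTail {p : Simplex (k + 1)} (h : p 0 ≠ 1) : ContinuousAt normTail p := by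
  rw [ContinuousAt, tendsto_subtype_rng, tendsto_pi_nhds]
  intro i
  have h0 : ∀ᶠ q : Simplex (k + 1) in 𝓝 p, q 0 ≠ 1 :=
    (continuous_simplex_apply 0).continuousAt.eventually_ne h
  have h1 : ContinuousAt (fun q : Simplex (k + 1) => q i.succ / (1 - q 0)) p :=
    (continuous_simplex_apply _).continuousAt.div
      (continuousAt_const.sub (continuous_simplex_apply _).continuousAt)
      (sub_ne_zero.2 (Ne.symm h))
  have h2 := h1.tendsto
  rw [← normTail_apply h i] at h2
  exact h2.congr' (h0.mono fun q hq => (normTail_apply hq i).symm)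

/-- The cone with apex `e` on a singular simplex of the standard simplex. -/
def cone (e : Simplex N) (s : C(Simplex k, Simplex N)) : C(Simplex (k + 1), Simplex N) where
  toFun p := mix (coord p 0) e (s (normTail p))
  continuous_toFun := by
    refine continuous_to_simplex fun i => continuous_iff_continuousAt.2 fun p => ?_
    simp only [mix_apply, coe_coord]
    refine ((continuous_simplex_apply 0).continuousAt.mul continuousAt_const).add ?_
    -- At the apex `normTail` need not be continuous, but its contribution has the factor 1 - q 0,
    -- which tends to zero.
    by_cases h : p 0 = 1
    · rw [ContinuousAt, h, sub_self, zero_mul]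
      refine squeeze_zero_norm (a := fun q : Simplex (k + 1) => 1 - q 0) (fun q => ?_) ?_
      · have h1 := stdSimplex.le_one q 0
        have h2 := stdSimplex.zero_le (s (normTail q)) i
        have h3 := stdSimplex.le_one (s (normTail q)) i
        rw [Real.norm_eq_abs, abs_of_nonneg (mul_nonneg (by linarith) h2)]
        exact mul_le_of_le_one_right (by linarith) h3
      · have : ContinuousAt (fun q : Simplex (k + 1) => 1 - q 0) p :=
          continuousAt_const.sub (continuous_simplex_apply _).continuousAt
        simpa [ContinuousAt, h] using this
    · exact (continuousAt_const.sub (continuous_simplex_apply _).continuousAt).mul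
        (((continuous_simplex_apply i).comp s.continuous).continuousAt.comp
          (continuousAt_normTail h))

theorem cone_apply (e : Simplex N) (s : C(Simplex k, Simplex N)) (p : Simplex (k + 1)) :
    cone e s p = mix (coord p 0) e (s (normTail p)) := rfl

theorem cone_apply_of_eq_one (e : Simplex N) (s : C(Simplex k, Simplex N)) {p : Simplex (k + 1)}
    (h : p 0 = 1) : cone e s p = e := by
  refine simplex_ext fun i => ?_
  rw [cone_apply, mix_apply, coe_coord, h]
  ring

theorem cone_comp_faceMap_zero (e : Simplex N) (s : C(Simplex k, Simplex N)) :
    (cone e s).comp (faceMap 0) = s := by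
  ext1 p
  have h0 : faceMap 0 p 0 = 0 := faceMap_self 0 p
  have h1 : normTail (faceMap 0 p) = p := by
    refine simplex_ext fun i => ?_
    rw [normTail_apply (by rw [h0]; norm_num), h0, ← Fin.succAbove_zero_apply, faceMap_succAbove]
    ring
  refine simplex_ext fun i => ?_
  rw [ContinuousMap.comp_apply, cone_apply, mix_apply, coe_coord, h0, h1]
  ring

theorem cone_comp_faceMap_succ (e : Simplex N) (s : C(Simplex (k + 1), Simplex N))
    (i : Fin (k + 2)) : (cone e s).comp (faceMap i.succ) = cone e (s.comp (faceMap i)) := by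
  ext1 p
  have h0 : faceMap i.succ p 0 = p 0 := by
    have := faceMap_succAbove i.succ p 0
    rwa [Fin.succ_succAbove_zero] at this
  by_cases h : p 0 = 1
  · rw [ContinuousMap.comp_apply, cone_apply_of_eq_one _ _ h, cone_apply_of_eq_one _ _ (h0.trans h)]
  have h1 : normTail (faceMap i.succ p) = faceMap i (normTail p) := by
    refine simplex_ext fun j => ?_
    rw [normTail_apply (by rwa [h0]), h0]
    obtain rfl | ⟨l, rfl⟩ := Fin.eq_self_or_eq_succAbove i j
    · rw [faceMap_self, faceMap_self, zero_div]
    · rw [faceMap_succAbove, normTail_apply h, ← Fin.succ_succAbove_succ, faceMap_succAbove]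
  have h2 : coord (faceMap i.succ p) 0 = coord p 0 := Subtype.ext h0
  rw [ContinuousMap.comp_apply, cone_apply, cone_apply, h1, h2, ContinuousMap.comp_apply]

theorem cone_comp_faceMap_one (e : Simplex N) (s : C(Simplex 0, Simplex N)) :
    (cone e s).comp (faceMap 1) = ContinuousMap.const _ e := by
  ext1 p
  refine cone_apply_of_eq_one e s ?_
  have := faceMap_succAbove 1 p 0
  rw [Fin.one_succAbove_zero] at this
  rw [this, ← stdSimplex.sum_eq_one p, Fin.sum_univ_one]

/-- The cone operator on chains of the standard simplex. -/
def coneChain (e : Simplex N) (k : ℕ) :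
    Chain ℤ (Simplex N) k →ₗ[ℤ] Chain ℤ (Simplex N) (k + 1) :=
  Finsupp.lmapDomain ℤ ℤ (cone e)

theorem coneChain_single (e : Simplex N) (s : C(Simplex k, Simplex N)) (a : ℤ) :
    coneChain e k (Finsupp.single s a) = Finsupp.single (cone e s) a :=
  Finsupp.mapDomain_single

/-- Facet 0 of a cone is its base; facet i + 1 is the cone on facet i of the base, and the shift of
the index reverses the sign. -/
theorem bd_coneChain (e : Simplex N) (c : Chain ℤ (Simplex N) (k + 1)) :
    bd ℤ (coneChain e (k + 1) c) = c - coneChain e k (bd ℤ c) := by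
  suffices h : (bd ℤ).comp (coneChain e (k + 1)) = LinearMap.id - (coneChain e k).comp (bd ℤ) from
    LinearMap.congr_fun h c
  refine chain_induction _ _ fun s => ?_
  rw [LinearMap.comp_apply, LinearMap.sub_apply, LinearMap.comp_apply, coneChain_single,
    boundary_single, boundary_single, Fin.sum_univ_succ, map_sum, face_eq, cone_comp_faceMap_zero,
    Fin.val_zero, pow_zero, one_smul, LinearMap.id_apply, sub_eq_add_neg, ← Finset.sum_neg_distrib]
  congr 1
  refine Finset.sum_congr rfl fun i _ => ?_
  rw [map_smul]
  erw [coneChain_single]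
  rw [face_eq, face_eq, cone_comp_faceMap_succ, Fin.val_succ, pow_succ, mul_neg_one, neg_smul]

/-- The cone on a point is a segment whose other end is the apex, so the apex occurs with the total
coefficient of the chain. -/
theorem bd_coneChain_zero (e : Simplex N) (c : Chain ℤ (Simplex N) 0) :
    bd ℤ (coneChain e 0 c) =
      c - augmentation c • Finsupp.single (ContinuousMap.const _ e) 1 := by
  suffices h : (bd ℤ).comp (coneChain e 0) = LinearMap.id - augmentation.smulRight
      (Finsupp.single (ContinuousMap.const (Simplex 0) e) (1 : ℤ)) from LinearMap.congr_fun h c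
  refine chain_induction _ _ fun s => ?_
  rw [LinearMap.comp_apply, LinearMap.sub_apply, LinearMap.smulRight_apply, coneChain_single,
    boundary_single, Fin.sum_univ_two, face_eq, face_eq, cone_comp_faceMap_zero,
    cone_comp_faceMap_one]
  simp [sub_eq_add_neg]

/-- The set `A` is star-shaped with respect to the point `e`. -/
def StarAt (e : Simplex N) (A : Set (Simplex N)) : Prop :=
  ∀ a ∈ A, ∀ t, mix t e a ∈ A

theorem coneChain_mem_chainsIn {e : Simplex N} {A : Set (Simplex N)} (h : StarAt e A)
    {c : Chain ℤ (Simplex N) k} (hc : c ∈ chainsIn ℤ A k) :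
    coneChain e k c ∈ chainsIn ℤ A (k + 1) := by
  refine mapDomain_mem_supported (fun s hs => ?_) hc
  rintro _ ⟨p, rfl⟩
  exact h _ (hs ⟨_, rfl⟩) _

/-- A chain of a star-shaped set that bounds in the simplex bounds in the set. -/
theorem StarAt.exists_bd {e : Simplex N} {A : Set (Simplex N)} (h : StarAt e A)
    {c : Chain ℤ (Simplex N) k} (hc : c ∈ chainsIn ℤ A k) {d : Chain ℤ (Simplex N) (k + 1)}
    (hd : bd ℤ d = c) : ∃ d' ∈ chainsIn ℤ A (k + 1), bd ℤ d' = c := by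
  refine ⟨coneChain e k c, coneChain_mem_chainsIn h hc, ?_⟩
  subst hd
  -- That c bounds somewhere makes the error term of the cone formula vanish: in degree 0 it kills
  -- the augmentation, in higher degrees it makes c a cycle.
  cases k with
  | zero => rw [bd_coneChain_zero, augmentation_boundary, zero_smul, sub_zero]
  | succ k => rw [bd_coneChain, show bd ℤ (bd ℤ d) = 0 from boundary_boundary d, map_zero, sub_zero]

theorem exists_bd_of_cycle {c : Chain ℤ (Simplex N) (k + 1)} (hc : bd ℤ c = 0) :
    ∃ d, bd ℤ d = c :=
  ⟨coneChain (stdSimplex.vertex 0) _ c, by rw [bd_coneChain, hc, map_zero, sub_zero]⟩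

end Cone

/-! ### Barycentric subdivision -/

section Subdivision

variable {X Y : Type*} [TopologicalSpace X] [TopologicalSpace Y]

/-- The natural operator on chains with value `m` on the identity of the standard simplex. -/
def natOp {k l : ℕ} (m : Chain ℤ (Simplex k) l) : Chain ℤ X k →ₗ[ℤ] Chain ℤ X l :=
  Finsupp.linearCombination ℤ fun s : C(Simplex k, X) => push s l m

variable {k l : ℕ}

@[simp]
theorem natOp_single (m : Chain ℤ (Simplex k) l) (s : C(Simplex k, X)) :
    natOp m (Finsupp.single s 1) = push s l m := by
  simp [natOp]

theorem natOp_push (m : Chain ℤ (Simplex k) l) (f : C(X, Y)) (c : Chain ℤ X k) :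
    natOp m (push f k c) = push f l (natOp m c) := by
  suffices h : (natOp m).comp (push f k) = (push f l).comp (natOp m) from LinearMap.congr_fun h c
  refine chain_induction _ _ fun s => ?_
  rw [LinearMap.comp_apply, LinearMap.comp_apply, push_single, natOp_single, natOp_single,
    push_push]

theorem natOp_mem_chainsIn (m : Chain ℤ (Simplex k) l) {S : Set X} {c : Chain ℤ X k}
    (hc : c ∈ chainsIn ℤ S k) : natOp m c ∈ chainsIn ℤ S l := by
  refine mem_of_supported hc ((chainsIn ℤ S l).comap (natOp m)) fun s hs => ?_
  rw [Submodule.mem_comap, natOp_single]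
  exact push_mem_chainsIn_univ hs m

/-- The barycentric subdivision of the standard simplex. -/
def sdModel : (k : ℕ) → Chain ℤ (Simplex k) k
  | 0 => idChain 0
  | k + 1 => coneChain stdSimplex.barycenter k (natOp (sdModel k) (bd ℤ (idChain (k + 1))))

theorem sdModel_succ (k : ℕ) : sdModel (k + 1) =
    coneChain stdSimplex.barycenter k (natOp (sdModel k) (bd ℤ (idChain (k + 1)))) := rfl

/-- The barycentric subdivision operator. -/
def sd (k : ℕ) : Chain ℤ X k →ₗ[ℤ] Chain ℤ X k := natOp (sdModel k)

/-- The value of the subdivision homotopy on the identity of the standard simplex. -/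
def sdHtpyModel : (k : ℕ) → Chain ℤ (Simplex k) (k + 1)
  | 0 => 0
  | k + 1 => coneChain stdSimplex.barycenter (k + 1) (idChain (k + 1) - sdModel (k + 1) -
      natOp (sdHtpyModel k) (bd ℤ (idChain (k + 1))))

theorem sdHtpyModel_succ (k : ℕ) : sdHtpyModel (k + 1) =
    coneChain stdSimplex.barycenter (k + 1) (idChain (k + 1) - sdModel (k + 1) -
      natOp (sdHtpyModel k) (bd ℤ (idChain (k + 1)))) := rfl

/-- The chain homotopy between the identity and the barycentric subdivision operator. -/
def sdHtpy (k : ℕ) : Chain ℤ X k →ₗ[ℤ] Chain ℤ X (k + 1) := natOp (sdHtpyModel k)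

theorem bd_natOp (m : Chain ℤ (Simplex k) (l + 1)) (c : Chain ℤ X k) :
    bd ℤ (natOp m c) = natOp (bd ℤ m) c := by
  suffices h : (bd ℤ).comp (natOp m) = natOp (X := X) (bd ℤ m) from LinearMap.congr_fun h c
  refine chain_induction _ _ fun s => ?_
  rw [LinearMap.comp_apply, natOp_single, natOp_single, bd_push]

/-- Composites of natural operators are again determined by their value on the identity simplex.
Identities between operators thereby reduce to identities between chains of the standard simplex. -/
theorem natOp_natOp {j : ℕ} (m : Chain ℤ (Simplex l) j) (m' : Chain ℤ (Simplex k) l)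
    (c : Chain ℤ X k) : natOp m (natOp m' c) = natOp (natOp m m') c := by
  suffices h : (natOp m).comp (natOp m') = natOp (X := X) (natOp m m') from
    LinearMap.congr_fun h c
  refine chain_induction _ _ fun s => ?_
  rw [LinearMap.comp_apply, natOp_single, natOp_single, natOp_push]

theorem natOp_sub (m m' : Chain ℤ (Simplex k) l) (c : Chain ℤ X k) :
    natOp (m - m') c = natOp m c - natOp m' c := by
  suffices h : natOp (X := X) (m - m') = natOp m - natOp m' from LinearMap.congr_fun h c
  refine chain_induction _ _ fun s => ?_
  rw [LinearMap.sub_apply, natOp_single, natOp_single, natOp_single, map_sub]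

theorem natOp_zero (c : Chain ℤ X k) : natOp (0 : Chain ℤ (Simplex k) l) c = 0 := by
  rw [← sub_self 0, natOp_sub, sub_self]

theorem natOp_id (c : Chain ℤ X k) : natOp (idChain k) c = c := by
  suffices h : natOp (idChain k) = LinearMap.id (R := ℤ) (M := Chain ℤ X k) from
    LinearMap.congr_fun h c
  refine chain_induction _ _ fun s => ?_
  rw [natOp_single, push_idChain, LinearMap.id_apply]

/-- The boundary is itself a natural operator, so `natOp_natOp` also applies to composites with it.
-/
theorem bd_eq_natOp (c : Chain ℤ X (k + 1)) : bd ℤ c = natOp (bd ℤ (idChain (k + 1))) c := by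
  rw [← bd_natOp, natOp_id]

theorem sd_zero (c : Chain ℤ X 0) : sd 0 c = c := natOp_id c

/-- The cone formula leaves an error term on the boundary of the subdivided facets. By induction
this is the subdivision of a boundary of a boundary; in the lowest degree the augmentation vanishes
instead. -/
theorem bd_sdModel (k : ℕ) :
    bd ℤ (sdModel (k + 1)) = natOp (sdModel k) (bd ℤ (idChain (k + 1))) := by
  induction k with
  | zero =>
    rw [sdModel_succ, bd_coneChain_zero, sdModel, natOp_id, augmentation_boundary, zero_smul, sub_zero]
  | succ k ih =>
    rw [sdModel_succ, bd_coneChain, bd_natOp, ih, ← natOp_natOp, ← bd_eq_natOp,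
      show bd ℤ (bd ℤ (idChain (k + 2))) = 0 from boundary_boundary _, map_zero, map_zero,
      sub_zero]

theorem bd_sd (c : Chain ℤ X (k + 1)) : bd ℤ (sd (k + 1) c) = sd k (bd ℤ c) := by
  rw [sd, bd_natOp, bd_sdModel, ← natOp_natOp, ← bd_eq_natOp]
  rfl

theorem boundary_sd (c : Chain ℤ X k) :
    boundary ℤ X k (sd k c) = sd (k - 1) (boundary ℤ X k c) := by
  cases k with
  | zero => rw [boundary_zero, boundary_zero, map_zero]
  | succ k => exact bd_sd c

/-- Acyclic models: the chain under the cone is a cycle, by the formula one degree lower, and the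
cone on a cycle of positive degree bounds it. -/
theorem bd_sdHtpyModel (k : ℕ) : bd ℤ (sdHtpyModel (k + 1)) = idChain (k + 1) - sdModel (k + 1) -
    natOp (sdHtpyModel k) (bd ℤ (idChain (k + 1))) := by
  rw [sdHtpyModel_succ, bd_coneChain, sub_eq_self]
  suffices h : bd ℤ (idChain (k + 1) - sdModel (k + 1) -
      natOp (sdHtpyModel k) (bd ℤ (idChain (k + 1)))) = 0 by rw [h, map_zero]
  induction k with
  | zero =>
    rw [map_sub, map_sub, bd_sdModel, sdModel, natOp_id, sub_self, sdHtpyModel, natOp_zero,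
      map_zero, sub_zero]
  | succ k ih =>
    rw [map_sub, map_sub, bd_sdModel, bd_natOp, sdHtpyModel_succ, bd_coneChain, ih, map_zero,
      sub_zero, natOp_sub, natOp_sub, natOp_id, ← natOp_natOp, ← bd_eq_natOp,
      show bd ℤ (bd ℤ (idChain (k + 2))) = 0 from boundary_boundary _, map_zero, sub_zero, sub_self]

theorem bd_sdHtpy (c : Chain ℤ X (k + 1)) :
    bd ℤ (sdHtpy (k + 1) c) = c - sd (k + 1) c - sdHtpy k (bd ℤ c) := by
  rw [sdHtpy, bd_natOp, bd_sdHtpyModel, natOp_sub, natOp_sub, natOp_id, ← natOp_natOp,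
    ← bd_eq_natOp]
  rfl

/-- The iterated barycentric subdivision operator. -/
def sdIter (m k : ℕ) : Chain ℤ X k →ₗ[ℤ] Chain ℤ X k := (sd k : Module.End ℤ (Chain ℤ X k)) ^ m

theorem sdIter_zero (c : Chain ℤ X k) : sdIter 0 k c = c := by
  rw [sdIter, pow_zero, Module.End.one_apply]

theorem sdIter_succ (m : ℕ) (c : Chain ℤ X k) : sdIter (m + 1) k c = sdIter m k (sd k c) := by
  rw [sdIter, pow_succ, Module.End.mul_apply]
  rfl

theorem sdIter_succ' (m : ℕ) (c : Chain ℤ X k) : sdIter (m + 1) k c = sd k (sdIter m k c) := by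
  rw [sdIter, pow_succ', Module.End.mul_apply]
  rfl

theorem sdIter_mem_chainsIn (m : ℕ) {S : Set X} {c : Chain ℤ X k} (hc : c ∈ chainsIn ℤ S k) :
    sdIter m k c ∈ chainsIn ℤ S k := by
  induction m with
  | zero => rwa [sdIter_zero]
  | succ m ih => rw [sdIter_succ']; exact natOp_mem_chainsIn _ ih

theorem boundary_sdIter (m : ℕ) (c : Chain ℤ X k) :
    boundary ℤ X k (sdIter m k c) = sdIter m (k - 1) (boundary ℤ X k c) := by
  induction m with
  | zero => rw [sdIter_zero, sdIter_zero]
  | succ m ih => rw [sdIter_succ', boundary_sd, ih, sdIter_succ']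

/-- A chain and its subdivision are homologous, up to chains that contain the boundary. -/
theorem exists_sub_sdIter (m : ℕ) {S T : Set X} {c : Chain ℤ X k} (hc : c ∈ chainsIn ℤ S k)
    (hc' : boundary ℤ X k c ∈ chainsIn ℤ T (k - 1)) :
    ∃ w ∈ chainsIn ℤ S (k + 1), ∃ r ∈ chainsIn ℤ T k, c - sdIter m k c = bd ℤ w + r := by
  have key : ∀ c : Chain ℤ X k, c ∈ chainsIn ℤ S k → boundary ℤ X k c ∈ chainsIn ℤ T (k - 1) →
      ∃ w ∈ chainsIn ℤ S (k + 1), ∃ r ∈ chainsIn ℤ T k, c - sd k c = bd ℤ w + r := by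
    intro c hc hc'
    cases k with
    | zero =>
      exact ⟨0, Submodule.zero_mem _, 0, Submodule.zero_mem _, by
        rw [sd_zero, map_zero, sub_self, add_zero]⟩
    | succ k =>
      -- In the homotopy formula the term that depends on the boundary of c stays in every set T
      -- that contains this boundary.
      exact ⟨_, natOp_mem_chainsIn (sdHtpyModel (k + 1)) hc, _,
        natOp_mem_chainsIn (sdHtpyModel k) hc', by
        rw [← sdHtpy, bd_sdHtpy, ← sdHtpy, sub_add_cancel]⟩
  induction m generalizing c with
  | zero =>
    exact ⟨0, Submodule.zero_mem _, 0, Submodule.zero_mem _, by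
      rw [sdIter_zero, map_zero, sub_self, add_zero]⟩
  | succ m ih =>
    obtain ⟨w, hw, r, hr, h⟩ := key c hc hc'
    obtain ⟨w', hw', r', hr', h'⟩ := ih (natOp_mem_chainsIn (sdModel k) hc) (by
      rw [← sd, boundary_sd]
      exact natOp_mem_chainsIn _ hc')
    refine ⟨w + w', Submodule.add_mem _ hw hw', r + r', Submodule.add_mem _ hr hr', ?_⟩
    rw [← sd] at h'
    rw [sdIter_succ, ← sub_add_sub_cancel c (sd k c), h, h', map_add]
    abel

/-! ### The simplices of a subdivision are small -/

/-- The `ℓ¹`-distance of two points of a simplex. -/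
def l1Dist (p q : Simplex k) : ℝ := ∑ j, |p j - q j|

/-- The affine singular simplices whose vertices have mutual `ℓ¹`-distance at most `2ρ`. -/
def affineSimplices (ρ : ℝ) (l k : ℕ) : Set C(Simplex l, Simplex k) :=
  {s | (∀ p j, s p j = ∑ a, p a * s (stdSimplex.vertex a) j) ∧
    ∀ a b, l1Dist (s (stdSimplex.vertex a)) (s (stdSimplex.vertex b)) ≤ 2 * ρ}

theorem l1Dist_comm (p q : Simplex k) : l1Dist p q = l1Dist q p :=
  Finset.sum_congr rfl fun _ _ => abs_sub_comm _ _

theorem l1Dist_self (p : Simplex k) : l1Dist p p = 0 := by simp [l1Dist]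

/-- For b = 1 / (k + 1) and 0 ≤ x ≤ 1 one has |b - x| ≤ b + x - 2bx, with equality at x = 0 and x =
1. Summation over the coordinates gives 2 - 2b. -/
theorem l1Dist_barycenter_le (p : Simplex k) :
    l1Dist stdSimplex.barycenter p ≤ 2 * (k / (k + 1)) := by
  have h : ∀ j, |(stdSimplex.barycenter : Simplex k) j - p j| ≤
      (stdSimplex.barycenter : Simplex k) j + p j - 2 * ((k + 1 : ℝ)⁻¹ * p j) := by
    intro j
    have h1 : (stdSimplex.barycenter : Simplex k) j = (k + 1 : ℝ)⁻¹ := by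
      change (Fintype.card (Fin (k + 1)) : ℝ)⁻¹ = _
      simp
    have h2 := stdSimplex.le_one p j
    have h3 := stdSimplex.zero_le p j
    have h4 := stdSimplex.le_one (stdSimplex.barycenter : Simplex k) j
    rw [h1] at h4 ⊢
    have h5 : (0 : ℝ) ≤ (k + 1 : ℝ)⁻¹ := by positivity
    rw [abs_le]
    constructor <;> nlinarith
  refine (Finset.sum_le_sum fun j _ => h j).trans (le_of_eq ?_)
  rw [Finset.sum_sub_distrib, Finset.sum_add_distrib, ← Finset.mul_sum, ← Finset.mul_sum,
    stdSimplex.sum_eq_one, stdSimplex.sum_eq_one]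
  field_simp
  ring

theorem l1Dist_faceMap (i : Fin (k + 2)) (p q : Simplex k) :
    l1Dist (faceMap i p) (faceMap i q) = l1Dist p q := by
  rw [l1Dist, Fin.sum_univ_succAbove _ i]
  simp [l1Dist]

/-- The vertices of a subdivided facet satisfy the bound of the lower dimension, which is smaller
because k / (k + 1) increases with k. The new edges start at the barycenter and are controlled by
`l1Dist_barycenter_le`. -/
theorem sdModel_mem (k : ℕ) :
    sdModel k ∈ Finsupp.supported ℤ ℤ (affineSimplices (k / (k + 1)) k k) := by
  induction k with
  | zero =>
    refine Finsupp.single_mem_supported _ _ ⟨fun p j => ?_, fun a b => ?_⟩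
    · simp [Fin.fin_one_eq_zero]
    · obtain rfl : a = b := by omega
      rw [l1Dist_self]
      simp
  | succ k ih =>
    have h : natOp (sdModel k) (bd ℤ (idChain (k + 1))) ∈
        Finsupp.supported ℤ ℤ (affineSimplices (k / (k + 1)) k (k + 1)) := by
      rw [idChain, boundary_single, map_sum]
      refine Submodule.sum_mem _ fun i _ => ?_
      rw [map_smul]
      refine Submodule.smul_mem _ _ ?_
      erw [natOp_single]
      refine mapDomain_mem_supported (fun s hs => ?_) ih
      refine ⟨fun p j => ?_, fun a b => ?_⟩
      · simp only [ContinuousMap.comp_apply, face_eq, ContinuousMap.id_comp]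
        obtain rfl | ⟨j, rfl⟩ := Fin.eq_self_or_eq_succAbove i j
        · simp
        · simp only [faceMap_succAbove]
          exact hs.1 p j
      · refine le_of_eq_of_le ?_ (hs.2 a b)
        exact l1Dist_faceMap _ _ _
    refine mapDomain_mem_supported (fun s hs => ?_) h
    have h0 : cone stdSimplex.barycenter s (stdSimplex.vertex 0) = stdSimplex.barycenter :=
      cone_apply_of_eq_one _ _ (by simp)
    have h1 : ∀ a, cone stdSimplex.barycenter s (stdSimplex.vertex (Fin.succ a)) =
        s (stdSimplex.vertex a) := by
      intro a
      conv_rhs => rw [← cone_comp_faceMap_zero stdSimplex.barycenter s]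
      rw [ContinuousMap.comp_apply]
      congr 1
      exact (stdSimplex.map_vertex (Fin.succAbove 0) a).symm
    have hk : (k / (k + 1) : ℝ) ≤ (k + 1 : ℕ) / ((k + 1 : ℕ) + 1) := by
      push_cast
      rw [div_le_div_iff₀ (by positivity) (by positivity)]
      nlinarith
    refine ⟨fun p j => ?_, fun a b => ?_⟩
    · rw [Fin.sum_univ_succ, h0, cone_apply, mix_apply, hs.1, Finset.mul_sum, coe_coord]
      congr 1
      refine Finset.sum_congr rfl fun a _ => ?_
      rw [h1, ← mul_assoc, mul_normTail]
    · refine Fin.cases ?_ (fun a => ?_) a <;> refine Fin.cases ?_ (fun b => ?_) b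
      · rw [l1Dist_self]; positivity
      · rw [h0]; exact l1Dist_barycenter_le _
      · rw [h0, l1Dist_comm]; exact l1Dist_barycenter_le _
      · rw [h1, h1]
        exact (hs.2 a b).trans (by linarith)

/-- Write p - q = u - v with nonnegative parts of the same mass P, half the distance of p and q.
Then P (s p - s q) is the sum of the differences of the vertices a and b of s with weights u a * v
b. Each difference has norm at most 2ρ and the weights add up to P², whence the Lipschitz constant
ρ; the factor 2 is the distance of two distinct vertices of a standard simplex. -/
theorem l1Dist_le_of_affine {ρ : ℝ} {s : C(Simplex l, Simplex k)}
    (hs : s ∈ affineSimplices ρ l k) (p q : Simplex l) :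
    l1Dist (s p) (s q) ≤ ρ * l1Dist p q := by
  set w : Fin (l + 1) → Fin (k + 1) → ℝ := fun a j => s (stdSimplex.vertex a) j with hw
  set u : Fin (l + 1) → ℝ := fun a => max (p a - q a) 0 with hu
  set v : Fin (l + 1) → ℝ := fun a => max (q a - p a) 0 with hv
  have hu0 : ∀ a, 0 ≤ u a := fun a => le_max_right _ _
  have hv0 : ∀ a, 0 ≤ v a := fun a => le_max_right _ _
  have huv : ∀ a, u a - v a = p a - q a := by
    intro a
    simp only [hu, hv]
    rcases le_total (p a) (q a) with h | h
    · rw [max_eq_right (by linarith), max_eq_left (by linarith)]; ring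
    · rw [max_eq_left (by linarith), max_eq_right (by linarith)]; ring
  -- The two parts have disjoint supports.
  have huv' : ∀ a, u a + v a = |p a - q a| := by
    intro a
    simp only [hu, hv]
    rcases le_total (p a) (q a) with h | h
    · rw [max_eq_right (by linarith), max_eq_left (by linarith), abs_of_nonpos (by linarith)]; ring
    · rw [max_eq_left (by linarith), max_eq_right (by linarith), abs_of_nonneg (by linarith)]; ring
  have hsum : ∑ a, u a = ∑ a, v a := by
    rw [← sub_eq_zero, ← Finset.sum_sub_distrib, Finset.sum_congr rfl fun a _ => huv a,
      Finset.sum_sub_distrib, stdSimplex.sum_eq_one, stdSimplex.sum_eq_one, sub_self]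
  set P := ∑ a, u a with hP
  have hd : l1Dist p q = 2 * P := by
    rw [l1Dist, ← Finset.sum_congr rfl fun a _ => huv' a, Finset.sum_add_distrib, ← hsum]
    ring
  have hP0 : 0 ≤ P := Finset.sum_nonneg fun a _ => hu0 a
  have hdiff : ∀ j, s p j - s q j = ∑ a, (u a - v a) * w a j := by
    intro j
    rw [hs.1, hs.1 q, ← Finset.sum_sub_distrib]
    exact Finset.sum_congr rfl fun a _ => by rw [huv, sub_mul]
  rcases hP0.eq_or_lt with h | h
  · have hu1 : ∀ a, u a = 0 := fun a =>
      (Finset.sum_eq_zero_iff_of_nonneg fun a _ => hu0 a).1 h.symm a (Finset.mem_univ a)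
    have hv1 : ∀ a, v a = 0 := fun a =>
      (Finset.sum_eq_zero_iff_of_nonneg fun a _ => hv0 a).1 (hsum ▸ h.symm) a (Finset.mem_univ a)
    have : l1Dist (s p) (s q) = 0 := by
      rw [l1Dist]
      refine Finset.sum_eq_zero fun j _ => ?_
      rw [hdiff]
      simp [hu1, hv1]
    rw [this, hd, ← h]
    simp
  · have hexp : ∀ j, P * (s p j - s q j) = ∑ a, ∑ b, u a * v b * (w a j - w b j) := by
      intro j
      have e1 : ∑ a, ∑ b, u a * v b * (w a j - w b j) =
          (∑ a, u a * w a j) * (∑ b, v b) - (∑ a, u a) * (∑ b, v b * w b j) := by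
        rw [Finset.sum_mul_sum, Finset.sum_mul_sum, ← Finset.sum_sub_distrib]
        refine Finset.sum_congr rfl fun a _ => ?_
        rw [← Finset.sum_sub_distrib]
        exact Finset.sum_congr rfl fun b _ => by ring
      rw [e1, ← hsum, hdiff, Finset.sum_congr rfl fun a _ => sub_mul (u a) (v a) (w a j),
        Finset.sum_sub_distrib]
      ring
    have hle : P * l1Dist (s p) (s q) ≤ P * (ρ * l1Dist p q) := by
      rw [l1Dist, Finset.mul_sum]
      calc ∑ j, P * |s p j - s q j| = ∑ j, |∑ a, ∑ b, u a * v b * (w a j - w b j)| := by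
            refine Finset.sum_congr rfl fun j _ => ?_
            rw [← hexp, abs_mul, abs_of_pos h]
        _ ≤ ∑ j, ∑ a, ∑ b, u a * v b * |w a j - w b j| := by
            refine Finset.sum_le_sum fun j _ => ?_
            refine (Finset.abs_sum_le_sum_abs _ _).trans (Finset.sum_le_sum fun a _ => ?_)
            refine (Finset.abs_sum_le_sum_abs _ _).trans (Finset.sum_le_sum fun b _ => ?_)
            rw [abs_mul, abs_of_nonneg (mul_nonneg (hu0 a) (hv0 b))]
        _ = ∑ a, ∑ b, u a * v b * ∑ j, |w a j - w b j| := by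
            rw [Finset.sum_comm]
            refine Finset.sum_congr rfl fun a _ => ?_
            rw [Finset.sum_comm]
            refine Finset.sum_congr rfl fun b _ => ?_
            rw [Finset.mul_sum]
        _ ≤ ∑ a, ∑ b, u a * v b * (2 * ρ) := by
            refine Finset.sum_le_sum fun a _ => Finset.sum_le_sum fun b _ => ?_
            exact mul_le_mul_of_nonneg_left (hs.2 a b) (mul_nonneg (hu0 a) (hv0 b))
        _ = P * (ρ * l1Dist p q) := by
            simp_rw [← Finset.sum_mul]
            rw [← Finset.sum_mul_sum, ← hsum, hd]
            ring
    exact le_of_mul_le_mul_left hle h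

/-- Every further subdivision precomposes with one more affine simplex and contributes one more
contraction factor. -/
theorem sdIter_single_mem (m : ℕ) (s : C(Simplex k, X)) :
    sdIter m k (Finsupp.single s 1) ∈ Finsupp.supported ℤ ℤ
      {s' : C(Simplex k, X) | ∃ t : C(Simplex k, Simplex k), s' = s.comp t ∧
        ∀ p q, l1Dist (t p) (t q) ≤ (k / (k + 1) : ℝ) ^ m * l1Dist p q} := by
  induction m with
  | zero =>
    rw [sdIter_zero]
    exact Finsupp.single_mem_supported _ _ ⟨ContinuousMap.id _, rfl, fun p q => by simp⟩
  | succ m ih =>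
    rw [sdIter_succ']
    refine mem_of_supported ih (Submodule.comap (sd k) (Finsupp.supported ℤ ℤ _)) ?_
    rintro _ ⟨t, rfl, ht⟩
    rw [Submodule.mem_comap, sd, natOp_single]
    refine mapDomain_mem_supported (fun t' ht' => ?_) (sdModel_mem k)
    refine ⟨t.comp t', rfl, fun p q => ?_⟩
    refine (ht _ _).trans ?_
    rw [pow_succ, mul_assoc]
    exact mul_le_mul_of_nonneg_left (l1Dist_le_of_affine ht' p q) (by positivity)

theorem dist_le_l1Dist (p q : Simplex k) : dist p q ≤ l1Dist p q := by
  rw [Subtype.dist_eq, l1Dist, dist_pi_le_iff (Finset.sum_nonneg fun _ _ => abs_nonneg _)]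
  intro j
  rw [Real.dist_eq]
  exact Finset.single_le_sum (f := fun j => |p j - q j|) (fun _ _ => abs_nonneg _)
    (Finset.mem_univ j)

theorem l1Dist_le_two (p q : Simplex k) : l1Dist p q ≤ 2 := by
  have h : ∀ j, |p j - q j| ≤ p j + q j := fun j => by
    rw [abs_le]
    constructor <;> linarith [stdSimplex.zero_le p j, stdSimplex.zero_le q j]
  refine (Finset.sum_le_sum fun j _ => h j).trans (le_of_eq ?_)
  rw [Finset.sum_add_distrib, stdSimplex.sum_eq_one, stdSimplex.sum_eq_one]
  norm_num

/-- Iterated barycentric subdivision makes the simplices of a chain subordinate to an open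
cover. -/
theorem eventually_sdIter_small {𝒰 : Set (Set X)} (h𝒰 : ∀ U ∈ 𝒰, IsOpen U) {c : Chain ℤ X k}
    (hc : c ∈ chainsIn ℤ (⋃₀ 𝒰) k) :
    ∀ᶠ m in Filter.atTop, sdIter m k c ∈ Finsupp.supported ℤ ℤ
      {s : C(Simplex k, X) | ∃ U ∈ 𝒰, Set.range s ⊆ U} := by
  have key : ∀ s ∈ c.support, ∀ᶠ m in Filter.atTop, sdIter m k (Finsupp.single s 1) ∈
      Finsupp.supported ℤ ℤ {s : C(Simplex k, X) | ∃ U ∈ 𝒰, Set.range s ⊆ U} := by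
    intro s hs
    obtain ⟨δ, hδ, hL⟩ := lebesgue_number_lemma_of_metric (s := (Set.univ : Set (Simplex k)))
      (c := fun U : 𝒰 => s ⁻¹' U) isCompact_univ (fun U => (h𝒰 U U.2).preimage s.continuous)
      (fun p _ => by
        obtain ⟨U, hU, hp⟩ := hc hs ⟨p, rfl⟩
        exact Set.mem_iUnion.2 ⟨⟨U, hU⟩, hp⟩)
    have hlim : Filter.Tendsto (fun m : ℕ => (k / (k + 1) : ℝ) ^ m * 2) Filter.atTop (𝓝 0) := by
      have := (tendsto_pow_atTop_nhds_zero_of_lt_one (r := (k / (k + 1) : ℝ)) (by positivity)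
        ((div_lt_one (by positivity)).2 (by linarith))).mul_const 2
      rwa [zero_mul] at this
    filter_upwards [hlim.eventually (gt_mem_nhds hδ)] with m hm
    refine Finsupp.supported_mono ?_ (sdIter_single_mem m s)
    rintro _ ⟨t, rfl, ht⟩
    obtain ⟨⟨U, hU⟩, hsub⟩ := hL (t (stdSimplex.vertex 0)) (Set.mem_univ _)
    refine ⟨U, hU, ?_⟩
    rintro _ ⟨p, rfl⟩
    refine hsub (Metric.mem_ball.2 (lt_of_le_of_lt ((dist_le_l1Dist _ _).trans (ht _ _)) ?_))
    exact lt_of_le_of_lt (mul_le_mul_of_nonneg_left (l1Dist_le_two _ _) (by positivity)) hm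
  filter_upwards [(Filter.eventually_all_finset c.support).2 key] with m hm
  rw [← Finsupp.sum_single c, Finsupp.sum, map_sum]
  refine Submodule.sum_mem _ fun s hs => ?_
  rw [← mul_one (c s), ← smul_eq_mul, ← Finsupp.smul_single, map_smul]
  exact Submodule.smul_mem _ _ (hm s hs)

end Subdivision

/-! ### Excision -/

section Excision

variable {X Y : Type*} [TopologicalSpace X] [TopologicalSpace Y] {k : ℕ}

theorem exists_sdIter_eq_add {U V : Set X} (hU : IsOpen U) (hV : IsOpen V) {c : Chain ℤ X k}
    (hc : c ∈ chainsIn ℤ (U ∪ V) k) :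
    ∃ m, ∃ a ∈ chainsIn ℤ U k, ∃ b ∈ chainsIn ℤ V k, a + b = sdIter m k c := by
  have h := eventually_sdIter_small (𝒰 := {U, V}) (by rintro _ (rfl | rfl) <;> assumption)
    (c := c) (by rwa [Set.sUnion_pair])
  obtain ⟨m, hm⟩ := h.exists
  refine ⟨m, exists_add_of_supported (Finsupp.supported_mono ?_ hm)⟩
  rintro s ⟨_, rfl | rfl, hs⟩
  · exact Or.inl hs
  · exact Or.inr hs

theorem sub_sdIter_mem_relBoundaries (m : ℕ) {S : Set X} {c : Chain ℤ X k}
    (hc : c ∈ relCycles ℤ S k) : c - sdIter m k c ∈ relBoundaries ℤ S k := by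
  obtain ⟨w, -, r, hr, h⟩ := exists_sub_sdIter m (mem_chainsIn_univ c) hc
  exact mem_relBoundaries.2 ⟨r, hr, w, by rw [h, add_comm]⟩

/-- Surjectivity part of excision. -/
theorem exists_mem_chainsIn_of_relCycle {W S : Set X} (hW : IsOpen W) (hS : IsOpen S)
    (hWS : W ∪ S = Set.univ) {c : Chain ℤ X k} (hc : c ∈ relCycles ℤ S k) :
    ∃ a ∈ chainsIn ℤ W k, a ∈ relCycles ℤ S k ∧ c - a ∈ relBoundaries ℤ S k := by
  obtain ⟨m, a, ha, b, hb, hab⟩ :=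
    exists_sdIter_eq_add hW hS (c := c) (by rw [hWS]; exact mem_chainsIn_univ c)
  have h : c - a ∈ relBoundaries ℤ S k := by
    have := Submodule.add_mem _ (sub_sdIter_mem_relBoundaries m hc) (chainsIn_le_relBoundaries hb)
    rwa [← hab, sub_add_eq_sub_sub, sub_add_cancel] at this
  refine ⟨a, ha, ?_, h⟩
  have := Submodule.sub_mem _ hc (relBoundaries_le_relCycles h)
  rwa [sub_sub_cancel] at this

/-- Injectivity part of excision. -/
theorem exists_bd_mem_chainsIn {W S : Set X} (hW : IsOpen W) (hS : IsOpen S)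
    (hWS : W ∪ S = Set.univ) {a : Chain ℤ X k} (ha : a ∈ chainsIn ℤ W k)
    (ha' : a ∈ relBoundaries ℤ S k) :
    ∃ d ∈ chainsIn ℤ W (k + 1), a - bd ℤ d ∈ chainsIn ℤ S k := by
  have hcyc := relBoundaries_le_relCycles ha'
  obtain ⟨c, hc, d, rfl⟩ := mem_relBoundaries.1 ha'
  obtain ⟨m, d1, hd1, d2, hd2, hd⟩ :=
    exists_sdIter_eq_add hW hS (c := d) (by rw [hWS]; exact mem_chainsIn_univ d)
  obtain ⟨w, hw, r, hr, h⟩ := exists_sub_sdIter m ha hcyc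
  -- The part d1 of the subdivided bounding chain bounds the subdivision of a up to chains in S, and
  -- w joins a to its subdivision.
  refine ⟨d1 + w, Submodule.add_mem _ hd1 hw, ?_⟩
  have e1 : sdIter m k (bd ℤ d) = bd ℤ d1 + bd ℤ d2 := by
    rw [← map_add, hd]
    exact (boundary_sdIter m d).symm
  have e2 : c + bd ℤ d - bd ℤ (d1 + w) = r + sdIter m k c + bd ℤ d2 := by
    rw [eq_add_of_sub_eq h, map_add, map_add, e1]
    abel
  rw [e2]
  exact Submodule.add_mem _ (Submodule.add_mem _ hr (sdIter_mem_chainsIn m hc))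
    (boundary_mem_chainsIn hd2)

/-- By excision the bounding chain can be taken in W and the remainder in W ∩ S, so no condition on
f is needed on the rest of S. -/
theorem push_mem_relBoundaries_of_local {f : C(X, Y)} {W S : Set X} {T : Set Y} (hW : IsOpen W)
    (hS : IsOpen S) (hWS : W ∪ S = Set.univ) (hf : Set.MapsTo f (W ∩ S) T) {a : Chain ℤ X k}
    (ha : a ∈ chainsIn ℤ W k) (ha' : a ∈ relBoundaries ℤ S k) :
    push f k a ∈ relBoundaries ℤ T k := by
  obtain ⟨d, hd, h⟩ := exists_bd_mem_chainsIn hW hS hWS ha ha'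
  have h' := chainsIn_inter (Submodule.sub_mem _ ha (boundary_mem_chainsIn hd)) h
  refine mem_relBoundaries.2 ⟨_, push_mem_chainsIn hf h', push f (k + 1) d, ?_⟩
  rw [bd_push, map_sub, sub_add_cancel]

theorem exists_push_eq {f : C(X, Y)} {W : Set X} (hf : Topology.IsOpenEmbedding fun w : W => f w)
    {c : Chain ℤ Y k} (hc : c ∈ chainsIn ℤ (f '' W) k) :
    ∃ c' ∈ chainsIn ℤ W k, push f k c' = c := by
  refine mem_of_supported hc ((chainsIn ℤ W k).map (push f k)) fun s hs => ?_
  have hs' : ∀ p, ∃ w : W, f w = s p := fun p => by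
    obtain ⟨w, hw, h⟩ := hs ⟨p, rfl⟩
    exact ⟨⟨w, hw⟩, h⟩
  choose g hg using hs'
  have hgc : Continuous g := by
    rw [hf.isInducing.continuous_iff]
    exact s.continuous.congr fun p => (hg p).symm
  refine ⟨Finsupp.single ⟨fun p => g p, continuous_subtype_val.comp hgc⟩ 1,
    single_mem_chainsIn ?_ _, ?_⟩
  · rintro _ ⟨p, rfl⟩
    exact (g p).2
  · rw [push_single]
    congr 1
    ext p
    exact hg p

/-- Injectivity on W rules out cancellation between pushed simplices, so every simplex of c is still
visible in the image chain. -/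
theorem mem_chainsIn_preimage_of_injOn {f : C(X, Y)} {W : Set X} (hf : Set.InjOn f W) {T : Set Y}
    {c : Chain ℤ X k} (hc : c ∈ chainsIn ℤ W k) (hc' : push f k c ∈ chainsIn ℤ T k) :
    c ∈ chainsIn ℤ (f ⁻¹' T) k := by
  classical
  intro s hs
  have hinj : Set.InjOn (fun s : C(Simplex k, X) => f.comp s) c.support := by
    intro s hs s' hs' h
    ext p
    exact hf (hc hs ⟨p, rfl⟩) (hc hs' ⟨p, rfl⟩) (DFunLike.congr_fun h p)
  have h1 : f.comp s ∈ (push f k c).support := by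
    change _ ∈ (Finsupp.mapDomain _ c).support
    rw [Finsupp.mapDomain_support_of_injOn _ hinj]
    exact Finset.mem_image_of_mem _ hs
  rintro _ ⟨p, rfl⟩
  exact hc' h1 ⟨p, rfl⟩

/-- Excision moves the bounding chain into the open set f(W), from where it is pulled back along the
embedding. -/
theorem mem_relBoundaries_of_push {f : C(X, Y)} {W S : Set X} {T : Set Y}
    (hf : Topology.IsOpenEmbedding fun w : W => f w) (hT : IsOpen T) (hWT : f '' W ∪ T = Set.univ)
    (hS : W ∩ f ⁻¹' T ⊆ S) {a : Chain ℤ X k} (ha : a ∈ chainsIn ℤ W k)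
    (ha' : push f k a ∈ relBoundaries ℤ T k) : a ∈ relBoundaries ℤ S k := by
  have hopen : IsOpen (f '' W) := by
    have := hf.isOpen_range
    rwa [show (Set.range fun w : W => f w) = f '' W by rw [Set.image_eq_range]] at this
  obtain ⟨d, hd, h⟩ := exists_bd_mem_chainsIn hopen hT hWT
    (push_mem_chainsIn (Set.mapsTo_image f W) ha) ha'
  obtain ⟨d', hd', rfl⟩ := exists_push_eq hf hd
  rw [bd_push, ← map_sub] at h
  have h1 := Submodule.sub_mem _ ha (boundary_mem_chainsIn hd')
  have h2 := chainsIn_inter h1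
    (mem_chainsIn_preimage_of_injOn (Set.injOn_iff_injective.2 hf.injective) h1 h)
  exact mem_relBoundaries.2 ⟨_, chainsIn_mono hS k h2, d', by rw [sub_add_cancel]⟩

end Excision

/-! ### The local homology of the standard simplex at an interior point -/

section LocalSimplex

variable {N k : ℕ}

/-! ### Mayer–Vietoris for two subsets of a simplex. -/

/-- Injectivity of the connecting map, which sends z to the part b of its boundary. If b bounds
modulo s in A ∩ B, then b - s bounds some w in the star-shaped set B and a + s bounds some v in A;
the cycle z - w - v bounds in the simplex. -/
theorem mem_relBoundaries_union_of_star {e e' : Simplex N} {A B : Set (Simplex N)}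
    (hA : StarAt e A) (hB : StarAt e' B) {z : Chain ℤ (Simplex N) (k + 1)}
    {a b : Chain ℤ (Simplex N) k} (ha : a ∈ chainsIn ℤ A k) (hb : b ∈ chainsIn ℤ B k)
    (hz : bd ℤ z = a + b) (hb' : b ∈ relBoundaries ℤ (A ∩ B) k) :
    z ∈ relBoundaries ℤ (A ∪ B) (k + 1) := by
  obtain ⟨s, hs, d, hd⟩ := mem_relBoundaries.1 hb'
  obtain ⟨w, hw, hbw⟩ := hB.exists_bd (c := b - s)
    (Submodule.sub_mem _ hb (chainsIn_mono Set.inter_subset_right _ hs)) (d := d)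
    (by rw [hd, add_sub_cancel_left])
  obtain ⟨v, hv, hav⟩ := hA.exists_bd (c := a + s)
    (Submodule.add_mem _ ha (chainsIn_mono Set.inter_subset_left _ hs)) (d := z - w)
    (by rw [map_sub, hz, hbw]; abel)
  obtain ⟨y, hy⟩ := exists_bd_of_cycle (c := z - w - v) (by
    rw [map_sub, map_sub, hz, hbw, hav]
    abel)
  refine mem_relBoundaries.2 ⟨w + v, Submodule.add_mem _
    (chainsIn_mono Set.subset_union_right _ hw) (chainsIn_mono Set.subset_union_left _ hv), y, ?_⟩
  rw [hy]
  abel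

/-- The boundaries of a and b are opposite, so they lie in both sets. -/
theorem mem_relCycles_inter {X : Type*} [TopologicalSpace X] {A B : Set X}
    {z : Chain ℤ X (k + 1)} {a b : Chain ℤ X k} (ha : a ∈ chainsIn ℤ A k)
    (hb : b ∈ chainsIn ℤ B k) (hz : bd ℤ z = a + b) : b ∈ relCycles ℤ (A ∩ B) k := by
  refine chainsIn_inter ?_ (boundary_mem_chainsIn hb)
  have : boundary ℤ X k b = -boundary ℤ X k a := by
    rw [eq_neg_iff_add_eq_zero, add_comm (boundary ℤ X k b), ← map_add, ← hz]
    exact boundary_boundary z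
  rw [this]
  exact Submodule.neg_mem _ (boundary_mem_chainsIn ha)

/-- The connecting map is well defined: modulo a boundary, z is a chain in A ∪ B, and its
subdivision splits into a chain in A and a chain in B. The latter bounds the subdivision of b modulo
A ∩ B. -/
theorem mem_relBoundaries_inter {X : Type*} [TopologicalSpace X] {A B : Set X} (hA : IsOpen A)
    (hB : IsOpen B) {z : Chain ℤ X (k + 1)} {a b : Chain ℤ X k} (ha : a ∈ chainsIn ℤ A k)
    (hb : b ∈ chainsIn ℤ B k) (hz : bd ℤ z = a + b) (hz' : z ∈ relBoundaries ℤ (A ∪ B) (k + 1)) :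
    b ∈ relBoundaries ℤ (A ∩ B) k := by
  obtain ⟨g, hg, y, rfl⟩ := mem_relBoundaries.1 hz'
  have h0 : bd ℤ g = a + b := by
    rw [← hz, map_add, show bd ℤ (bd ℤ y) = 0 from boundary_boundary y, add_zero]
  have hbcyc := mem_relCycles_inter ha hb h0
  obtain ⟨m, ga, hga, gb, hgb, hab⟩ := exists_sdIter_eq_add hA hB hg
  have h1 : sdIter m k a + sdIter m k b = bd ℤ ga + bd ℤ gb := by
    rw [← map_add, ← map_add, hab, ← h0]
    exact (boundary_sdIter m g).symm
  have h2 : sdIter m k b - bd ℤ gb ∈ chainsIn ℤ (A ∩ B) k := by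
    refine chainsIn_inter ?_ (Submodule.sub_mem _ (sdIter_mem_chainsIn m hb)
      (boundary_mem_chainsIn hgb))
    have : sdIter m k b - bd ℤ gb = bd ℤ ga - sdIter m k a := by
      rw [sub_eq_sub_iff_add_eq_add, add_comm, h1]
    rw [this]
    exact Submodule.sub_mem _ (boundary_mem_chainsIn hga) (sdIter_mem_chainsIn m ha)
  have h3 := Submodule.add_mem _ (sub_sdIter_mem_relBoundaries m hbcyc)
    (Submodule.add_mem _ (chainsIn_le_relBoundaries h2) (boundary_mem_relBoundaries gb))
  rwa [sub_add_cancel, sub_add_cancel] at h3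

/-! ### The front faces and the filtration of the complement of an interior point. -/

/-- The inclusion of the face spanned by the first `j + 1` vertices. -/
def frontFace {j : ℕ} (h : j ≤ N) : C(Simplex j, Simplex N) :=
  ⟨stdSimplex.map (Fin.castLE (by omega)), stdSimplex.continuous_map _⟩

theorem frontFace_castLE {j : ℕ} (h : j ≤ N) (p : Simplex j) (i : Fin (j + 1)) :
    frontFace h p (Fin.castLE (by omega) i) = p i :=
  map_apply_of_injective (Fin.castLE_injective _) p i

theorem frontFace_of_lt {j : ℕ} (h : j ≤ N) (p : Simplex j) {i : Fin (N + 1)} (hi : j < i) :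
    frontFace h p i = 0 := by
  refine map_apply_of_notMem p fun a ha => ?_
  have := congrArg Fin.val ha
  simp at this
  omega

theorem frontFace_comp_faceMap_last {j : ℕ} (h : j + 1 ≤ N) :
    (frontFace h).comp (faceMap (Fin.last (j + 1))) = frontFace (by omega : j ≤ N) := by
  ext1 p
  change stdSimplex.map _ (stdSimplex.map _ p) = stdSimplex.map _ p
  rw [stdSimplex.map_comp_apply]
  congr 1
  funext a
  ext
  simp

/-- The points of the simplex whose first `j + 1` coordinates are not proportional to those
of `q`. -/
def nonProp (q : Simplex N) (j : ℕ) : Set (Simplex N) :=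
  {p | ∃ i : Fin (N + 1), (i : ℕ) ≤ j ∧ p i * q 0 ≠ p 0 * q i}

theorem nonProp_zero (q : Simplex N) : nonProp q 0 = ∅ := by
  ext p
  simp only [nonProp, Set.mem_ofPred_eq, Set.mem_empty_iff_false, iff_false, not_exists, not_and,
    not_not]
  intro i hi
  obtain rfl : i = 0 := Fin.ext (by simpa using hi)
  rfl

/-- Proportional points of the simplex are equal because their coordinates have the same sum. The
increasing sets `nonProp q j` thus lead from the empty set to the complement of q. -/
theorem nonProp_top (q : Simplex N) (hq : ∀ i, 0 < q i) : nonProp q N = {q}ᶜ := by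
  ext p
  rw [Set.mem_compl_singleton_iff, ← not_iff_not, not_not]
  simp only [nonProp, Set.mem_ofPred_eq, not_exists, not_and, not_not]
  constructor
  · intro h
    have h1 : ∀ i, p i * q 0 = p 0 * q i := fun i => h i (by omega)
    have h2 : q 0 = p 0 := by
      have := Finset.sum_congr rfl fun i (_ : i ∈ Finset.univ) => h1 i
      rwa [← Finset.sum_mul, ← Finset.mul_sum, stdSimplex.sum_eq_one, stdSimplex.sum_eq_one,
        one_mul, mul_one] at this
    refine simplex_ext fun i => ?_
    have h3 := h1 i
    rw [← h2, mul_comm] at h3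
    exact mul_left_cancel₀ (hq 0).ne' h3
  · rintro rfl i -
    ring

theorem isOpen_nonProp (q : Simplex N) (j : ℕ) : IsOpen (nonProp q j) := by
  have : nonProp q j = ⋃ i : Fin (N + 1), ⋃ _ : (i : ℕ) ≤ j, {p | p i * q 0 ≠ p 0 * q i} := by
    ext p
    simp [nonProp]
  rw [this]
  exact isOpen_iUnion fun i => isOpen_iUnion fun _ =>
    isOpen_ne_fun (by fun_prop) (by fun_prop)

/-- The first of two star-shaped sets that cover `nonProp q v`. -/
def upperPart (q : Simplex N) (j : ℕ) (v : Fin (N + 1)) : Set (Simplex N) :=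
  nonProp q j ∪ {p | p 0 * q v < p v * q 0}

/-- The second of two star-shaped sets that cover `nonProp q v`. -/
def lowerPart (q : Simplex N) (j : ℕ) (v : Fin (N + 1)) : Set (Simplex N) :=
  nonProp q j ∪ {p | p v * q 0 < p 0 * q v}

theorem isOpen_upperPart (q : Simplex N) (j : ℕ) (v : Fin (N + 1)) : IsOpen (upperPart q j v) :=
  (isOpen_nonProp q j).union (isOpen_lt (by fun_prop) (by fun_prop))

theorem isOpen_lowerPart (q : Simplex N) (j : ℕ) (v : Fin (N + 1)) : IsOpen (lowerPart q j v) :=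
  (isOpen_nonProp q j).union (isOpen_lt (by fun_prop) (by fun_prop))

theorem upperPart_inter_lowerPart (q : Simplex N) (j : ℕ) (v : Fin (N + 1)) :
    upperPart q j v ∩ lowerPart q j v = nonProp q j := by
  rw [upperPart, lowerPart, ← Set.union_inter_distrib_left, Set.union_eq_left]
  rintro p ⟨h1, h2⟩
  exact (lt_asymm (show p 0 * q v < p v * q 0 from h1) h2).elim

theorem upperPart_union_lowerPart (q : Simplex N) {j : ℕ} {v : Fin (N + 1)} (hv : (v : ℕ) = j + 1) :
    upperPart q j v ∪ lowerPart q j v = nonProp q (j + 1) := by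
  ext p
  constructor
  · rintro ((⟨i, hi, h⟩ | h) | (⟨i, hi, h⟩ | h))
    · exact ⟨i, by omega, h⟩
    · exact ⟨v, by omega, (ne_of_lt h).symm⟩
    · exact ⟨i, by omega, h⟩
    · exact ⟨v, by omega, ne_of_lt h⟩
  · rintro ⟨i, hi, h⟩
    rcases Nat.lt_or_ge j i with h1 | h1
    · obtain rfl : i = v := Fin.ext (by omega)
      rcases lt_or_gt_of_ne h with h2 | h2
      · exact Or.inr (Or.inr h2)
      · exact Or.inl (Or.inr h2)
    · exact Or.inl (Or.inl ⟨i, h1, h⟩)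

/-- The first j + 1 coordinates of e are proportional to those of q, possibly zero, so mixing with e
only scales the defect of proportionality by 1 - t. -/
theorem mix_mem_nonProp {q e a : Simplex N} {j : ℕ}
    (he : ∀ i : Fin (N + 1), (i : ℕ) ≤ j → e i * q 0 = e 0 * q i) (ha : a ∈ nonProp q j)
    {t : unitInterval} (ht : (t : ℝ) ≠ 1) : mix t e a ∈ nonProp q j := by
  obtain ⟨i, hi, h⟩ := ha
  refine ⟨i, hi, fun h' => h ?_⟩
  simp only [mix_apply] at h'
  have h1 : (1 - (t : ℝ)) * (a i * q 0) = (1 - t) * (a 0 * q i) := by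
    linear_combination h' - t * he i hi
  exact mul_left_cancel₀ (sub_ne_zero.2 ht.symm) h1

/-- Moving towards the vertex v shrinks the first j + 1 coordinates in a fixed ratio and increases
the defining inequality; at t = 1 the vertex itself satisfies the inequality. -/
theorem starAt_upperPart {q : Simplex N} (hq : ∀ i, 0 < q i) {j : ℕ} {v : Fin (N + 1)}
    (hv : (v : ℕ) = j + 1) : StarAt (stdSimplex.vertex v) (upperPart q j v) := by
  have h0 : ∀ i : Fin (N + 1), (i : ℕ) ≤ j → (stdSimplex.vertex v : Simplex N) i = 0 := by
    intro i hi
    refine Pi.single_eq_of_ne (fun h => ?_) _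
    rw [h] at hi
    omega
  have h1 : (stdSimplex.vertex v : Simplex N) v = 1 := Pi.single_eq_same _ _
  have hq0 := hq 0
  intro a ha t
  by_cases ht : (t : ℝ) = 1
  · right
    change mix t _ a 0 * q v < mix t _ a v * q 0
    rw [mix_apply, mix_apply, h1, h0 0 (by simp), ht]
    linarith
  · rcases ha with ha | ha
    · exact Or.inl (mix_mem_nonProp (fun i hi => by rw [h0 i hi, h0 0 (by simp)]; ring) ha ht)
    · right
      change mix t _ a 0 * q v < mix t _ a v * q 0
      change a 0 * q v < a v * q 0 at ha
      rw [mix_apply, mix_apply, h1, h0 0 (by simp)]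
      have h2 : 0 < 1 - (t : ℝ) := sub_pos.2 (lt_of_le_of_ne t.2.2 ht)
      have h3 := mul_lt_mul_of_pos_left ha h2
      have h4 := mul_nonneg t.2.1 hq0.le
      linarith

/-- The apex is the projection of q to the front j-face: its first j + 1 coordinates are
proportional to those of q, and its coordinate v vanishes. -/
theorem exists_starAt_lowerPart {q : Simplex N} (hq : ∀ i, 0 < q i) {j : ℕ} {v : Fin (N + 1)}
    (hv : (v : ℕ) = j + 1) : ∃ e, StarAt e (lowerPart q j v) := by
  classical
  set Q : ℝ := ∑ i : Fin (N + 1), if (i : ℕ) ≤ j then q i else 0 with hQ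
  have hQ0 : 0 < Q := by
    refine Finset.sum_pos' (fun i _ => ?_) ⟨0, Finset.mem_univ _, ?_⟩
    · split_ifs
      exacts [(hq i).le, le_rfl]
    · simp [hq 0]
  let e : Simplex N := ⟨fun i => (if (i : ℕ) ≤ j then q i else 0) / Q, fun i => by
    dsimp only
    split_ifs
    exacts [div_nonneg (hq i).le hQ0.le, by simp], by
    rw [← Finset.sum_div, ← hQ, div_self hQ0.ne']⟩
  have h0 : ∀ i : Fin (N + 1), (i : ℕ) ≤ j → e i = q i / Q := fun i hi => by
    change (if (i : ℕ) ≤ j then q i else 0) / Q = _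
    rw [if_pos hi]
  have h1 : e v = 0 := by
    change (if (v : ℕ) ≤ j then q v else 0) / Q = _
    rw [if_neg (by omega), zero_div]
  have he0 : 0 < e 0 * q v := by
    rw [h0 0 (by simp)]
    exact mul_pos (div_pos (hq 0) hQ0) (hq v)
  refine ⟨e, fun a ha t => ?_⟩
  by_cases ht : (t : ℝ) = 1
  · right
    change mix t e a v * q 0 < mix t e a 0 * q v
    rw [mix_apply, mix_apply, h1, ht]
    linarith
  · rcases ha with ha | ha
    · refine Or.inl (mix_mem_nonProp (fun i hi => ?_) ha ht)
      rw [h0 i hi, h0 0 (by simp)]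
      ring
    · right
      change mix t e a v * q 0 < mix t e a 0 * q v
      change a v * q 0 < a 0 * q v at ha
      rw [mix_apply, mix_apply, h1]
      have h2 : 0 < 1 - (t : ℝ) := sub_pos.2 (lt_of_le_of_ne t.2.2 ht)
      have h3 := mul_lt_mul_of_pos_left ha h2
      have h4 := mul_nonneg t.2.1 he0.le
      linarith

/-- Meant for the facets of the front (j + 1)-face other than the last. If the first j + 1
coordinates were proportional to those of q, one zero among them would make all of them zero, and p
would be the vertex v. -/
theorem mem_upperPart_of_eq_zero {q p : Simplex N} (hq : ∀ i, 0 < q i) {j : ℕ} {v : Fin (N + 1)}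
    (hv : (v : ℕ) = j + 1) (hp : ∀ i : Fin (N + 1), j + 1 < i → p i = 0) {i : Fin (N + 1)}
    (hi : (i : ℕ) ≤ j) (hpi : p i = 0) : p ∈ upperPart q j v := by
  by_contra h
  have h1 : ∀ i : Fin (N + 1), (i : ℕ) ≤ j → p i * q 0 = p 0 * q i := by
    intro i hi
    by_contra h'
    exact h (Or.inl ⟨i, hi, h'⟩)
  have h2 : p 0 = 0 := by
    have := h1 i hi
    rw [hpi, zero_mul] at this
    exact (mul_eq_zero.1 this.symm).resolve_right (hq i).ne'
  have h3 : p v = 1 := by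
    rw [← stdSimplex.sum_eq_one p, eq_comm]
    refine Finset.sum_eq_single v (fun l _ hl => ?_) (by simp)
    rcases lt_trichotomy (l : ℕ) (j + 1) with h4 | h4 | h4
    · have := h1 l (by omega)
      rw [h2, zero_mul] at this
      exact (mul_eq_zero.1 this).resolve_right (hq 0).ne'
    · exact absurd (Fin.ext (by omega)) hl
    · exact hp l h4
  refine h (Or.inr ?_)
  change p 0 * q v < p v * q 0
  rw [h2, h3]
  linarith [hq 0]

/-- Meant for the last facet of the front (j + 1)-face. If the first coordinates are proportional to
those of q, they cannot vanish because nothing else contributes to the sum. -/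
theorem mem_lowerPart_of_eq_zero {q p : Simplex N} (hq : ∀ i, 0 < q i) {j : ℕ} {v : Fin (N + 1)}
    (hv : (v : ℕ) = j + 1) (hp : ∀ i : Fin (N + 1), j < i → p i = 0) : p ∈ lowerPart q j v := by
  by_contra h
  have h1 : ∀ i : Fin (N + 1), (i : ℕ) ≤ j → p i * q 0 = p 0 * q i := by
    intro i hi
    by_contra h'
    exact h (Or.inl ⟨i, hi, h'⟩)
  have h2 : p 0 ≠ 0 := by
    intro h2
    have : ∑ i, p i = 0 := Finset.sum_eq_zero fun l _ => by
      rcases Nat.lt_or_ge j l with h4 | h4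
      · exact hp l h4
      · have := h1 l h4
        rw [h2, zero_mul] at this
        exact (mul_eq_zero.1 this).resolve_right (hq 0).ne'
    rw [stdSimplex.sum_eq_one] at this
    exact one_ne_zero this
  refine h (Or.inr ?_)
  change p v * q 0 < p 0 * q v
  rw [hp v (by omega), zero_mul]
  exact mul_pos (lt_of_le_of_ne (stdSimplex.zero_le p 0) h2.symm) (hq v)

/-- The front j-face freely generates the homology of the simplex relative to `nonProp q j`. For j =
0 this is the augmentation. In the induction step `nonProp q (j + 1)` is the union of two open
star-shaped sets with intersection `nonProp q j`, and the connecting map takes the front (j +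
1)-face to the front j-face up to sign. -/
theorem frontFace_generates {q : Simplex N} (hq : ∀ i, 0 < q i) (j : ℕ) (hj : j ≤ N) :
    (∀ t : ℤ, t • Finsupp.single (frontFace hj) (1 : ℤ) ∈ relBoundaries ℤ (nonProp q j) j →
      t = 0) ∧
    ∀ z ∈ relCycles ℤ (nonProp q j) j, ∃ t : ℤ,
      z - t • Finsupp.single (frontFace hj) (1 : ℤ) ∈ relBoundaries ℤ (nonProp q j) j := by
  induction j with
  | zero =>
    rw [nonProp_zero]
    constructor
    · intro t ht
      obtain ⟨a, ha, d, hd⟩ := mem_relBoundaries.1 ht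
      have ha0 : a = 0 := by
        rw [← Finsupp.support_eq_empty, Finset.eq_empty_iff_forall_notMem]
        intro s hs
        exact ha hs ⟨stdSimplex.vertex 0, rfl⟩
      have := congrArg augmentation hd
      rw [ha0, map_add, map_zero (augmentation (X := Simplex N)), augmentation_boundary, map_smul,
        augmentation_single] at this
      simpa using this
    · intro z _
      refine ⟨augmentation z, ?_⟩
      have h : frontFace hj = ContinuousMap.const _ (stdSimplex.vertex 0) := by
        ext1 p
        have hp : p = stdSimplex.vertex 0 := by
          refine simplex_ext fun i => ?_
          obtain rfl : i = 0 := by omega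
          have := stdSimplex.sum_eq_one p
          rw [Fin.sum_univ_one] at this
          rw [this]
          simp
        rw [hp]
        exact stdSimplex.map_vertex _ _
      rw [h, ← bd_coneChain_zero]
      exact boundary_mem_relBoundaries _
  | succ j ih =>
    obtain ⟨ih1, ih2⟩ := ih (by omega)
    set v : Fin (N + 1) := ⟨j + 1, by omega⟩ with hv
    have hv' : (v : ℕ) = j + 1 := rfl
    have hA := starAt_upperPart hq hv'
    obtain ⟨e, hB⟩ := exists_starAt_lowerPart hq hv'
    rw [← upperPart_union_lowerPart q hv']
    rw [← upperPart_inter_lowerPart q j v] at ih1 ih2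
    have hAo := isOpen_upperPart q j v
    have hBo := isOpen_lowerPart q j v
    set A := upperPart q j v with hAdef
    set B := lowerPart q j v with hBdef
    set g : Chain ℤ (Simplex N) (j + 1) := Finsupp.single (frontFace hj) 1 with hg
    set g' : Chain ℤ (Simplex N) j := Finsupp.single (frontFace (by omega : j ≤ N)) 1 with hg'
    -- All facets but the last lie in A; the last one is the front j-face and lies in B, so the
    -- connecting map sends g to g' with the sign of the facet j + 1.
    obtain ⟨a, ha, hbd⟩ : ∃ a ∈ chainsIn ℤ A j, bd ℤ g = a + (-1) ^ (j + 1) • g' := by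
      refine ⟨_, ?_, by
        rw [hg, boundary_single, Fin.sum_univ_castSucc, face_eq _ (frontFace hj),
          frontFace_comp_faceMap_last hj, Fin.val_last]⟩
      refine Submodule.sum_mem _ fun i _ => Submodule.smul_mem _ _ (single_mem_chainsIn ?_ _)
      rintro _ ⟨p, rfl⟩
      refine mem_upperPart_of_eq_zero hq hv' (fun l hl => frontFace_of_lt hj _ hl)
        (i := Fin.castLE (by omega) i.castSucc) (by simp; omega) ?_
      rw [face_eq, ContinuousMap.comp_apply, frontFace_castLE, faceMap_self]
    have hg'B : g' ∈ chainsIn ℤ B j := by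
      refine single_mem_chainsIn ?_ _
      rintro _ ⟨p, rfl⟩
      exact mem_lowerPart_of_eq_zero hq hv' fun l hl => frontFace_of_lt _ _ hl
    constructor
    · intro t ht
      have := mem_relBoundaries_inter hAo hBo (z := t • g) (a := t • a)
        (b := (t * (-1) ^ (j + 1)) • g') (Submodule.smul_mem _ _ ha) (Submodule.smul_mem _ _ hg'B)
        (by rw [map_smul, hbd, smul_add, smul_smul]) ht
      have h := ih1 _ this
      exact (mul_eq_zero.1 h).resolve_right (pow_ne_zero _ (by norm_num))
    · intro z hz
      obtain ⟨m, a', ha', b', hb', hab⟩ := exists_sdIter_eq_add hAo hBo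
        (c := bd ℤ z) (mem_relCycles.1 hz)
      have hz1 := sub_sdIter_mem_relBoundaries m hz
      have hz2 : bd ℤ (sdIter m (j + 1) z) = a' + b' := by
        rw [hab]
        exact boundary_sdIter m z
      have hb'cyc := mem_relCycles_inter ha' hb' hz2
      obtain ⟨t, ht⟩ := ih2 b' hb'cyc
      have hsq : ((-1 : ℤ) ^ (j + 1)) * (-1) ^ (j + 1) = 1 := by
        rw [← mul_pow]; norm_num
      refine ⟨t * (-1) ^ (j + 1), ?_⟩
      have h1 : sdIter m (j + 1) z - (t * (-1) ^ (j + 1)) • g ∈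
          relBoundaries ℤ (A ∪ B) (j + 1) := by
        refine mem_relBoundaries_union_of_star hA hB
          (a := a' - (t * (-1) ^ (j + 1)) • a) (b := b' - t • g')
          (Submodule.sub_mem _ ha' (Submodule.smul_mem _ _ ha))
          (Submodule.sub_mem _ hb' (Submodule.smul_mem _ _ hg'B)) ?_ ht
        rw [map_sub, map_smul, hbd, hz2, smul_add, smul_smul, mul_assoc, hsq, mul_one]
        abel
      have := Submodule.add_mem _ hz1 h1
      rwa [sub_add_sub_cancel] at this

/-- The interior of the standard simplex. -/
def interiorSimplex (N : ℕ) : Set (Simplex N) := {p | ∀ i, 0 < p i}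

theorem isOpen_interiorSimplex : IsOpen (interiorSimplex N) := by
  have : interiorSimplex N = ⋂ i, {p | 0 < p i} := by
    ext p
    simp [interiorSimplex]
  rw [this]
  exact isOpen_iInter_of_finite fun i => isOpen_lt continuous_const (by fun_prop)

theorem frontFace_self : frontFace (le_refl N) = ContinuousMap.id _ := by
  ext1 p
  exact stdSimplex.map_id_apply p

theorem eq_zero_of_smul_idChain {q : Simplex N} (hq : q ∈ interiorSimplex N) {t : ℤ}
    (h : t • idChain N ∈ relBoundaries ℤ ({q}ᶜ : Set (Simplex N)) N) : t = 0 := by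
  have := (frontFace_generates hq N le_rfl).1 t
  rw [nonProp_top q hq, frontFace_self] at this
  exact this h

theorem exists_sub_smul_idChain {q : Simplex N} (hq : q ∈ interiorSimplex N)
    {z : Chain ℤ (Simplex N) N} (hz : z ∈ relCycles ℤ ({q}ᶜ : Set (Simplex N)) N) :
    ∃ t : ℤ, z - t • idChain N ∈ relBoundaries ℤ ({q}ᶜ : Set (Simplex N)) N := by
  have := (frontFace_generates hq N le_rfl).2 z
  rw [nonProp_top q hq, frontFace_self] at this
  exact this hz

/-- The simplex is a cycle relative to its boundary. -/
theorem bd_idChain_mem (N : ℕ) : boundary ℤ (Simplex N) N (idChain N) ∈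
    chainsIn ℤ (interiorSimplex N)ᶜ (N - 1) := by
  cases N with
  | zero => exact Submodule.zero_mem _
  | succ N =>
    rw [idChain, boundary_single]
    refine Submodule.sum_mem _ fun i _ => Submodule.smul_mem _ _ (single_mem_chainsIn ?_ _)
    rintro _ ⟨p, rfl⟩ h
    have := h i
    change 0 < faceMap i p i at this
    rw [faceMap_self] at this
    exact lt_irrefl _ this

end LocalSimplex

/-! ### Permutations of the vertices -/

section Permutations

variable {n : ℕ}

/-- The simplicial map induced by a map of vertices. -/
def vertexMap {a b : ℕ} (f : Fin (a + 1) → Fin (b + 1)) : C(Simplex a, Simplex b) :=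
  ⟨stdSimplex.map f, stdSimplex.continuous_map f⟩

theorem vertexMap_comp {a b c : ℕ} (g : Fin (b + 1) → Fin (c + 1)) (f : Fin (a + 1) → Fin (b + 1)) :
    (vertexMap g).comp (vertexMap f) = vertexMap (g ∘ f) := by
  ext1 p
  exact stdSimplex.map_comp_apply f g p

theorem vertexMap_id : vertexMap (id : Fin (n + 1) → Fin (n + 1)) = ContinuousMap.id _ := by
  ext1 p
  exact stdSimplex.map_id_apply p

theorem vertexMap_perm_apply (π : Equiv.Perm (Fin (n + 1))) (p : Simplex n) (i : Fin (n + 1)) :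
    vertexMap π p (π i) = p i :=
  map_apply_of_injective π.injective p i

theorem vertexMap_perm_mem_interior (π : Equiv.Perm (Fin (n + 1))) {p : Simplex n} :
    vertexMap π p ∈ interiorSimplex n ↔ p ∈ interiorSimplex n := by
  constructor
  · intro h i
    rw [← vertexMap_perm_apply π]
    exact h _
  · intro h i
    rw [← π.apply_symm_apply i, vertexMap_perm_apply]
    exact h _

theorem bd_vertexMap {a b : ℕ} (f : Fin (a + 2) → Fin (b + 1)) :
    bd ℤ (Finsupp.single (vertexMap f) (1 : ℤ)) = ∑ i : Fin (a + 2),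
      (-1 : ℤ) ^ (i : ℕ) • Finsupp.single (vertexMap (f ∘ i.succAbove)) 1 := by
  rw [boundary_single]
  refine Finset.sum_congr rfl fun i _ => ?_
  rw [← vertexMap_comp]
  rfl

theorem range_vertexMap_subset {a : ℕ} {f : Fin (a + 1) → Fin (n + 1)}
    (hf : ¬Function.Surjective f) : Set.range (vertexMap f) ⊆ (interiorSimplex n)ᶜ := by
  rintro _ ⟨p, rfl⟩ h
  simp only [Function.Surjective, not_forall, not_exists] at hf
  obtain ⟨j, hj⟩ := hf
  have h1 := h j
  rw [show vertexMap f p j = 0 from map_apply_of_notMem p hj] at h1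
  exact lt_irrefl _ h1

/-- Take the boundary of the degenerate simplex with vertices 0, …, k, k + 1, k, k + 2, …, n.
Omitting the first k gives the transposition, omitting the second gives the identity, and both have
the sign (-1)^k. All other facets repeat the vertex k and so miss the interior. -/
theorem swap_add_id_mem (k : Fin n) :
    Finsupp.single (vertexMap (Equiv.swap k.castSucc k.succ)) (1 : ℤ) + idChain n ∈
      relBoundaries ℤ (interiorSimplex n)ᶜ n := by
  obtain ⟨k, hk⟩ := k
  let f : Fin (n + 2) → Fin (n + 1) := fun i =>
    if h : (i : ℕ) ≤ k + 1 then ⟨i, by omega⟩ else if (i : ℕ) = k + 2 then ⟨k, by omega⟩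
    else ⟨i - 1, by omega⟩
  have hf : ∀ i, ((f i : Fin (n + 1)) : ℕ) =
      if (i : ℕ) ≤ k + 1 then (i : ℕ) else if (i : ℕ) = k + 2 then k else i - 1 := by
    intro i
    simp only [f]
    split_ifs <;> rfl
  let a : Fin (n + 2) := ⟨k, by omega⟩
  let b : Fin (n + 2) := ⟨k + 2, by omega⟩
  have hab : a ≠ b := fun h => by simpa [a, b] using congrArg Fin.val h
  have hsv : ∀ (m : Fin (n + 2)) (i : Fin (n + 1)),
      ((m.succAbove i : Fin (n + 2)) : ℕ) = if (i : ℕ) < m then (i : ℕ) else i + 1 := by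
    intro m i
    simp only [Fin.succAbove, Fin.lt_def, Fin.val_castSucc]
    split_ifs <;> simp
  have ha : f ∘ a.succAbove = Equiv.swap (Fin.castSucc ⟨k, hk⟩) (Fin.succ ⟨k, hk⟩) := by
    funext i
    ext
    rw [Function.comp_apply, hf, hsv, Equiv.swap_apply_def]
    simp only [a, Fin.ext_iff, Fin.val_castSucc, Fin.val_succ]
    split_ifs <;> simp_all <;> omega
  have hb : f ∘ b.succAbove = id := by
    funext i
    ext
    rw [Function.comp_apply, hf, hsv]
    simp only [b, id]
    split_ifs <;> omega
  set g : Fin (n + 2) → Chain ℤ (Simplex n) n := fun i =>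
    (-1 : ℤ) ^ (i : ℕ) • Finsupp.single (vertexMap (f ∘ i.succAbove)) 1 with hg
  have hrest : ∑ i ∈ Finset.univ \ {a, b}, g i ∈ chainsIn ℤ (interiorSimplex n)ᶜ n := by
    refine Submodule.sum_mem _ fun i hi => Submodule.smul_mem _ _ (single_mem_chainsIn ?_ _)
    simp only [Finset.mem_sdiff, Finset.mem_univ, true_and, Finset.mem_insert,
      Finset.mem_singleton, not_or] at hi
    refine range_vertexMap_subset fun hs => ?_
    have hinj := Finite.injective_iff_surjective.2 hs
    obtain ⟨x, hx⟩ := Fin.exists_succAbove_eq (Ne.symm hi.1)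
    obtain ⟨y, hy⟩ := Fin.exists_succAbove_eq (Ne.symm hi.2)
    have hxy : x = y := hinj (by
      ext
      rw [Function.comp_apply, Function.comp_apply, hx, hy, hf, hf]
      simp [a, b])
    exact hab (by rw [← hx, ← hy, hxy])
  have hsum : bd ℤ (Finsupp.single (vertexMap f) (1 : ℤ)) =
      ∑ i ∈ Finset.univ \ {a, b}, g i + (g a + g b) := by
    rw [bd_vertexMap, ← Finset.sum_sdiff (Finset.subset_univ {a, b}), Finset.sum_pair hab]
  have hgab : g a + g b = (-1 : ℤ) ^ k • (Finsupp.single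
      (vertexMap (Equiv.swap (Fin.castSucc ⟨k, hk⟩) (Fin.succ ⟨k, hk⟩))) (1 : ℤ) + idChain n) := by
    simp only [hg, ha, hb, vertexMap_id, idChain, a, b, smul_add]
    rw [pow_add]
    norm_num
  have hmem : g a + g b ∈ relBoundaries ℤ (interiorSimplex n)ᶜ n := by
    have := Submodule.sub_mem _ (boundary_mem_relBoundaries (S := (interiorSimplex n)ᶜ)
      (Finsupp.single (vertexMap f) (1 : ℤ))) (chainsIn_le_relBoundaries hrest)
    rwa [hsum, add_sub_cancel_left] at this
  rw [hgab] at hmem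
  have := Submodule.smul_mem _ ((-1 : ℤ) ^ k) hmem
  rwa [smul_smul, ← mul_pow, neg_one_mul, neg_neg, one_pow, one_smul] at this

/-- A permutation of the vertices acts by its sign on the relative fundamental class of the
simplex. -/
theorem vertexMap_perm_sub_mem (π : Equiv.Perm (Fin (n + 1))) :
    Finsupp.single (vertexMap π) (1 : ℤ) - (Equiv.Perm.sign π : ℤ) • idChain n ∈
      relBoundaries ℤ (interiorSimplex n)ᶜ n := by
  have hπ : π ∈ Submonoid.closure
      (Set.range fun i : Fin n => Equiv.swap i.castSucc i.succ) := by
    rw [Equiv.Perm.mclosure_swap_castSucc_succ]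
    trivial
  induction hπ using Submonoid.closure_induction with
  | mem x hx =>
    obtain ⟨k, rfl⟩ := hx
    rw [Equiv.Perm.sign_swap k.castSucc_lt_succ.ne]
    simpa [sub_eq_add_neg] using swap_add_id_mem k
  | one =>
    rw [Equiv.Perm.sign_one, Equiv.Perm.coe_one, vertexMap_id]
    simp [idChain]
  | mul σ τ _ _ hσ hτ =>
    have h1 := push_mem_relBoundaries (f := vertexMap σ) (S := (interiorSimplex n)ᶜ)
      (T := (interiorSimplex n)ᶜ)
      (fun p hp h => hp ((vertexMap_perm_mem_interior σ).1 h)) hτ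
    rw [map_sub, map_smul, push_idChain, push_single, vertexMap_comp] at h1
    have h2 := Submodule.add_mem _ h1 (Submodule.smul_mem _ (Equiv.Perm.sign τ : ℤ) hσ)
    rw [smul_sub, smul_smul, sub_add_sub_cancel] at h2
    rwa [Equiv.Perm.sign_mul, mul_comm, Units.val_mul, Equiv.Perm.coe_mul]

end Permutations

/-! ### Open simplices generate the local homology -/

section OpenSimplex

/-- A locally constant uniquely determined value is constant on preconnected sets. -/
theorem eq_on_isPreconnected {X : Type*} [TopologicalSpace X] {W : Set X} (hW : IsPreconnected W)
    {R : X → ℤ → Prop} (hex : ∀ w ∈ W, ∃ t, R w t) (huniq : ∀ w ∈ W, ∀ t t', R w t → R w t' → t = t')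
    (hloc : ∀ w ∈ W, ∀ t, R w t → ∀ᶠ y in 𝓝 w, R y t) {w₀ w : X} (hw₀ : w₀ ∈ W) (hw : w ∈ W)
    {t : ℤ} (h : R w₀ t) : R w t := by
  by_contra hcon
  have hU : IsOpen (interior {y | R y t}) := isOpen_interior
  have hV : IsOpen (⋃ t' : {t' // t' ≠ t}, interior {y | R y t'}) :=
    isOpen_iUnion fun _ => isOpen_interior
  have hmem : ∀ y ∈ W, ∀ t, R y t → y ∈ interior {y | R y t} := fun y hy t ht =>
    mem_interior_iff_mem_nhds.2 (hloc y hy t ht)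
  have hsub : ∀ y t, y ∈ interior {y | R y t} → R y t := fun y t hy =>
    show y ∈ {y | R y t} from interior_subset hy
  have hcov : W ⊆ interior {y | R y t} ∪ ⋃ t' : {t' // t' ≠ t}, interior {y | R y t'} := by
    intro y hy
    obtain ⟨t', ht'⟩ := hex y hy
    by_cases h' : t' = t
    · exact Or.inl (hmem y hy t (h' ▸ ht'))
    · exact Or.inr (Set.mem_iUnion.2 ⟨⟨t', h'⟩, hmem y hy t' ht'⟩)
  obtain ⟨y, hy, hyU, hyV⟩ := hW _ _ hU hV hcov ⟨w₀, hw₀, hmem w₀ hw₀ t h⟩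
    ⟨w, hw, (hcov hw).resolve_left fun h' => hcon (hsub _ _ h')⟩
  obtain ⟨⟨t', ht'⟩, hy'⟩ := Set.mem_iUnion.1 hyV
  exact ht' (huniq y hy t' t (hsub _ _ hy') (hsub _ _ hyU))

variable {n : ℕ} {X : Type*} [TopologicalSpace X]

/-- A singular simplex that restricts to an open embedding of the interior of the standard simplex
and takes the values of interior points only once. -/
structure IsOpenSimplex (s : C(Simplex n, X)) : Prop where
  isOpenEmbedding : Topology.IsOpenEmbedding fun p : interiorSimplex n => s p
  eq_of_eq : ∀ p ∈ interiorSimplex n, ∀ p', s p' = s p → p' = p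

namespace IsOpenSimplex

variable {s : C(Simplex n, X)}

theorem mapsTo (hs : IsOpenSimplex s) {q : Simplex n} (hq : q ∈ interiorSimplex n) :
    Set.MapsTo s ({q}ᶜ : Set (Simplex n)) ({s q}ᶜ : Set X) :=
  fun p hp h => hp (hs.eq_of_eq q hq p h)

theorem isOpen_image (hs : IsOpenSimplex s) : IsOpen (s '' interiorSimplex n) := by
  have := hs.isOpenEmbedding.isOpen_range
  rwa [← Set.image_eq_range] at this

theorem idChain_mem_relCycles {q : Simplex n} (hq : q ∈ interiorSimplex n) :
    idChain n ∈ relCycles ℤ ({q}ᶜ : Set (Simplex n)) n :=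
  chainsIn_mono (S := (interiorSimplex n)ᶜ) (T := {q}ᶜ)
    (fun _ hp h => hp (by rwa [Set.mem_singleton_iff.1 h])) _ (bd_idChain_mem n)

theorem mem_relCycles (hs : IsOpenSimplex s) {q : Simplex n} (hq : q ∈ interiorSimplex n) :
    Finsupp.single s 1 ∈ relCycles ℤ ({s q}ᶜ : Set X) n := by
  rw [← push_idChain]
  exact push_mem_relCycles (hs.mapsTo hq) (idChain_mem_relCycles hq)

theorem union_compl_eq_univ {q : Simplex n} (hq : q ∈ interiorSimplex n) :
    interiorSimplex n ∪ {q}ᶜ = Set.univ :=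
  Set.eq_univ_of_forall fun p => by
    by_cases h : p = q
    · exact Or.inl (h ▸ hq)
    · exact Or.inr h

theorem image_union_compl_eq_univ {q : Simplex n} (hq : q ∈ interiorSimplex n) :
    s '' interiorSimplex n ∪ {s q}ᶜ = Set.univ :=
  Set.eq_univ_of_forall fun p => by
    by_cases h : p = s q
    · exact Or.inl (h ▸ ⟨q, hq, rfl⟩)
    · exact Or.inr h

/-- The identity chain is excised into the interior of the simplex, where s is an open embedding;
there the relation pulls back to the standard simplex. -/
theorem eq_zero [T1Space X] (hs : IsOpenSimplex s) {q : Simplex n} (hq : q ∈ interiorSimplex n)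
    {t : ℤ} (h : t • Finsupp.single s 1 ∈ relBoundaries ℤ ({s q}ᶜ : Set X) n) : t = 0 := by
  obtain ⟨a, ha, -, ha'⟩ := exists_mem_chainsIn_of_relCycle isOpen_interiorSimplex
    isOpen_compl_singleton (union_compl_eq_univ hq) (idChain_mem_relCycles hq)
  have h1 := push_mem_relBoundaries (hs.mapsTo hq) (Submodule.smul_mem _ t ha')
  rw [map_smul, map_sub, push_idChain, smul_sub] at h1
  have h2 := Submodule.sub_mem _ h h1
  rw [sub_sub_cancel, ← map_smul] at h2
  have h3 := mem_relBoundaries_of_push (S := {q}ᶜ) hs.isOpenEmbedding isOpen_compl_singleton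
    (image_union_compl_eq_univ hq) (fun p hp h => hp.2 (congrArg s h))
    (Submodule.smul_mem _ t ha) h2
  refine eq_zero_of_smul_idChain hq ?_
  have h4 := Submodule.add_mem _ (Submodule.smul_mem _ t ha') h3
  rwa [smul_sub, sub_add_cancel] at h4

theorem exists_sub_mem [T1Space X] (hs : IsOpenSimplex s) {q : Simplex n}
    (hq : q ∈ interiorSimplex n) {c : Chain ℤ X n} (hc : c ∈ relCycles ℤ ({s q}ᶜ : Set X) n) :
    ∃ t : ℤ, c - t • Finsupp.single s 1 ∈ relBoundaries ℤ ({s q}ᶜ : Set X) n := by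
  obtain ⟨a, ha, hcyc, hca⟩ := exists_mem_chainsIn_of_relCycle hs.isOpen_image
    isOpen_compl_singleton (image_union_compl_eq_univ hq) hc
  obtain ⟨a', ha', rfl⟩ := exists_push_eq hs.isOpenEmbedding ha
  have hcyc' : a' ∈ relCycles ℤ ({q}ᶜ : Set (Simplex n)) n := by
    rw [StableDelta.mem_relCycles, boundary_push] at hcyc
    have := mem_chainsIn_preimage_of_injOn (Set.injOn_iff_injective.2 hs.isOpenEmbedding.injective)
      (boundary_mem_chainsIn ha') hcyc
    exact chainsIn_mono (S := s ⁻¹' {s q}ᶜ) (T := {q}ᶜ) (fun p hp h => hp (congrArg s h)) _ this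
  obtain ⟨t, ht⟩ := exists_sub_smul_idChain hq hcyc'
  refine ⟨t, ?_⟩
  have h1 := push_mem_relBoundaries (hs.mapsTo hq) ht
  rw [map_sub, map_smul, push_idChain] at h1
  have := Submodule.add_mem _ hca h1
  rwa [sub_add_sub_cancel] at this

/-- The relation holds in the standard simplex modulo its boundary, and s maps the boundary away
from s q. -/
theorem perm_sub_mem (hs : IsOpenSimplex s) {q : Simplex n} (hq : q ∈ interiorSimplex n)
    (π : Equiv.Perm (Fin (n + 1))) :
    Finsupp.single (s.comp (vertexMap π)) 1 - (Equiv.Perm.sign π : ℤ) • Finsupp.single s 1 ∈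
      relBoundaries ℤ ({s q}ᶜ : Set X) n := by
  have h1 := push_mem_relBoundaries (f := s) (S := (interiorSimplex n)ᶜ) (T := {s q}ᶜ)
    (fun p hp h => hp (hs.eq_of_eq q hq p h ▸ hq)) (vertexMap_perm_sub_mem π)
  rwa [map_sub, map_smul, push_idChain, push_single] at h1

end IsOpenSimplex

end OpenSimplex

/-! ### Small simplices in charts -/

section SmallSimplex

variable {n : ℕ}

variable (n) in
/-- The barycenter of the standard simplex. -/
def barycenter : Simplex n :=
  ⟨fun _ => 1 / ((n : ℝ) + 1), fun _ => by positivity, by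
    rw [Finset.sum_const, Finset.card_univ, Fintype.card_fin, nsmul_eq_mul]
    push_cast
    field_simp⟩

theorem barycenter_apply (i : Fin (n + 1)) : barycenter n i = 1 / ((n : ℝ) + 1) := rfl

theorem barycenter_mem_interiorSimplex : barycenter n ∈ interiorSimplex n := fun i => by
  rw [barycenter_apply]
  positivity

/-- An affine embedding of the standard `n`-simplex into `ℝⁿ`, which takes the barycenter to `v`. -/
def affineSimplex (r : ℝ) (v : EuclideanSpace ℝ (Fin n)) (p : Simplex n) :
    EuclideanSpace ℝ (Fin n) :=
  WithLp.toLp 2 fun i => v i + r * (p i.succ - 1 / ((n : ℝ) + 1))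

theorem continuous_affineSimplex (v : EuclideanSpace ℝ (Fin n)) :
    Continuous fun x : ℝ × Simplex n => affineSimplex x.1 v x.2 := by
  refine (PiLp.continuous_toLp 2 _).comp (continuous_pi fun i => ?_)
  have : Continuous fun x : ℝ × Simplex n => x.2 i.succ :=
    (continuous_simplex_apply i.succ).comp continuous_snd
  fun_prop

theorem apply_zero_eq (p : Simplex n) : p 0 = 1 - ∑ i : Fin n, p i.succ := by
  have := stdSimplex.sum_eq_one p
  rw [Fin.sum_univ_succ] at this
  linarith

theorem affineSimplex_injective {r : ℝ} (hr : r ≠ 0) (v : EuclideanSpace ℝ (Fin n)) :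
    Function.Injective (affineSimplex r v) := by
  intro p q h
  have h' : ∀ i : Fin n, p i.succ = q i.succ := fun i => by
    have := congrArg (fun w : EuclideanSpace ℝ (Fin n) => w i) h
    simpa [affineSimplex, hr] using this
  refine simplex_ext fun i => ?_
  induction i using Fin.cases with
  | zero => rw [apply_zero_eq, apply_zero_eq, Finset.sum_congr rfl fun i _ => h' i]
  | succ i => exact h' i

theorem isOpen_affineSimplex_image {r : ℝ} (hr : r ≠ 0) (v : EuclideanSpace ℝ (Fin n)) :
    IsOpen (affineSimplex r v '' interiorSimplex n) := by
  let c : Fin n → EuclideanSpace ℝ (Fin n) → ℝ := fun i w => (w i - v i) / r + 1 / ((n : ℝ) + 1)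
  have hc : ∀ i, Continuous (c i) := fun i => by fun_prop
  have : affineSimplex r v '' interiorSimplex n =
      (⋂ i, {w | 0 < c i w}) ∩ {w | ∑ i, c i w < 1} := by
    ext w
    simp only [Set.mem_image, Set.mem_inter_iff, Set.mem_iInter, Set.mem_ofPred_eq]
    constructor
    · rintro ⟨p, hp, rfl⟩
      have h : ∀ i, c i (affineSimplex r v p) = p i.succ := fun i => by
        simp only [c, affineSimplex]
        field_simp
        ring
      simp only [h]
      refine ⟨fun i => hp _, ?_⟩
      have := hp 0
      rw [apply_zero_eq] at this
      linarith
    · rintro ⟨h1, h2⟩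
      refine ⟨⟨Fin.cons (1 - ∑ i, c i w) fun i => c i w, fun i => ?_, ?_⟩, fun i => ?_, ?_⟩
      · induction i using Fin.cases with
        | zero => simpa using h2.le
        | succ i => simpa using (h1 i).le
      · rw [Fin.sum_univ_succ]
        simp
      · induction i using Fin.cases with
        | zero => exact sub_pos.2 h2
        | succ i => exact h1 i
      · ext i
        change v i + r * (c i w - _) = w i
        simp only [c]
        field_simp
        ring
  rw [this]
  exact (isOpen_iInter_of_finite fun i => isOpen_lt continuous_const (hc i)).inter
    (isOpen_lt (continuous_finsetSum _ fun i _ => hc i) continuous_const)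

/-- An affine simplex centred at the image of z in a chart; at scale 0 it is constant, so by
compactness a small nonzero scale keeps it in the target of the chart. -/
theorem exists_isOpenSimplex {Z : Type*} [TopologicalSpace Z] [T2Space Z]
    (e : OpenPartialHomeomorph Z (EuclideanSpace ℝ (Fin n))) {z : Z} (hz : z ∈ e.source) :
    ∃ s : C(Simplex n, Z), IsOpenSimplex s ∧ ∃ q ∈ interiorSimplex n, s q = z := by
  have h0 : ∀ p : Simplex n, affineSimplex 0 (e z) p = e z := fun p => by
    ext i
    simp [affineSimplex]
  have hev : ∀ᶠ r in 𝓝 (0 : ℝ), ∀ p ∈ (Set.univ : Set (Simplex n)),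
      affineSimplex r (e z) p ∈ e.target := by
    refine isCompact_univ.eventually_forall_of_forall_eventually fun p _ => ?_
    refine (continuous_affineSimplex (e z)).continuousAt.eventually (e.open_target.mem_nhds ?_)
    change affineSimplex 0 (e z) p ∈ _
    rw [h0]
    exact e.map_source hz
  -- A negative scale would do as well; only r ≠ 0 matters.
  obtain ⟨r, hr, hr0⟩ := ((hev.filter_mono nhdsWithin_le_nhds).and
    (self_mem_nhdsWithin (s := {(0 : ℝ)}ᶜ))).exists
  have hr' : ∀ p, affineSimplex r (e z) p ∈ e.target := fun p => hr p trivial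
  have hc : Continuous (affineSimplex r (e z)) :=
    (continuous_affineSimplex (e z)).comp (continuous_const.prodMk continuous_id)
  let s : C(Simplex n, Z) := ⟨fun p => e.symm (affineSimplex r (e z) p),
    e.continuousOn_symm.comp_continuous hc hr'⟩
  have hinj : Function.Injective s := fun p q h =>
    affineSimplex_injective hr0 _ (e.symm.injOn (hr' p) (hr' q) h)
  refine ⟨s, ⟨?_, fun p _ p' h => hinj h⟩, barycenter n, barycenter_mem_interiorSimplex, ?_⟩
  · refine ⟨(s.continuous.isClosedEmbedding hinj).isEmbedding.comp
      Topology.IsEmbedding.subtypeVal, ?_⟩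
    have : (Set.range fun p : interiorSimplex n => s p) =
        e.symm '' (affineSimplex r (e z) '' interiorSimplex n) := by
      rw [Set.image_image, Set.image_eq_range]
      rfl
    change IsOpen (Set.range fun p : interiorSimplex n => s p)
    rw [this]
    refine e.symm.isOpen_image_of_subset_source (isOpen_affineSimplex_image hr0 _) ?_
    rintro _ ⟨p, -, rfl⟩
    exact hr' p
  · change e.symm (affineSimplex r (e z) (barycenter n)) = z
    rw [show affineSimplex r (e z) (barycenter n) = e z by
      ext i
      simp [affineSimplex, barycenter_apply], e.left_inv hz]

end SmallSimplex

/-! ### Generators of the local homology -/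

section LocalGenerator

variable {n : ℕ} {X Y : Type u} [TopologicalSpace X] [TopologicalSpace Y]

/-- The class of `b` freely generates the local homology at `x`. -/
structure IsLocalGenerator (x : X) (b : Chain ℤ X n) : Prop where
  mem_relCycles : b ∈ relCycles ℤ ({x}ᶜ : Set X) n
  exists_sub_mem : ∀ c ∈ relCycles ℤ ({x}ᶜ : Set X) n, ∃ t : ℤ,
    c - t • b ∈ relBoundaries ℤ ({x}ᶜ : Set X) n
  eq_zero : ∀ t : ℤ, t • b ∈ relBoundaries ℤ ({x}ᶜ : Set X) n → t = 0

theorem IsOpenSimplex.isLocalGenerator [T1Space X] {s : C(Simplex n, X)} (hs : IsOpenSimplex s)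
    {q : Simplex n} (hq : q ∈ interiorSimplex n) :
    IsLocalGenerator (s q) (Finsupp.single s (1 : ℤ)) :=
  ⟨hs.mem_relCycles hq, fun _ hc => hs.exists_sub_mem hq hc, fun _ ht => hs.eq_zero hq ht⟩

namespace IsLocalGenerator

variable {x : X} {b b' : Chain ℤ X n}

theorem eq_of_sub_mem (hb : IsLocalGenerator x b) {c : Chain ℤ X n} {t t' : ℤ}
    (h : c - t • b ∈ relBoundaries ℤ ({x}ᶜ : Set X) n)
    (h' : c - t' • b ∈ relBoundaries ℤ ({x}ᶜ : Set X) n) : t = t' := by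
  have := hb.eq_zero (t - t') (by
    rw [sub_smul]
    have := Submodule.sub_mem _ h' h
    rwa [sub_sub_sub_cancel_left] at this)
  omega

/-- Expressing each generator through the other gives coefficients whose product is 1. -/
theorem eq_one_or_neg_one (hb : IsLocalGenerator x b)
    (hb' : ∀ c ∈ relCycles ℤ ({x}ᶜ : Set X) n, ∃ t : ℤ,
      c - t • b' ∈ relBoundaries ℤ ({x}ᶜ : Set X) n) {t : ℤ}
    (h : b' - t • b ∈ relBoundaries ℤ ({x}ᶜ : Set X) n) : t = 1 ∨ t = -1 := by
  obtain ⟨u, hu⟩ := hb' b hb.mem_relCycles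
  have h1 := Submodule.add_mem _ hu (Submodule.smul_mem _ u h)
  rw [smul_sub, smul_smul, sub_add_sub_cancel] at h1
  have h2 := hb.eq_of_sub_mem h1 (t' := 1) (by rw [one_smul, sub_self]; exact Submodule.zero_mem _)
  rw [mul_comm] at h2
  exact Int.eq_one_or_neg_one_of_mul_eq_one h2

/-- Over a point with a free generator, any other generator is free, too. -/
theorem of_exists_sub_mem (hb : IsLocalGenerator x b)
    (hrel : b' ∈ relCycles ℤ ({x}ᶜ : Set X) n)
    (hb' : ∀ c ∈ relCycles ℤ ({x}ᶜ : Set X) n, ∃ t : ℤ,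
      c - t • b' ∈ relBoundaries ℤ ({x}ᶜ : Set X) n) : IsLocalGenerator x b' := by
  refine ⟨hrel, hb', fun t ht => ?_⟩
  obtain ⟨u, hu⟩ := hb.exists_sub_mem b' hrel
  have h1 := Submodule.sub_mem _ ht (Submodule.smul_mem _ t hu)
  rw [smul_sub, sub_sub_cancel, smul_smul] at h1
  have h2 := hb.eq_zero _ h1
  rcases hb.eq_one_or_neg_one hb' hu with rfl | rfl <;> omega

theorem smul_of_isUnit (hb : IsLocalGenerator x b) {ε : ℤ} (hε : ε * ε = 1) :
    IsLocalGenerator x (ε • b) := by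
  refine hb.of_exists_sub_mem (Submodule.smul_mem _ _ hb.mem_relCycles) fun c hc => ?_
  obtain ⟨t, ht⟩ := hb.exists_sub_mem c hc
  refine ⟨t * ε, ?_⟩
  rwa [smul_smul, mul_assoc, hε, mul_one]

theorem exists_unit (hb : IsLocalGenerator x b) (hb' : IsLocalGenerator x b') :
    ∃ ε : ℤ, (ε = 1 ∨ ε = -1) ∧ b' - ε • b ∈ relBoundaries ℤ ({x}ᶜ : Set X) n := by
  obtain ⟨ε, hε⟩ := hb.exists_sub_mem b' hb'.mem_relCycles
  exact ⟨ε, hb.eq_one_or_neg_one hb'.exists_sub_mem hε, hε⟩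

end IsLocalGenerator

/-- `b` is a chain near `z` which represents the local class of `γ` pulled back along `f`. -/
def PushesTo (f : C(X, Y)) (z : X) (b : Chain ℤ X n) (γ : Chain ℤ Y n) : Prop :=
  ∃ W : Set X, IsOpen W ∧ z ∈ W ∧ (Topology.IsOpenEmbedding fun w : W => f w) ∧
    b ∈ chainsIn ℤ W n ∧ push f n b - γ ∈ relBoundaries ℤ ({f z}ᶜ : Set Y) n

section

variable {f : C(X, Y)} {z : X} {W : Set X}

theorem injOn_of_isOpenEmbedding (hf : Topology.IsOpenEmbedding fun w : W => f w) : Set.InjOn f W :=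
  Set.injOn_iff_injective.2 hf.injective

theorem isOpen_image_of_isOpenEmbedding (hf : Topology.IsOpenEmbedding fun w : W => f w) :
    IsOpen (f '' W) := by
  have := hf.isOpen_range
  rwa [← Set.image_eq_range] at this

theorem isOpenEmbedding_mono {V : Set X} (hf : Topology.IsOpenEmbedding fun w : W => f w)
    (hV : IsOpen V) (hVW : V ⊆ W) : Topology.IsOpenEmbedding fun w : V => f w :=
  hf.comp ((Topology.IsOpenEmbedding.inclusion hVW) (hV.preimage continuous_subtype_val))

theorem union_compl_singleton_eq_univ {X : Type*} {W : Set X} {z : X} (hz : z ∈ W) : W ∪ {z}ᶜ = Set.univ :=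
  Set.eq_univ_of_forall fun x => by
    by_cases h : x = z
    · exact Or.inl (h ▸ hz)
    · exact Or.inr h

theorem mapsTo_inter_compl (hf : Set.InjOn f W) (hz : z ∈ W) :
    Set.MapsTo f (W ∩ {z}ᶜ) {f z}ᶜ :=
  fun _ hx h => hx.2 (hf hx.1 hz h)

theorem push_mem_relCycles_of_injOn (hf : Set.InjOn f W) (hz : z ∈ W) {a : Chain ℤ X n}
    (ha : a ∈ chainsIn ℤ W n) (hc : a ∈ relCycles ℤ ({z}ᶜ : Set X) n) :
    push f n a ∈ relCycles ℤ ({f z}ᶜ : Set Y) n := by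
  rw [mem_relCycles, boundary_push]
  exact push_mem_chainsIn (mapsTo_inter_compl hf hz) (chainsIn_inter (boundary_mem_chainsIn ha) hc)

theorem mem_relCycles_of_push (hf : Set.InjOn f W) {a : Chain ℤ X n}
    (ha : a ∈ chainsIn ℤ W n) (hc : push f n a ∈ relCycles ℤ ({f z}ᶜ : Set Y) n) :
    a ∈ relCycles ℤ ({z}ᶜ : Set X) n := by
  rw [mem_relCycles, boundary_push] at hc
  exact chainsIn_mono (S := f ⁻¹' {f z}ᶜ) (T := {z}ᶜ) (fun p hp h => hp (congrArg f h)) _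
    (mem_chainsIn_preimage_of_injOn hf (boundary_mem_chainsIn ha) hc)

theorem push_mem_relBoundaries_of_injOn [T1Space X] (hW : IsOpen W) (hf : Set.InjOn f W)
    (hz : z ∈ W) {a : Chain ℤ X n} (ha : a ∈ chainsIn ℤ W n)
    (hc : a ∈ relBoundaries ℤ ({z}ᶜ : Set X) n) :
    push f n a ∈ relBoundaries ℤ ({f z}ᶜ : Set Y) n :=
  push_mem_relBoundaries_of_local hW isOpen_compl_singleton (union_compl_singleton_eq_univ hz)
    (mapsTo_inter_compl hf hz) ha hc

theorem mem_relBoundaries_singleton_of_push [T1Space Y]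
    (hf : Topology.IsOpenEmbedding fun w : W => f w) (hz : z ∈ W) {a : Chain ℤ X n}
    (ha : a ∈ chainsIn ℤ W n) (hc : push f n a ∈ relBoundaries ℤ ({f z}ᶜ : Set Y) n) :
    a ∈ relBoundaries ℤ ({z}ᶜ : Set X) n :=
  mem_relBoundaries_of_push (S := {z}ᶜ) hf isOpen_compl_singleton
    (union_compl_singleton_eq_univ ⟨z, hz, rfl⟩) (fun _ hp h => hp.2 (congrArg f h)) ha hc

theorem exists_pushesTo [T1Space Y] (hW : IsOpen W)
    (hf : Topology.IsOpenEmbedding fun w : W => f w) (hz : z ∈ W) {γ : Chain ℤ Y n}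
    (hγ : γ ∈ relCycles ℤ ({f z}ᶜ : Set Y) n) : ∃ b, PushesTo f z b γ := by
  obtain ⟨a, ha, -, h⟩ := exists_mem_chainsIn_of_relCycle (isOpen_image_of_isOpenEmbedding hf)
    isOpen_compl_singleton (union_compl_singleton_eq_univ ⟨z, hz, rfl⟩) hγ
  obtain ⟨b, hb, rfl⟩ := exists_push_eq hf ha
  refine ⟨b, W, hW, hz, hf, hb, ?_⟩
  rw [← neg_sub]
  exact Submodule.neg_mem _ h

namespace PushesTo

variable {b : Chain ℤ X n} {γ : Chain ℤ Y n}

theorem mem_relCycles (h : PushesTo f z b γ) (hγ : γ ∈ relCycles ℤ ({f z}ᶜ : Set Y) n) :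
    b ∈ relCycles ℤ ({z}ᶜ : Set X) n := by
  obtain ⟨W, hW, hz, hf, hb, h⟩ := h
  refine mem_relCycles_of_push (injOn_of_isOpenEmbedding hf) hb ?_
  have := Submodule.add_mem _ (relBoundaries_le_relCycles h) hγ
  rwa [sub_add_cancel] at this

/-- The local class upstairs is determined by the one below. Both chains are excised into the common
neighbourhood W ∩ W', on which f is an open embedding, and are compared there. -/
theorem sub_mem [T1Space X] [T1Space Y] (h : PushesTo f z b γ) (hb : b ∈ relCycles ℤ ({z}ᶜ : Set X) n)
    {b' : Chain ℤ X n} {γ' : Chain ℤ Y n}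
    (h' : PushesTo f z b' γ') (hb' : b' ∈ relCycles ℤ ({z}ᶜ : Set X) n)
    (hγ : γ - γ' ∈ relBoundaries ℤ ({f z}ᶜ : Set Y) n) :
    b - b' ∈ relBoundaries ℤ ({z}ᶜ : Set X) n := by
  obtain ⟨W, hW, hz, hf, hbW, h⟩ := h
  obtain ⟨W', hW', hz', hf', hbW', h'⟩ := h'
  have hWW : IsOpen (W ∩ W') := hW.inter hW'
  obtain ⟨a, ha, -, hba⟩ := exists_mem_chainsIn_of_relCycle hWW
    isOpen_compl_singleton (union_compl_singleton_eq_univ ⟨hz, hz'⟩) hb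
  obtain ⟨a', ha', -, hba'⟩ := exists_mem_chainsIn_of_relCycle hWW
    isOpen_compl_singleton (union_compl_singleton_eq_univ ⟨hz, hz'⟩) hb'
  have h1 := push_mem_relBoundaries_of_injOn hW (injOn_of_isOpenEmbedding hf) hz
    (Submodule.sub_mem _ hbW (chainsIn_mono Set.inter_subset_left _ ha)) hba
  have h2 := push_mem_relBoundaries_of_injOn hW' (injOn_of_isOpenEmbedding hf') hz'
    (Submodule.sub_mem _ hbW' (chainsIn_mono Set.inter_subset_right _ ha')) hba'
  rw [map_sub] at h1 h2
  have h3 := mem_relBoundaries_singleton_of_push (isOpenEmbedding_mono hf hWW Set.inter_subset_left)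
    ⟨hz, hz'⟩ (Submodule.sub_mem _ ha ha') (by
      rw [map_sub]
      have := Submodule.add_mem _ (Submodule.add_mem _ (Submodule.sub_mem _ h h1) hγ)
        (Submodule.sub_mem _ h2 h')
      convert this using 1
      abel)
  have := Submodule.add_mem _ (Submodule.sub_mem _ hba hba') h3
  convert this using 1
  abel

/-- Excision identifies the local homology at z and at f z, since f is an open embedding near z. -/
theorem isLocalGenerator [T1Space X] [T1Space Y] (h : PushesTo f z b γ)
    (hγ : IsLocalGenerator (f z) γ) : IsLocalGenerator z b := by
  refine ⟨h.mem_relCycles hγ.mem_relCycles, fun c hc => ?_, fun t ht => ?_⟩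
  · obtain ⟨W, hW, hz, hf, hb, h⟩ := h
    obtain ⟨a, ha, hac, hca⟩ := exists_mem_chainsIn_of_relCycle hW
      isOpen_compl_singleton (union_compl_singleton_eq_univ hz) hc
    obtain ⟨t, ht⟩ := hγ.exists_sub_mem _
      (push_mem_relCycles_of_injOn (injOn_of_isOpenEmbedding hf) hz ha hac)
    refine ⟨t, ?_⟩
    have h1 := mem_relBoundaries_singleton_of_push hf hz
      (Submodule.sub_mem _ ha (Submodule.smul_mem _ t hb)) (by
        rw [map_sub, map_smul]
        have := Submodule.sub_mem _ ht (Submodule.smul_mem _ t h)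
        rwa [smul_sub, sub_sub, add_sub_cancel] at this)
    have := Submodule.add_mem _ hca h1
    rwa [sub_add_sub_cancel] at this
  · obtain ⟨W, hW, hz, hf, hb, h⟩ := h
    have h1 := push_mem_relBoundaries_of_injOn hW (injOn_of_isOpenEmbedding hf) hz
      (Submodule.smul_mem _ t hb) ht
    have h2 := Submodule.sub_mem _ h1 (Submodule.smul_mem _ t h)
    rw [map_smul, smul_sub, sub_sub_cancel] at h2
    exact hγ.eq_zero t h2

end PushesTo

end

end LocalGenerator

/-! ### Orientations as systems of chains -/

section OrientationSystem

variable {n : ℕ} {X Y : Type u} [TopologicalSpace X] [TopologicalSpace Y]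

/-- A locally consistent choice of chains which generate the local homology. -/
structure IsOrientationSystem (β : X → Chain ℤ X n) : Prop where
  isLocalGenerator : ∀ x, IsLocalGenerator x (β x)
  eventually : ∀ x, ∀ᶠ y in 𝓝 x, β x - β y ∈ relBoundaries ℤ ({y}ᶜ : Set X) n

/-- Orientations pull back along local homeomorphisms. -/
theorem exists_isOrientationSystem [T2Space X] [T2Space Y] {f : C(X, Y)} (hf : IsLocalHomeomorph f)
    {γ : X → Chain ℤ Y n} (hγ : ∀ x, IsLocalGenerator (f x) (γ x))
    (hloc : ∀ x, ∀ᶠ y in 𝓝 x, γ x - γ y ∈ relBoundaries ℤ ({f y}ᶜ : Set Y) n) :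
    ∃ β : X → Chain ℤ X n, IsOrientationSystem β ∧ ∀ x, PushesTo f x (β x) (γ x) := by
  have h : ∀ x, ∃ b, PushesTo f x b (γ x) := fun x => by
    obtain ⟨U, hU, hf⟩ := isLocalHomeomorph_iff_isOpenEmbedding_restrict.1 hf x
    exact exists_pushesTo isOpen_interior (isOpenEmbedding_mono (W := U) hf isOpen_interior
      interior_subset) (mem_interior_iff_mem_nhds.2 hU) (hγ x).mem_relCycles
  choose β hβ using h
  refine ⟨β, ⟨fun x => (hβ x).isLocalGenerator (hγ x), fun x => ?_⟩, hβ⟩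
  obtain ⟨W, hW, hx, hfW, hb, h⟩ := hβ x
  filter_upwards [hW.mem_nhds hx, hloc x, f.continuous.continuousAt.eventually
    (eventually_mem_relBoundaries h),
    eventually_mem_relCycles ((hβ x).mem_relCycles (hγ x).mem_relCycles)] with y hy h1 h2 h3
  exact PushesTo.sub_mem (γ := γ x) ⟨W, hW, hy, hfW, hb, h2⟩ h3 (hβ y)
    ((hβ y).mem_relCycles (hγ y).mem_relCycles) h1

theorem mem_chainsIn_compl {A : Type*} [CommRing A] {k : ℕ} {U : Set X} {c : Chain A X k}
    (h : ∀ y ∈ U, c ∈ chainsIn A ({y}ᶜ : Set X) k) : c ∈ chainsIn A Uᶜ k := by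
  intro s hs
  rintro _ ⟨p, rfl⟩ hp
  exact h _ hp hs ⟨p, rfl⟩ rfl

/-- The class of a relative cycle. -/
def RelHomology.mk {S : Set X} {c : Chain ℤ X n} (hc : c ∈ relCycles ℤ S n) : RelHomology ℤ S n :=
  Submodule.Quotient.mk ⟨c, hc⟩

theorem RelHomology.exists_mk {S : Set X} (a : RelHomology ℤ S n) :
    ∃ (c : Chain ℤ X n) (hc : c ∈ relCycles ℤ S n), RelHomology.mk hc = a := by
  obtain ⟨⟨c, hc⟩, rfl⟩ := Submodule.Quotient.mk_surjective _ a
  exact ⟨c, hc, rfl⟩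

theorem RelHomology.mk_eq_mk {S : Set X} {c c' : Chain ℤ X n} {hc : c ∈ relCycles ℤ S n}
    {hc' : c' ∈ relCycles ℤ S n} :
    RelHomology.mk hc = RelHomology.mk hc' ↔ c - c' ∈ relBoundaries ℤ S n := by
  rw [RelHomology.mk, RelHomology.mk, Submodule.Quotient.eq]
  rfl

theorem restrictTo_mk {U : Set X} {x : X} (hx : x ∈ U) {c : Chain ℤ X n}
    (hc : c ∈ relCycles ℤ Uᶜ n) : restrictTo n hx (RelHomology.mk hc) = RelHomology.mk
      (relCycles_mono (Set.compl_subset_compl.2 (Set.singleton_subset_iff.2 hx)) n hc) :=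
  rfl

theorem isLocalOrientation_mk_iff {x : X} {c : Chain ℤ X n}
    {hc : c ∈ relCycles ℤ ({x}ᶜ : Set X) n} :
    IsLocalOrientation n (RelHomology.mk hc : LocalHomology n x) ↔
      ∀ c' ∈ relCycles ℤ ({x}ᶜ : Set X) n, ∃ t : ℤ,
        c' - t • c ∈ relBoundaries ℤ ({x}ᶜ : Set X) n := by
  rw [IsLocalOrientation, Submodule.eq_top_iff']
  constructor
  · intro h c' hc'
    obtain ⟨t, ht⟩ := Submodule.mem_span_singleton.1 (h (RelHomology.mk hc'))
    exact ⟨t, RelHomology.mk_eq_mk (hc := hc') (hc' := Submodule.smul_mem _ t hc) |>.1 ht.symm⟩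
  · intro h a
    obtain ⟨c', hc', rfl⟩ := RelHomology.exists_mk a
    obtain ⟨t, ht⟩ := h c' hc'
    exact Submodule.mem_span_singleton.2 ⟨t, (RelHomology.mk_eq_mk (hc := hc')
      (hc' := Submodule.smul_mem _ t hc) |>.2 ht).symm⟩

/-- Around each point, some chain generates the local homology. -/
class HasLocalGenerators (n : ℕ) (X : Type u) [TopologicalSpace X] : Prop where
  exists_isOpenSimplex : ∀ x : X, ∃ s : C(Simplex n, X), IsOpenSimplex s ∧
    ∃ q ∈ interiorSimplex n, s q = x

theorem isLocalGenerator_of_isLocalOrientation [T1Space X] [HasLocalGenerators n X] {x : X}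
    {c : Chain ℤ X n} {hc : c ∈ relCycles ℤ ({x}ᶜ : Set X) n}
    (h : IsLocalOrientation n (RelHomology.mk hc : LocalHomology n x)) : IsLocalGenerator x c := by
  obtain ⟨s, hs, q, hq, rfl⟩ := HasLocalGenerators.exists_isOpenSimplex (n := n) x
  exact (hs.isLocalGenerator hq).of_exists_sub_mem hc (isLocalOrientation_mk_iff.1 h)

/-- A cycle relative to the complement of a point is a cycle relative to the complement of a
neighbourhood. -/
theorem exists_isOpen_mem_relCycles [T2Space X] {x : X} {c : Chain ℤ X n}
    (hc : c ∈ relCycles ℤ ({x}ᶜ : Set X) n) {V : Set X} (hV : V ∈ 𝓝 x) :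
    ∃ U ⊆ V, IsOpen U ∧ x ∈ U ∧ c ∈ relCycles ℤ Uᶜ n := by
  obtain ⟨U, hU, hUo, hx⟩ := mem_nhds_iff.1 (Filter.inter_mem (eventually_mem_relCycles hc) hV)
  exact ⟨U, fun y hy => (hU hy).2, hUo, hx, mem_chainsIn_compl fun y hy => (hU hy).1⟩

/-- Representatives are chosen independently at each point. They are compatible nearby because all
are congruent to one chain that represents the class on a neighbourhood. -/
theorem ManifoldOrientation.exists_isOrientationSystem [T2Space X] [HasLocalGenerators n X]
    (o : ManifoldOrientation n X) : ∃ γ : X → Chain ℤ X n, IsOrientationSystem γ ∧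
      ∀ x, ∃ h : γ x ∈ relCycles ℤ ({x}ᶜ : Set X) n, RelHomology.mk h = o.val x := by
  choose γ hγ hval using fun x => RelHomology.exists_mk (o.val x)
  refine ⟨γ, ⟨fun x => isLocalGenerator_of_isLocalOrientation (hc := hγ x) ?_, fun x => ?_⟩,
    fun x => ⟨hγ x, hval x⟩⟩
  · rw [hval]
    exact o.isLocalOrientation x
  · obtain ⟨U, hU, hx, a, ha⟩ := o.locally_consistent x
    obtain ⟨c, hc, rfl⟩ := RelHomology.exists_mk a
    have key : ∀ y ∈ U, c - γ y ∈ relBoundaries ℤ ({y}ᶜ : Set X) n := fun y hy => by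
      have := ha y hy
      rw [restrictTo_mk, ← hval] at this
      exact RelHomology.mk_eq_mk.1 this
    filter_upwards [hU.mem_nhds hx, eventually_mem_relBoundaries (key x hx)] with y hy h
    have := Submodule.sub_mem _ (key y hy) h
    rwa [sub_sub_sub_cancel_left] at this

theorem IsOrientationSystem.exists_manifoldOrientation [T2Space X] {β : X → Chain ℤ X n}
    (hβ : IsOrientationSystem β) : ∃ o : ManifoldOrientation n X,
      ∀ x, o.val x = RelHomology.mk (hβ.isLocalGenerator x).mem_relCycles := by
  refine ⟨⟨fun x => RelHomology.mk (hβ.isLocalGenerator x).mem_relCycles, fun x =>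
    isLocalOrientation_mk_iff.2 (hβ.isLocalGenerator x).exists_sub_mem, fun x => ?_⟩, fun x => rfl⟩
  obtain ⟨U, hUV, hU, hx, hc⟩ := exists_isOpen_mem_relCycles
    (hβ.isLocalGenerator x).mem_relCycles (hβ.eventually x)
  refine ⟨U, hU, hx, RelHomology.mk hc, fun y hy => ?_⟩
  rw [restrictTo_mk, RelHomology.mk_eq_mk]
  exact hUV hy

end OrientationSystem

/-! ### Lifts of simplices -/

section Lifts

variable {n : ℕ} {E X : Type*} [TopologicalSpace E] [TopologicalSpace X]

/-- Every map of the standard simplex lifts along `q`, with a prescribed value at a point. -/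
def LiftsSimplices (n : ℕ) (q : E → X) : Prop :=
  ∀ (f : C(Simplex n, X)) (p₀ : Simplex n) (y : E), q y = f p₀ →
    ∃ g : C(Simplex n, E), (∀ p, q (g p) = f p) ∧ g p₀ = y

theorem mix_zero (a b : Simplex n) : mix 0 a b = b := simplex_ext fun i => by simp [mix_apply]

theorem mix_one (a b : Simplex n) : mix 1 a b = a := simplex_ext fun i => by simp [mix_apply]

theorem mix_self (t : unitInterval) (a : Simplex n) : mix t a a = a :=
  simplex_ext fun i => by rw [mix_apply]; ring

/-- The homotopy that contracts the simplex to p₀ is lifted starting from the constant map y, and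
the lift is taken at time 1. Its value at p₀ is still y because the track of p₀ lies over a constant
path. -/
theorem liftsSimplices_of_isCoveringMap {q : E → X} (hq : IsCoveringMap q) : LiftsSimplices n q := by
  intro f p₀ y hy
  let H : C(unitInterval × Simplex n, X) := ⟨fun x => f (mix x.1 x.2 p₀), f.continuous.comp
    (continuous_mix.comp (continuous_fst.prodMk (continuous_snd.prodMk continuous_const)))⟩
  have H0 : ∀ a, H (0, a) = q (ContinuousMap.const (Simplex n) y a) := fun a => by
    change f (mix 0 a p₀) = q y
    rw [mix_zero, hy]
  let G := hq.liftHomotopy H (ContinuousMap.const _ y) H0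
  have hG : ∀ x, q (G x) = H x := fun x => congrFun (hq.liftHomotopy_lifts H _ H0) x
  refine ⟨⟨fun a => G (1, a), by fun_prop⟩, fun p => ?_, ?_⟩
  · change q (G (1, p)) = f p
    rw [hG]
    change f (mix 1 p p₀) = f p
    rw [mix_one]
  · refine Eq.trans ?_ (hq.liftHomotopy_zero H _ H0 p₀)
    refine hq.const_of_comp (g := fun t : unitInterval => G (t, p₀)) (by fun_prop) (fun t t' => ?_) 1 0
    rw [hG, hG]
    change f (mix t p₀ p₀) = f (mix t' p₀ p₀)
    rw [mix_self, mix_self]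

end Lifts

/-! ### The orientation covering -/

namespace OrientationCover

variable {n : ℕ} {X : Type u} [TopologicalSpace X]

/-- The projection of the orientation covering. -/
def proj (p : OrientationCover n X) : X := p.1

/-- A chain that represents a point of the orientation covering. -/
def rep (p : OrientationCover n X) : Chain ℤ X n := (RelHomology.exists_mk p.2.1).choose

theorem rep_mem (p : OrientationCover n X) : rep p ∈ relCycles ℤ ({proj p}ᶜ : Set X) n :=
  (RelHomology.exists_mk p.2.1).choose_spec.choose

theorem mk_rep (p : OrientationCover n X) : RelHomology.mk (rep_mem p) = p.2.1 :=
  (RelHomology.exists_mk p.2.1).choose_spec.choose_spec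

/-- The point of the orientation covering represented by a chain. -/
def ofChain {x : X} {b : Chain ℤ X n} (hb : IsLocalGenerator x b) : OrientationCover n X :=
  ⟨x, RelHomology.mk hb.mem_relCycles, isLocalOrientation_mk_iff.2 hb.exists_sub_mem⟩

theorem sub_rep_ofChain {x : X} {b : Chain ℤ X n} (hb : IsLocalGenerator x b) :
    b - rep (ofChain hb) ∈ relBoundaries ℤ ({x}ᶜ : Set X) n := by
  have := mk_rep (ofChain hb)
  exact RelHomology.mk_eq_mk.1 this.symm

theorem ext_of_sub_mem {p p' : OrientationCover n X} (h : proj p = proj p')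
    (h' : rep p - rep p' ∈ relBoundaries ℤ ({proj p}ᶜ : Set X) n) : p = p' := by
  have h1 := mk_rep p
  have h2 := mk_rep p'
  revert h1 h2 h'
  generalize rep_mem p = hp
  generalize rep_mem p' = hp'
  revert hp hp'
  generalize rep p = c
  generalize rep p' = c'
  obtain ⟨x, a, ha⟩ := p
  obtain ⟨x', a', ha'⟩ := p'
  obtain rfl : x = x' := h
  intro hp hp' h' h1 h2
  obtain rfl : a = a' := by
    rw [← show RelHomology.mk hp = a from h1, ← show RelHomology.mk hp' = a' from h2]
    exact RelHomology.mk_eq_mk.2 h'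
  rfl

/-- The points represented by the restrictions of a chain to the points of `U`. -/
def sheet (U : Set X) (c : Chain ℤ X n) : Set (OrientationCover n X) :=
  {p | proj p ∈ U ∧ c - rep p ∈ relBoundaries ℤ ({proj p}ᶜ : Set X) n}

theorem sheet_eq {U : Set X} {c : Chain ℤ X n} (hc : c ∈ relCycles ℤ Uᶜ n) :
    sheet U c = {p : OrientationCover n X |
      ∃ h : p.1 ∈ U, restrictTo n h (RelHomology.mk hc) = p.2.1} := by
  ext p
  constructor
  · rintro ⟨h1, h2⟩
    exact ⟨h1, (RelHomology.mk_eq_mk.2 h2).trans (mk_rep p)⟩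
  · rintro ⟨h1, h2⟩
    exact ⟨h1, RelHomology.mk_eq_mk.1 (Eq.trans h2 (mk_rep p).symm)⟩

theorem isOpen_sheet {U : Set X} (hU : IsOpen U) {c : Chain ℤ X n} (hc : c ∈ relCycles ℤ Uᶜ n) :
    IsOpen (sheet U c) :=
  TopologicalSpace.isOpen_generateFrom_of_mem ⟨U, hU, RelHomology.mk hc, sheet_eq hc⟩

/-- The section over U given by c is continuous: for each basic open set, agreement of its defining
chain with c modulo relative boundaries is an open condition. -/
theorem isOpen_proj_image [T2Space X] {U : Set X} (hU : IsOpen U) {c : Chain ℤ X n}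
    (hc : ∀ x ∈ U, IsLocalGenerator x c) {O : Set (OrientationCover n X)} (hO : IsOpen O) :
    IsOpen {x | ∃ h : x ∈ U, ofChain (hc x h) ∈ O} := by
  have hcont : Continuous fun x : U => ofChain (hc x x.2) := by
    refine continuous_generateFrom_iff.2 ?_
    rintro _ ⟨V, hV, a, rfl⟩
    obtain ⟨d, hd, rfl⟩ := RelHomology.exists_mk a
    rw [← sheet_eq hd, isOpen_iff_mem_nhds]
    rintro ⟨x, hx⟩ ⟨h1, h2⟩
    have hmem : ∀ y (hy : y ∈ U), d - rep (ofChain (hc y hy)) ∈ relBoundaries ℤ ({y}ᶜ : Set X) n ↔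
        d - c ∈ relBoundaries ℤ ({y}ᶜ : Set X) n := fun y hy => by
      have := sub_rep_ofChain (hc y hy)
      rw [← sub_add_sub_cancel d c]
      exact Submodule.add_mem_iff_left _ this
    have h3 : d - c ∈ relBoundaries ℤ ({x}ᶜ : Set X) n := (hmem x hx).1 h2
    have h4 : ∀ᶠ y in 𝓝 x, y ∈ V ∧ d - c ∈ relBoundaries ℤ ({y}ᶜ : Set X) n :=
      Filter.Eventually.and (hV.mem_nhds (show x ∈ V from h1)) (eventually_mem_relBoundaries h3)
    have h6 : Filter.Tendsto (Subtype.val : U → X) (𝓝 ⟨x, hx⟩) (𝓝 x) :=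
      continuous_subtype_val.continuousAt
    have h5 := h6.eventually h4
    filter_upwards [h5] with y hy
    exact ⟨hy.1, (hmem y y.2).2 hy.2⟩
  convert hU.isOpenMap_subtype_val _ (hO.preimage hcont) using 1
  ext x
  constructor
  · rintro ⟨h, h'⟩
    exact ⟨⟨x, h⟩, h', rfl⟩
  · rintro ⟨⟨x, h⟩, h', rfl⟩
    exact ⟨h, h'⟩

theorem isLocalGenerator_rep [T1Space X] [HasLocalGenerators n X] (p : OrientationCover n X) :
    IsLocalGenerator (proj p) (rep p) := by
  refine isLocalGenerator_of_isLocalOrientation (hc := rep_mem p) ?_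
  rw [mk_rep]
  exact p.2.2

theorem eventually_rep [T2Space X] (p : OrientationCover n X) :
    ∀ᶠ p' in 𝓝 p, rep p - rep p' ∈ relBoundaries ℤ ({proj p'}ᶜ : Set X) n := by
  obtain ⟨U, -, hU, hp, hc⟩ := exists_isOpen_mem_relCycles (rep_mem p) Filter.univ_mem
  filter_upwards [(isOpen_sheet hU hc).mem_nhds
    ⟨hp, by rw [sub_self]; exact Submodule.zero_mem _⟩] with p' hp'
  exact hp'.2

theorem single_mem_relCycles_of_isOpenSimplex {s : C(Simplex n, X)} (hs : IsOpenSimplex s)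
    {U : Set X} (hU : U ⊆ s '' interiorSimplex n) :
    Finsupp.single s (1 : ℤ) ∈ relCycles ℤ Uᶜ n := by
  refine mem_chainsIn_compl fun y hy => ?_
  obtain ⟨q, hq, rfl⟩ := hU hy
  exact hs.mem_relCycles hq

/-- Over an open simplex there are exactly two sheets, given by the simplex with coefficients 1 and
-1. They are disjoint because the simplex is a free generator, and exhaust the fibres because any
other generator differs by a sign. -/
theorem isCoveringMap_proj [T2Space X] [HasLocalGenerators n X] :
    IsCoveringMap (proj : OrientationCover n X → X) := by
  intro x
  obtain ⟨s, hs, q, hq, rfl⟩ := HasLocalGenerators.exists_isOpenSimplex (n := n) x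
  set V := s '' interiorSimplex n with hV
  have hVo : IsOpen V := hs.isOpen_image
  let c : ℤˣ → Chain ℤ X n := fun ε => (ε : ℤ) • Finsupp.single s 1
  have hgen : ∀ ε, ∀ y ∈ V, IsLocalGenerator y (c ε) := by
    rintro ε _ ⟨q, hq, rfl⟩
    exact (hs.isLocalGenerator hq).smul_of_isUnit (Int.units_coe_mul_self ε)
  have hc : ∀ ε, ∀ W ⊆ V, c ε ∈ relCycles ℤ Wᶜ n := fun ε W hW =>
    Submodule.smul_mem _ _ (single_mem_relCycles_of_isOpenSimplex hs hW)
  have hmem : ∀ ε y (hy : y ∈ V), ofChain (hgen ε y hy) ∈ sheet V (c ε) := fun ε y hy =>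
    ⟨hy, sub_rep_ofChain _⟩
  have huniq : ∀ ε, ∀ p ∈ sheet V (c ε), ∀ h, ofChain (hgen ε (proj p) h) = p := by
    intro ε p hp h
    refine ext_of_sub_mem rfl ?_
    have := Submodule.sub_mem _ hp.2 (sub_rep_ofChain (hgen ε (proj p) h))
    rwa [sub_sub_sub_cancel_left] at this
  have : Nonempty (X → OrientationCover n X) := ⟨fun _ => ofChain (hgen 1 (s q) ⟨q, hq, rfl⟩)⟩
  let t := hVo.trivializationDiscrete (f := (proj : OrientationCover n X → X)) (fun ε => sheet V (c ε)) V ?_ ?_ ?_ ?_ ?_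
  · exact (IsEvenlyCovered.of_trivialization (t := t) ⟨q, hq, rfl⟩).to_isEvenlyCovered_preimage
  · intro ε W hW
    have h1 : proj ⁻¹' W ∩ sheet V (c ε) = sheet W (c ε) := by
      ext p
      exact ⟨fun h => ⟨h.1, h.2.2⟩, fun h => ⟨h.1, hW h.1, h.2⟩⟩
    rw [h1]
    refine ⟨fun hWo => isOpen_sheet hWo (hc ε W hW), fun h => ?_⟩
    convert isOpen_proj_image hVo (hgen ε) h using 1
    ext y
    constructor
    · exact fun hy => ⟨hW hy, hy, sub_rep_ofChain _⟩
    · exact fun hy => hy.2.1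
  · intro ε p hp p' hp' h
    rw [← huniq ε p hp hp.1, ← huniq ε p' hp' hp'.1]
    congr 1
  · intro ε y hy
    exact ⟨_, hmem ε y hy, rfl⟩
  · intro ε ε' hne
    refine Set.disjoint_left.2 fun p hp hp' => hne ?_
    obtain ⟨q', hq', h⟩ := hp.1
    have h1 := Submodule.sub_mem _ hp.2 hp'.2
    rw [sub_sub_sub_cancel_right, ← h] at h1
    have h2 := hs.eq_zero hq' (t := ε - ε') (by rwa [sub_smul])
    exact Units.ext (by omega)
  · intro p hp
    obtain ⟨q', hq', h⟩ := hp
    have h1 := isLocalGenerator_rep p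
    rw [← h] at h1
    obtain ⟨ε, hε, h2⟩ := (hs.isLocalGenerator hq').exists_unit h1
    refine Set.mem_iUnion.2 ⟨if ε = 1 then 1 else -1, ⟨q', hq', h⟩, ?_⟩
    rw [← h, ← neg_sub]
    refine Submodule.neg_mem _ ?_
    rcases hε with rfl | rfl
    · exact h2
    · exact h2

/-- Every point of the fibre is plus or minus a fixed one. -/
theorem card_fiber_le [T2Space X] [HasLocalGenerators n X] (x : X) (F : Finset (OrientationCover n X))
    (hF : ∀ p ∈ F, proj p = x) : F.card ≤ 2 := by
  by_contra! h
  obtain ⟨a, b, c, ha, hb, hc, hab, hac, hbc⟩ := Finset.two_lt_card_iff.1 h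
  obtain rfl := hF a ha
  have key : ∀ p, proj p = proj a → ∃ ε : ℤ, (ε = 1 ∨ ε = -1) ∧
      rep p - ε • rep a ∈ relBoundaries ℤ ({proj a}ᶜ : Set X) n := fun p hp =>
    (isLocalGenerator_rep a).exists_unit (hp ▸ isLocalGenerator_rep p)
  have eq : ∀ p p', proj p = proj a → proj p' = proj a → ∀ ε : ℤ,
      rep p - ε • rep a ∈ relBoundaries ℤ ({proj a}ᶜ : Set X) n →
      rep p' - ε • rep a ∈ relBoundaries ℤ ({proj a}ᶜ : Set X) n → p = p' := by
    intro p p' hp hp' ε h h'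
    refine ext_of_sub_mem (hp.trans hp'.symm) ?_
    rw [hp]
    have := Submodule.sub_mem _ h h'
    rwa [sub_sub_sub_cancel_right] at this
  obtain ⟨ε, hε, h1⟩ := key b (hF b hb)
  obtain ⟨ε', hε', h2⟩ := key c (hF c hc)
  have ha1 : rep a - (1 : ℤ) • rep a ∈ relBoundaries ℤ ({proj a}ᶜ : Set X) n := by
    rw [one_smul, sub_self]
    exact Submodule.zero_mem _
  rcases hε with rfl | rfl
  · exact hab (eq a b rfl (hF b hb) 1 ha1 h1)
  · rcases hε' with rfl | rfl
    · exact hac (eq a c rfl (hF c hc) 1 ha1 h2)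
    · exact hbc (eq b c (hF b hb) (hF c hc) _ h1 h2)

theorem t2Space [T2Space X] [HasLocalGenerators n X] : T2Space (OrientationCover n X) := by
  have h := isCoveringMap_proj (n := n) (X := X)
  refine ⟨fun p p' hne => ?_⟩
  by_cases hp : proj p = proj p'
  · exact h.isSeparatedMap p p' hp hne
  · exact separated_by_continuous h.continuous hp

end OrientationCover

/-! ### Signs of adjacent simplices -/

section Signs

variable {n : ℕ} {X : Type u} [TopologicalSpace X]

theorem mix_mem_interiorSimplex {t : unitInterval} (ht : 0 < t) {a b : Simplex n}
    (ha : a ∈ interiorSimplex n) : mix t a b ∈ interiorSimplex n := fun i =>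
  add_pos_of_pos_of_nonneg (mul_pos ht (ha i)) (mul_nonneg (sub_nonneg.2 t.2.2) (b.2.1 i))

theorem isPreconnected_interiorSimplex : IsPreconnected (interiorSimplex n) := by
  refine isPreconnected_of_forall (barycenter n) fun p hp =>
    ⟨Set.range fun t : unitInterval => mix t p (barycenter n), ?_, ⟨0, mix_zero _ _⟩,
      ⟨1, mix_one _ _⟩, isPreconnected_range (continuous_mix.comp
        (continuous_id.prodMk (continuous_const.prodMk continuous_const)))⟩
  rintro _ ⟨t, rfl⟩ i
  change 0 < (t : ℝ) * p i + (1 - t) * barycenter n i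
  have h1 := hp i
  have h2 := barycenter_mem_interiorSimplex (n := n) i
  have h3 := t.2.1
  have h4 := t.2.2
  rcases eq_or_lt_of_le h3 with h | h
  · rw [← h]
    simpa using h2
  · exact add_pos_of_pos_of_nonneg (mul_pos h h1) (mul_nonneg (by linarith) h2.le)

theorem frequently_mem_interiorSimplex (p : Simplex n) : ∃ᶠ q in 𝓝 p, q ∈ interiorSimplex n := by
  have h1 : Filter.Tendsto (fun t : unitInterval => mix t (barycenter n) p) (𝓝[>] 0) (𝓝 p) := by
    have : Continuous fun t : unitInterval => mix t (barycenter n) p := continuous_mix.comp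
      (continuous_id.prodMk (continuous_const.prodMk continuous_const))
    have := this.tendsto 0
    rw [mix_zero] at this
    exact this.mono_left nhdsWithin_le_nhds
  have : (𝓝[>] (0 : unitInterval)).NeBot := nhdsGT_neBot_of_exists_gt ⟨1, zero_lt_one⟩
  refine h1.frequently (Filter.Eventually.frequently ?_)
  filter_upwards [self_mem_nhdsWithin] with t ht
  exact mix_mem_interiorSimplex ht barycenter_mem_interiorSimplex

/-- The class of the open simplex `s` is `ε` times the orientation `β`. -/
def HasSign (β : X → Chain ℤ X n) (s : C(Simplex n, X)) (ε : ℤ) : Prop :=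
  ∀ q ∈ interiorSimplex n,
    Finsupp.single s 1 - ε • β (s q) ∈ relBoundaries ℤ ({s q}ᶜ : Set X) n

theorem IsOpenSimplex.exists_hasSign [T2Space X] {β : X → Chain ℤ X n} (hβ : IsOrientationSystem β)
    {s : C(Simplex n, X)} (hs : IsOpenSimplex s) :
    ∃ ε : ℤ, (ε = 1 ∨ ε = -1) ∧ HasSign β s ε := by
  have hb := barycenter_mem_interiorSimplex (n := n)
  obtain ⟨ε, hε, h⟩ := (hβ.isLocalGenerator (s (barycenter n))).exists_unit (hs.isLocalGenerator hb)
  refine ⟨ε, hε, fun q hq => ?_⟩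
  refine eq_on_isPreconnected (R := fun q t => Finsupp.single s 1 - t • β (s q) ∈
    relBoundaries ℤ ({s q}ᶜ : Set X) n) isPreconnected_interiorSimplex (fun q hq => ?_)
    (fun q hq t t' h h' => ?_) (fun q hq t h => ?_) hb hq h
  · obtain ⟨ε, -, h⟩ := (hβ.isLocalGenerator (s q)).exists_unit (hs.isLocalGenerator hq)
    exact ⟨ε, h⟩
  · exact (hβ.isLocalGenerator _).eq_of_sub_mem h h'
  · refine s.continuous.continuousAt.eventually (p := fun y => Finsupp.single s 1 - t • β y ∈
      relBoundaries ℤ ({y}ᶜ : Set X) n) ?_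
    filter_upwards [eventually_mem_relBoundaries h, hβ.eventually (s q)] with y h1 h2
    have := Submodule.add_mem _ h1 (Submodule.smul_mem _ t h2)
    rwa [smul_sub, sub_add_sub_cancel] at this

theorem push_eq_push {Y : Type*} [TopologicalSpace Y] {f g : C(X, Y)} {S : Set X}
    (h : ∀ x ∈ S, f x = g x) {k : ℕ} {c : Chain ℤ X k} (hc : c ∈ chainsIn ℤ S k) :
    push f k c = push g k c := by
  have : c ∈ LinearMap.ker (push f k - push g k) := by
    refine mem_of_supported hc _ fun s hs => ?_
    rw [LinearMap.mem_ker, LinearMap.sub_apply, push_single, push_single, sub_eq_zero]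
    congr 1
    ext1 p
    exact h _ (hs ⟨p, rfl⟩)
  rwa [LinearMap.mem_ker, LinearMap.sub_apply, sub_eq_zero] at this

theorem isOpen_lt_coordinates (k : Fin (n + 1)) :
    IsOpen {p : Simplex n | ∀ l, l ≠ k → p k < p l} := by
  have : {p : Simplex n | ∀ l, l ≠ k → p k < p l} = ⋂ l, {p | l ≠ k → p k < p l} := by
    ext p
    simp
  rw [this]
  refine isOpen_iInter_of_finite fun l => ?_
  by_cases h : l = k
  · simp [h]
  · simpa [h] using isOpen_lt (continuous_simplex_apply k) (continuous_simplex_apply l)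

/-- Two simplices on different sides of a common facet have opposite signs. -/
theorem HasSign.eq_neg [T2Space X] {N : ℕ} {β : X → Chain ℤ X (N + 1)}
    (hβ : IsOrientationSystem β) {s s' : C(Simplex (N + 1), X)} {ε ε' : ℤ} (h : HasSign β s ε)
    (h' : HasSign β s' ε') (hinj : ∀ q ∈ interiorSimplex (N + 1), ∀ p, s p = s q → p = q)
    (hinj' : ∀ q ∈ interiorSimplex (N + 1), ∀ p, s' p = s' q → p = q) {k : Fin (N + 2)}
    {W F : Set (Simplex (N + 1))} (hW : W = {p | ∀ l, l ≠ k → p k < p l}) (hF : F = {p | p k = 0})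
    (hss : ∀ p ∈ F, s p = s' p) {p₀ : Simplex (N + 1)} (hp₀F : p₀ ∈ F) (hp₀W : p₀ ∈ W)
    (hp₀ : ∀ p ∈ W ∪ F, s p = s p₀ → p = p₀) (hp₀' : ∀ p ∈ W ∪ F, s' p = s p₀ → p = p₀)
    (hsep : ∀ q ∈ W ∩ interiorSimplex (N + 1), ∀ p ∈ W, s p ≠ s' q ∧ s' p ≠ s q) : ε' = -ε := by
  have hWo : IsOpen W := hW ▸ isOpen_lt_coordinates k
  -- After subdivision the simplex splits into a part a near p₀, inside W, and a part b that misses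
  -- p₀.
  obtain ⟨m, a, ha, b, hb, hab⟩ := exists_sdIter_eq_add hWo
    (isOpen_compl_singleton (x := p₀)) (c := idChain (N + 1)) (by
      rw [union_compl_singleton_eq_univ hp₀W]; exact mem_chainsIn_univ _)
  set x := s p₀ with hx
  set φ : Chain ℤ (Simplex (N + 1)) N :=
    (-1 : ℤ) ^ (k : ℕ) • sdIter m N (Finsupp.single (faceMap k) 1) with hφ
  have hφF : φ ∈ chainsIn ℤ F N := by
    refine Submodule.smul_mem _ _ (sdIter_mem_chainsIn m (single_mem_chainsIn ?_ _))
    rintro _ ⟨p, rfl⟩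
    rw [hF]
    exact faceMap_self k p
  -- Near p₀ the boundary of a consists only of the subdivided facet k, since p₀ lies on no other
  -- facet.
  have hr : bd ℤ a - φ ∈ chainsIn ℤ ((W ∪ F) ∩ {p₀}ᶜ) N := by
    refine chainsIn_inter (Submodule.sub_mem _
      (chainsIn_mono Set.subset_union_left _ (boundary_mem_chainsIn ha))
      (chainsIn_mono Set.subset_union_right _ hφF)) ?_
    have h1 : bd ℤ a - φ = (sdIter m N (bd ℤ (idChain (N + 1))) - φ) - bd ℤ b := by
      have := boundary_sdIter m (idChain (N + 1))
      rw [← hab, map_add] at this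
      have h2 : bd ℤ a = sdIter m N (bd ℤ (idChain (N + 1))) - bd ℤ b := eq_sub_of_add_eq this
      rw [h2]
      abel
    rw [h1]
    refine Submodule.sub_mem _ ?_ (boundary_mem_chainsIn hb)
    have h2 : bd ℤ (idChain (N + 1)) = (-1 : ℤ) ^ (k : ℕ) • Finsupp.single (faceMap k) 1 +
        ∑ l ∈ Finset.univ.erase k, (-1 : ℤ) ^ (l : ℕ) • Finsupp.single (faceMap l) 1 := by
      rw [Finset.add_sum_erase _ (fun l : Fin (N + 2) =>
        (-1 : ℤ) ^ (l : ℕ) • (Finsupp.single (faceMap l) 1 : Chain ℤ (Simplex (N + 1)) N))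
        (Finset.mem_univ k), idChain, boundary_single]
      rfl
    rw [h2, map_add, map_smul, ← hφ, add_sub_cancel_left]
    refine sdIter_mem_chainsIn m (Submodule.sum_mem _ fun l hl =>
      Submodule.smul_mem _ _ (single_mem_chainsIn ?_ _))
    rintro _ ⟨p, rfl⟩ hp
    have h3 := faceMap_self l p
    rw [Set.mem_singleton_iff.1 hp] at h3
    rw [hW] at hp₀W
    rw [hF] at hp₀F
    have h4 := hp₀W l (Finset.ne_of_mem_erase hl)
    have h5 : p₀ k = 0 := hp₀F
    linarith
  -- The two sides are joined along the facet. There s and s' agree, so the facet cancels and e is a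
  -- cycle relative to the complement of x; it is t times the orientation at x and at all nearby
  -- points.
  set e := push s (N + 1) a - push s' (N + 1) a with he
  have hecyc : e ∈ relCycles ℤ ({x}ᶜ : Set X) (N + 1) := by
    have h1 : bd ℤ e = push s N (bd ℤ a - φ) - push s' N (bd ℤ a - φ) := by
      rw [he, map_sub, bd_push, bd_push, map_sub, map_sub, push_eq_push hss hφF]
      abel
    have h2 : bd ℤ e ∈ chainsIn ℤ ({x}ᶜ : Set X) N := by
      rw [h1]
      exact Submodule.sub_mem _ (push_mem_chainsIn (fun p hp h => hp.2 (hp₀ p hp.1 h)) hr)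
        (push_mem_chainsIn (fun p hp h => hp.2 (hp₀' p hp.1 h)) hr)
    exact h2
  obtain ⟨t, ht⟩ := (hβ.isLocalGenerator x).exists_sub_mem e hecyc
  have hnear : ∀ᶠ y in 𝓝 x, e - t • β y ∈ relBoundaries ℤ ({y}ᶜ : Set X) (N + 1) := by
    filter_upwards [eventually_mem_relBoundaries ht, hβ.eventually x] with y h1 h2
    have := Submodule.add_mem _ h1 (Submodule.smul_mem _ t h2)
    rwa [smul_sub, sub_add_sub_cancel] at this
  have hs' : Filter.Tendsto s' (𝓝 p₀) (𝓝 x) := by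
    rw [hx, hss p₀ hp₀F]
    exact s'.continuous.continuousAt
  have hs : Filter.Tendsto s (𝓝 p₀) (𝓝 x) := s.continuous.continuousAt
  have hev := Filter.Eventually.and (hs.eventually hnear) (Filter.Eventually.and
    (hs'.eventually hnear) (Filter.Eventually.and (hWo.mem_nhds hp₀W) (eventually_mem_chainsIn hb)))
  obtain ⟨q, hq, h1, h2, hqW, hqb⟩ :=
    ((frequently_mem_interiorSimplex p₀).and_eventually hev).exists
  have haq : a - idChain (N + 1) ∈ relBoundaries ℤ ({q}ᶜ : Set (Simplex (N + 1))) (N + 1) := by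
    have h3 := sub_sdIter_mem_relBoundaries m (IsOpenSimplex.idChain_mem_relCycles hq)
    rw [← hab] at h3
    have := Submodule.neg_mem _ (Submodule.add_mem _ h3 (chainsIn_le_relBoundaries hqb))
    convert this using 1
    abel
  -- At an interior point on the side of s the other chain is invisible and a represents the whole
  -- simplex, so t is the sign of s. With s and s' exchanged, e changes sign and -t is the sign of
  -- s'.
  have key : ∀ (s s' : C(Simplex (N + 1), X)) (ε t : ℤ), HasSign β s ε →
      (∀ p, s p = s q → p = q) → (∀ p ∈ W, s' p ≠ s q) →
      push s (N + 1) a - push s' (N + 1) a - t • β (s q) ∈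
        relBoundaries ℤ ({s q}ᶜ : Set X) (N + 1) → t = ε := by
    intro s s' ε t h hinj hW h1
    have h3 := push_mem_relBoundaries (f := s) (S := {q}ᶜ) (T := {s q}ᶜ)
      (fun p hp h => hp (hinj p h)) haq
    rw [map_sub, push_idChain] at h3
    have h4 : push s' (N + 1) a ∈ relBoundaries ℤ ({s q}ᶜ : Set X) (N + 1) :=
      chainsIn_le_relBoundaries (push_mem_chainsIn (fun p hp => hW p hp) ha)
    refine (hβ.isLocalGenerator (s q)).eq_of_sub_mem (c := push s (N + 1) a) ?_ ?_
    · have := Submodule.add_mem _ h1 h4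
      convert this using 1
      abel
    have := Submodule.add_mem _ h3 (h q hq)
    convert this using 1
    abel
  have e1 := key s s' ε t h (hinj q hq) (fun p hp => (hsep q ⟨hqW, hq⟩ p hp).2) h1
  have e2 := key s' s ε' (-t) h' (hinj' q hq) (fun p hp => (hsep q ⟨hqW, hq⟩ p hp).1) (by
    have := Submodule.neg_mem _ h2
    convert this using 1
    rw [he, neg_smul]
    abel)
  omega

end Signs

/-! ### Spaces glued from simplices -/

section Gluing

variable {n : ℕ} {ι : Type*} {X : Type u} [TopologicalSpace X]

/-- A presentation of the space `X` as a union of simplices, glued along paired facets. -/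
structure SimplexGluing (n : ℕ) (ι : Type*) (X : Type u) [TopologicalSpace X] where
  simplex : ι → C(Simplex n, X)
  nbr : ι → Fin (n + 1) → ι
  perm : ι → Fin (n + 1) → Equiv.Perm (Fin (n + 1))
  nbr_nbr : ∀ i k, nbr (nbr i k) (perm i k k) = i
  perm_perm : ∀ i k, perm (nbr i k) (perm i k k) = (perm i k)⁻¹
  ne_self : n ≠ 0 → ∀ i k, (nbr i k, perm i k k) ≠ (i, k)
  glue : ∀ i k p, p k = 0 → simplex (nbr i k) (vertexMap (perm i k) p) = simplex i p
  isOpenSimplex : ∀ i, IsOpenSimplex (simplex i)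
  eq_of_interior : ∀ i j p, ∀ q ∈ interiorSimplex n, simplex j p = simplex i q → j = i
  eq_of_facet : ∀ i j k p p', p k = 0 → (∀ l, l ≠ k → 0 < p l) → simplex j p' = simplex i p →
    (j = i ∧ p' = p) ∨ (j = nbr i k ∧ p' = vertexMap (perm i k) p)
  exists_eq : ∀ x, ∃ i p, simplex i p = x

namespace SimplexGluing

variable (G : SimplexGluing n ι X)

/-- `HasSign.eq_neg` is applied to the simplex i and to its neighbour reparametrized by the gluing
permutation, which agree on the facet k; the reparametrization multiplies the sign of the neighbour
by the sign of the permutation. -/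
theorem sign_nbr [T2Space X] {β : X → Chain ℤ X n} (hβ : IsOrientationSystem β) {ε : ι → ℤ}
    (hε : ∀ i, HasSign β (G.simplex i) (ε i)) (hn : n ≠ 0) (i : ι) (k : Fin (n + 1)) :
    ε (G.nbr i k) * (Equiv.Perm.sign (G.perm i k) : ℤ) = -ε i := by
  obtain ⟨N, rfl⟩ := Nat.exists_eq_succ_of_ne_zero hn
  set π := G.perm i k with hπ
  set j := G.nbr i k with hj
  have hsym : ∀ p l, vertexMap π p l = p (π.symm l) := fun p l => by
    rw [← vertexMap_perm_apply π p, Equiv.apply_symm_apply]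
  -- A simplex may be glued to itself, but then along two different facets. The condition that
  -- coordinate k is the strictly smallest one separates the neighbourhoods of these two facets.
  have hne : j = i → π k ≠ k := fun h h' => G.ne_self hn i k (Prod.ext h h')
  set p₀ : Simplex (N + 1) := faceMap k (barycenter N) with hp₀
  have hk : p₀ k = 0 := faceMap_self k _
  have hl : ∀ l, l ≠ k → 0 < p₀ l := fun l hl => by
    obtain ⟨l, rfl⟩ := Fin.exists_succAbove_eq hl
    rw [hp₀, faceMap_succAbove]
    exact barycenter_mem_interiorSimplex l
  have hperm : ∀ q ∈ interiorSimplex (N + 1), ∀ p,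
      G.simplex j (vertexMap π p) = G.simplex j (vertexMap π q) → p = q := fun q hq p h => by
    have := (G.isOpenSimplex j).eq_of_eq _ ((vertexMap_perm_mem_interior π).2 hq) _ h
    refine simplex_ext fun l => ?_
    rw [← vertexMap_perm_apply π p, ← vertexMap_perm_apply π q, this]
  refine HasSign.eq_neg hβ (hε i) (s' := (G.simplex j).comp (vertexMap π)) ?_
    (fun q hq p => (G.isOpenSimplex i).eq_of_eq q hq p) (fun q hq p => hperm q hq p) (k := k) rfl rfl
    (fun p hp => (G.glue i k p hp).symm) (p₀ := p₀) hk (fun l h => by rw [hk]; exact hl l h) ?_ ?_ ?_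
  · intro q hq
    have hq' := (vertexMap_perm_mem_interior π).2 hq
    have h1 := (G.isOpenSimplex j).perm_sub_mem hq' π
    have h2 := Submodule.smul_mem _ (Equiv.Perm.sign π : ℤ) (hε j _ hq')
    have := Submodule.add_mem _ h1 h2
    rw [smul_sub, smul_smul, sub_add_sub_cancel, mul_comm] at this
    exact this
  · intro p hp h
    rcases G.eq_of_facet i i k p₀ p hk hl h with h | ⟨h1, rfl⟩
    · exact h.2
    · exfalso
      have hπk := hne h1.symm
      have hkk : 0 < vertexMap π p₀ k := by
        rw [hsym]
        exact hl _ fun h' => hπk (by rw [← h', Equiv.apply_symm_apply, h'])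
      rcases hp with hp | hp
      · have := hp (π k) hπk
        rw [vertexMap_perm_apply, hk] at this
        linarith
      · exact hkk.ne' hp
  · intro p hp h
    rcases G.eq_of_facet i j k p₀ _ hk hl h with h | ⟨-, h⟩
    · exfalso
      have hπk := hne h.1
      have h3 : ∀ l, p l = p₀ (π l) := fun l => by
        rw [← h.2]
        exact (vertexMap_perm_apply π p l).symm
      have hkk : 0 < p k := by
        rw [h3]
        exact hl _ hπk
      rcases hp with hp | hp
      · have h4 : π.symm k ≠ k := fun h' => hπk (by rw [← h', Equiv.apply_symm_apply, h'])
        have := hp (π.symm k) h4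
        rw [h3 (π.symm k), Equiv.apply_symm_apply, hk] at this
        linarith
      · exact hkk.ne' hp
    · refine simplex_ext fun l => ?_
      rw [← vertexMap_perm_apply π p, h, vertexMap_perm_apply]
  · rintro q ⟨hqW, hq⟩ p hp
    have hq' := (vertexMap_perm_mem_interior π).2 hq
    constructor
    · intro h
      have hij := (G.eq_of_interior _ _ _ _ hq' h).symm
      have hπk := hne hij
      change G.simplex i p = G.simplex j _ at h
      rw [hij] at h
      have h' := (G.isOpenSimplex i).eq_of_eq _ hq' _ h
      have h1 := hp (π k) hπk
      have h4 : π.symm k ≠ k := fun h' => hπk (by rw [← h', Equiv.apply_symm_apply, h'])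
      have h2 := hqW (π.symm k) h4
      rw [h', vertexMap_perm_apply, hsym] at h1
      linarith
    · intro h
      have hij := G.eq_of_interior _ _ _ _ hq h
      have hπk := hne hij
      change G.simplex j _ = G.simplex i q at h
      rw [hij] at h
      have h' := (G.isOpenSimplex i).eq_of_eq _ hq _ h
      have h1 := hqW (π k) hπk
      have h4 : π.symm k ≠ k := fun h' => hπk (by rw [← h', Equiv.apply_symm_apply, h'])
      have h2 := hp (π.symm k) h4
      rw [← h', vertexMap_perm_apply, hsym] at h1
      linarith

variable [Fintype ι]

/-- The alternating sum of the parametrizations of the simplices, with signs `ε`. -/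
def signedSum (ε : ι → ℤ) : Chain ℤ X n :=
  ∑ i, ∑ π : Equiv.Perm (Fin (n + 1)),
    Finsupp.single ((G.simplex i).comp (vertexMap π)) (ε i * (Equiv.Perm.sign π : ℤ))

/-- Facet k of the simplex i parametrized by π lies on the facet π k of the simplex. Composing π
with the gluing permutation parametrizes the neighbour so that its facet k is the same singular
simplex, and by `sign_nbr` its coefficient is the opposite one. This matching is an involution. -/
theorem boundary_signedSum [T2Space X] {β : X → Chain ℤ X n} (hβ : IsOrientationSystem β)
    {ε : ι → ℤ} (hε : ∀ i, HasSign β (G.simplex i) (ε i)) :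
    boundary ℤ X n (G.signedSum ε) = 0 := by
  classical
  cases n with
  | zero => rfl
  | succ N =>
    have h1 : boundary ℤ X (N + 1) (G.signedSum ε) =
        ∑ x : (ι × Equiv.Perm (Fin (N + 2))) × Fin (N + 2), Finsupp.single
          (((G.simplex x.1.1).comp (vertexMap x.1.2)).comp (faceMap x.2))
          (ε x.1.1 * (Equiv.Perm.sign x.1.2 : ℤ) * (-1) ^ (x.2 : ℕ)) := by
      rw [signedSum, map_sum, Fintype.sum_prod_type, Fintype.sum_prod_type]
      refine Finset.sum_congr rfl fun i _ => ?_
      rw [map_sum]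
      refine Finset.sum_congr rfl fun π _ => ?_
      rw [← mul_one (ε i * (Equiv.Perm.sign π : ℤ)), ← smul_eq_mul, ← Finsupp.smul_single, map_smul]
      refine (congrArg _ (boundary_single _ _)).trans ?_
      rw [Finset.smul_sum]
      refine Finset.sum_congr rfl fun k _ => ?_
      rw [smul_smul, Finsupp.smul_single, smul_eq_mul, mul_one]
      rfl
    rw [h1]
    let g : (ι × Equiv.Perm (Fin (N + 2))) × Fin (N + 2) →
        (ι × Equiv.Perm (Fin (N + 2))) × Fin (N + 2) := fun x =>
      ((G.nbr x.1.1 (x.1.2 x.2), G.perm x.1.1 (x.1.2 x.2) * x.1.2), x.2)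
    refine Finset.sum_involution (fun x _ => g x) ?_ ?_ (fun _ _ => Finset.mem_univ _) ?_
    · rintro ⟨⟨i, π⟩, k⟩ -
      have h2 : ((G.simplex (G.nbr i (π k))).comp (vertexMap (G.perm i (π k) * π))).comp
          (faceMap k) = ((G.simplex i).comp (vertexMap π)).comp (faceMap k) := by
        rw [Equiv.Perm.coe_mul, ← vertexMap_comp]
        ext1 p
        refine G.glue i (π k) _ ?_
        rw [vertexMap_perm_apply]
        exact faceMap_self k p
      simp only [g, h2]
      rw [← Finsupp.single_add, Equiv.Perm.sign_mul, Units.val_mul, ← mul_assoc,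
        G.sign_nbr hβ hε (Nat.succ_ne_zero N)]
      refine (congrArg _ ?_).trans (Finsupp.single_zero _)
      ring
    · rintro ⟨⟨i, π⟩, k⟩ - - h
      simp only [g, Prod.mk.injEq, mul_eq_right] at h
      refine G.ne_self (Nat.succ_ne_zero N) i (π k) (Prod.ext h.1.1 ?_)
      rw [h.1.2]
      rfl
    · rintro ⟨⟨i, π⟩, k⟩ -
      simp only [g, Equiv.Perm.coe_mul, Function.comp_apply, G.nbr_nbr, G.perm_perm,
        inv_mul_cancel_left]

/-- At an interior point of a simplex only its own (n + 1)! parametrizations are visible, and each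
of them contributes the orientation class exactly once. -/
theorem signedSum_sub_mem [T2Space X] {β : X → Chain ℤ X n} (hβ : IsOrientationSystem β)
    {ε : ι → ℤ} (hε : ∀ i, HasSign β (G.simplex i) (ε i)) (hε' : ∀ i, ε i = 1 ∨ ε i = -1) (x : X) :
    G.signedSum ε - ((n + 1).factorial : ℤ) • β x ∈ relBoundaries ℤ ({x}ᶜ : Set X) n := by
  classical
  have hcyc : ∀ x : X, G.signedSum ε ∈ relCycles ℤ ({x}ᶜ : Set X) n := fun x => by
    rw [mem_relCycles, G.boundary_signedSum hβ hε]
    exact Submodule.zero_mem _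
  have hint : ∀ i, ∀ q ∈ interiorSimplex n, G.signedSum ε - ((n + 1).factorial : ℤ) •
      β (G.simplex i q) ∈ relBoundaries ℤ ({G.simplex i q}ᶜ : Set X) n := by
    intro i q hq
    have h1 : ∀ π : Equiv.Perm (Fin (n + 1)), Finsupp.single ((G.simplex i).comp (vertexMap π))
        (ε i * (Equiv.Perm.sign π : ℤ)) - β (G.simplex i q) ∈
          relBoundaries ℤ ({G.simplex i q}ᶜ : Set X) n := by
      intro π
      have h2 := Submodule.smul_mem _ (ε i * (Equiv.Perm.sign π : ℤ))
        ((G.isOpenSimplex i).perm_sub_mem hq π)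
      have h3 := Submodule.smul_mem _ (ε i) (hε i q hq)
      have hs : (Equiv.Perm.sign π : ℤ) * (Equiv.Perm.sign π : ℤ) = 1 :=
        Int.units_coe_mul_self _
      have he : ε i * ε i = 1 := by rcases hε' i with h | h <;> rw [h] <;> rfl
      rw [smul_sub, smul_smul, mul_assoc, hs, mul_one, Finsupp.smul_single, smul_eq_mul,
        mul_one] at h2
      rw [smul_sub, smul_smul, he, one_smul] at h3
      have := Submodule.add_mem _ h2 h3
      rwa [sub_add_sub_cancel] at this
    have h2 : G.signedSum ε - ((n + 1).factorial : ℤ) • β (G.simplex i q) =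
        (∑ π : Equiv.Perm (Fin (n + 1)), (Finsupp.single ((G.simplex i).comp (vertexMap π))
        (ε i * (Equiv.Perm.sign π : ℤ)) - β (G.simplex i q))) +
        ∑ j ∈ Finset.univ.erase i, ∑ π : Equiv.Perm (Fin (n + 1)),
          Finsupp.single ((G.simplex j).comp (vertexMap π)) (ε j * (Equiv.Perm.sign π : ℤ)) := by
      rw [signedSum, ← Finset.add_sum_erase _ _ (Finset.mem_univ i), Finset.sum_sub_distrib,
        Finset.sum_const, Finset.card_univ, Fintype.card_perm, Fintype.card_fin,
        natCast_zsmul]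
      abel
    rw [h2]
    refine Submodule.add_mem _ (Submodule.sum_mem _ fun π _ => h1 π) (chainsIn_le_relBoundaries
      (Submodule.sum_mem _ fun j hj => Submodule.sum_mem _ fun π _ => single_mem_chainsIn ?_ _))
    rintro _ ⟨p, rfl⟩ h
    exact Finset.ne_of_mem_erase hj (G.eq_of_interior _ _ _ q hq h)
  obtain ⟨i, p, rfl⟩ := G.exists_eq x
  -- Points on facets are reached because the multiplicity is locally constant along the connected
  -- image of the simplex, whose center is an interior point.
  refine eq_on_isPreconnected (R := fun x t => G.signedSum ε - t • β x ∈
    relBoundaries ℤ ({x}ᶜ : Set X) n) (isPreconnected_range (G.simplex i).continuous)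
    (fun x _ => (hβ.isLocalGenerator x).exists_sub_mem _ (hcyc x))
    (fun x _ t t' h h' => (hβ.isLocalGenerator x).eq_of_sub_mem h h') (fun x _ t h => ?_)
    ⟨barycenter n, rfl⟩ ⟨p, rfl⟩ (hint i _ barycenter_mem_interiorSimplex)
  filter_upwards [eventually_mem_relBoundaries h, hβ.eventually x] with y h1 h2
  have := Submodule.add_mem _ h1 (Submodule.smul_mem _ t h2)
  rwa [smul_sub, sub_add_sub_cancel] at this

/-- A manifold glued from simplices has a cycle which is `(n + 1)!` times the fundamental cycle. -/
theorem exists_cycle [T2Space X] {β : X → Chain ℤ X n} (hβ : IsOrientationSystem β) :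
    ∃ ε : ι → ℤ, (∀ i, ε i = 1 ∨ ε i = -1) ∧ boundary ℤ X n (G.signedSum ε) = 0 ∧
      ∀ x, G.signedSum ε - ((n + 1).factorial : ℤ) • β x ∈ relBoundaries ℤ ({x}ᶜ : Set X) n := by
  choose ε hε' hε using fun i => (G.isOpenSimplex i).exists_hasSign hβ
  exact ⟨ε, hε', G.boundary_signedSum hβ hε, G.signedSum_sub_mem hβ hε hε'⟩

end SimplexGluing

end Gluing

/-! ### The degree of a local homeomorphism with finite fibres -/

section Degree

variable {n : ℕ} {X Y : Type u} [TopologicalSpace X] [TopologicalSpace Y]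

/-- The cycle is subdivided into pieces near the points of the fibre and a rest that misses the
fibre. Each piece represents k times the local class and pushes forward to k times γ; the rest
misses y after the push. -/
theorem push_sub_mem_relBoundaries [T2Space X] [T1Space Y] {f : C(X, Y)} {c : Chain ℤ X n}
    (hc : boundary ℤ X n c = 0) {β : X → Chain ℤ X n} {k : ℤ}
    (hcβ : ∀ x, c - k • β x ∈ relBoundaries ℤ ({x}ᶜ : Set X) n) {y : Y} {γ : Chain ℤ Y n}
    (F : Finset X) (hF : ∀ x, x ∈ F ↔ f x = y) (hβ : ∀ x ∈ F, PushesTo f x (β x) γ) :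
    push f n c - ((F.card : ℤ) * k) • γ ∈ relBoundaries ℤ ({y}ᶜ : Set Y) n := by
  classical
  obtain ⟨U, hU, hdisj⟩ := F.finite_toSet.t2_separation
  choose! W hW hxW hfW hβW hβγ using hβ
  set V : X → Set X := fun x => U x ∩ W x with hV
  have hVo : ∀ x ∈ F, IsOpen (V x) := fun x hx => (hU x).2.inter (hW x hx)
  have hxV : ∀ x ∈ F, x ∈ V x := fun x hx => ⟨(hU x).1, hxW x hx⟩
  have hFo : IsOpen ((F : Set X)ᶜ) := F.finite_toSet.isClosed.isOpen_compl
  have hev := eventually_sdIter_small (𝒰 := insert (F : Set X)ᶜ (V '' (F : Set X))) (c := c) (by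
    rintro _ (rfl | ⟨x, hx, rfl⟩)
    · exact hFo
    · exact hVo x hx) (by
    convert mem_chainsIn_univ c
    refine Set.eq_univ_of_forall fun x => ?_
    by_cases hx : x ∈ F
    · exact ⟨V x, Or.inr ⟨x, hx, rfl⟩, hxV x hx⟩
    · exact ⟨_, Or.inl rfl, hx⟩)
  obtain ⟨m, hm⟩ := hev.exists
  have hdec : sdIter m n c ∈ (⨆ x ∈ F, chainsIn ℤ (V x) n) ⊔ chainsIn ℤ ((F : Set X)ᶜ) n := by
    refine mem_of_supported hm _ fun s hs => ?_
    obtain ⟨_, rfl | ⟨x, hx, rfl⟩, hs⟩ := hs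
    · exact Submodule.mem_sup_right (single_mem_chainsIn hs _)
    · exact Submodule.mem_sup_left (Submodule.mem_iSup_of_mem x (Submodule.mem_iSup_of_mem hx
        (single_mem_chainsIn hs _)))
  obtain ⟨a', ha', b, hb, hab⟩ := Submodule.mem_sup.1 hdec
  obtain ⟨a, rfl⟩ := (Submodule.mem_iSup_finset_iff_exists_sum _ _).1 ha'
  -- Since c is a cycle, the remainder can be taken in the chains of the empty set, which vanish as
  -- no simplex has empty image.
  have hcsd : ∃ w, c - sdIter m n c = bd ℤ w := by
    obtain ⟨w, -, r, hr, h⟩ := exists_sub_sdIter (S := Set.univ) (T := ∅) m (mem_chainsIn_univ c)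
      (by rw [hc]; exact Submodule.zero_mem _)
    have hr0 : r = 0 := by
      by_contra hne
      obtain ⟨s, hs⟩ := Finsupp.support_nonempty_iff.2 hne
      exact hr hs ⟨barycenter n, rfl⟩
    exact ⟨w, by rw [h, hr0, add_zero]⟩
  obtain ⟨w, hw⟩ := hcsd
  have ha : ∀ x ∈ F, (a x : Chain ℤ X n) - k • β x ∈ relBoundaries ℤ ({x}ᶜ : Set X) n := by
    intro x hx
    have h1 : ∑ x' ∈ F.erase x, (a x' : Chain ℤ X n) ∈ chainsIn ℤ ({x}ᶜ : Set X) n := by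
      refine Submodule.sum_mem _ fun x' hx' => chainsIn_mono ?_ n (a x').2
      intro z hz hzx
      have hne : x ≠ x' := (Finset.ne_of_mem_erase hx').symm
      rw [Set.mem_singleton_iff.1 hzx] at hz
      exact Set.disjoint_left.1 (hdisj hx (Finset.mem_of_mem_erase hx') hne) (hU x).1 hz.1
    have h2 : b ∈ chainsIn ℤ ({x}ᶜ : Set X) n := by
      refine chainsIn_mono (S := (F : Set X)ᶜ) ?_ n hb
      intro z hz hzx
      rw [Set.mem_singleton_iff.1 hzx] at hz
      exact hz hx
    have h3 := Submodule.sub_mem _ (Submodule.sub_mem _ (Submodule.sub_mem _ (hcβ x)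
      (boundary_mem_relBoundaries (S := ({x}ᶜ : Set X)) w)) (chainsIn_le_relBoundaries h1))
      (chainsIn_le_relBoundaries h2)
    convert h3 using 1
    rw [← hw, ← hab, ← Finset.add_sum_erase _ _ hx]
    abel
  have hpush : ∀ x ∈ F, push f n (a x : Chain ℤ X n) - k • γ ∈
      relBoundaries ℤ ({y}ᶜ : Set Y) n := by
    intro x hx
    have hfx := (hF x).1 hx
    have h1 := push_mem_relBoundaries_of_injOn (hW x hx) (injOn_of_isOpenEmbedding (hfW x hx))
      (hxW x hx) (Submodule.sub_mem _ (chainsIn_mono Set.inter_subset_right n (a x).2)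
        (Submodule.smul_mem _ k (hβW x hx))) (ha x hx)
    have h2 := Submodule.add_mem _ h1 (Submodule.smul_mem _ k (hβγ x hx))
    rwa [map_sub, map_smul, smul_sub, sub_add_sub_cancel, hfx] at h2
  have hb' : push f n b ∈ relBoundaries ℤ ({y}ᶜ : Set Y) n :=
    chainsIn_le_relBoundaries 
      (push_mem_chainsIn (f := f) (S := (F : Set X)ᶜ) (T := {y}ᶜ) (fun x hx h => hx ((hF x).2 h)) hb)
  have h1 := Submodule.add_mem _ (Submodule.add_mem _ (Submodule.sum_mem _ hpush) hb')
    (boundary_mem_relBoundaries (S := ({y}ᶜ : Set Y)) (push f (n + 1) w))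
  convert h1 using 1
  rw [bd_push, ← hw, ← hab, Finset.sum_sub_distrib, Finset.sum_const, ← map_sum, map_sub, map_add,
    mul_smul, natCast_zsmul]
  abel

end Degree

/-! ### The gluing given by a triangulation -/

section Realization

variable {n m : ℕ}

namespace FacetPairing

variable (P : FacetPairing n m)

/-- The `i`-th simplex of the realization. -/
def realizationSimplex (i : Fin m) : C(Simplex n, P.Realization) :=
  ⟨fun p => Quot.mk _ ⟨i, p⟩, continuous_quot_mk.comp continuous_sigmaMk⟩

theorem Glue.symm {P : FacetPairing n m} {a b : Σ _ : Fin m, Simplex n} (h : P.Glue a b) :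
    P.Glue b a := by
  obtain ⟨i, k, p, hp⟩ := h
  have h1 : vertexMap (P.perm i k) p (P.perm i k k) = 0 := by rw [vertexMap_perm_apply, hp]
  have h2 := Glue.mk (P := P) (P.nbr i k) (P.perm i k k) _ h1
  have h3 : stdSimplex.map (P.perm (P.nbr i k) (P.perm i k k)) (vertexMap (P.perm i k) p) = p := by
    rw [P.perm_perm]
    change vertexMap ⇑((P.perm i k)⁻¹) (vertexMap (P.perm i k) p) = p
    rw [← ContinuousMap.comp_apply, vertexMap_comp, ← Equiv.Perm.coe_mul, inv_mul_cancel,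
      Equiv.Perm.coe_one, vertexMap_id]
    rfl
  rwa [h3, P.nbr_nbr] at h2

/-- Points of the realization are separated by predicates that are invariant under gluing. -/
theorem of_mk_eq_mk {P : FacetPairing n m} {R : (Σ _ : Fin m, Simplex n) → Prop}
    (hR : ∀ a b, P.Glue a b → R a → R b) {a b : Σ _ : Fin m, Simplex n}
    (h : (Quot.mk P.Glue a) = Quot.mk P.Glue b) (ha : R a) : R b := by
  have h1 : ∀ a b, P.Glue a b → R a = R b := fun a b hab =>
    propext ⟨hR a b hab, hR b a hab.symm⟩
  have h2 := congrArg (Quot.lift R h1) h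
  exact (show R a = R b from h2) ▸ ha

/-- Interior points have no zero coordinate, so no elementary identification applies to them. -/
theorem mk_eq_mk_interior {P : FacetPairing n m} {i j : Fin m} {p q : Simplex n}
    (hq : q ∈ interiorSimplex n) (h : P.realizationSimplex j p = P.realizationSimplex i q) :
    (⟨j, p⟩ : Σ _ : Fin m, Simplex n) = ⟨i, q⟩ := by
  refine of_mk_eq_mk (R := fun a => a = ⟨i, q⟩) ?_ h.symm rfl
  rintro _ _ ⟨l, k, p, hp⟩ h
  cases h
  exact absurd hp (hq k).ne'

/-- A point with a single zero coordinate is moved only by the pairing of that facet, and its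
partner is moved only back, since the pairing is an involution. -/
theorem mk_eq_mk_facet {P : FacetPairing n m} {i j : Fin m} {p p' : Simplex n} {k : Fin (n + 1)}
    (hk : p k = 0) (hl : ∀ l, l ≠ k → 0 < p l)
    (h : P.realizationSimplex j p' = P.realizationSimplex i p) :
    (⟨j, p'⟩ : Σ _ : Fin m, Simplex n) = ⟨i, p⟩ ∨
      (⟨j, p'⟩ : Σ _ : Fin m, Simplex n) = ⟨P.nbr i k, vertexMap (P.perm i k) p⟩ := by
  refine of_mk_eq_mk (R := fun a => a = ⟨i, p⟩ ∨ a = ⟨P.nbr i k, vertexMap (P.perm i k) p⟩)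
    ?_ h.symm (Or.inl rfl)
  rintro _ _ ⟨i', k', p', hp'⟩ (h | h)
  · cases h
    have : k' = k := by
      by_contra hne
      exact (hl k' hne).ne' hp'
    subst this
    exact Or.inr rfl
  · cases h
    left
    obtain ⟨l, rfl⟩ := (P.perm i k).surjective k'
    rw [vertexMap_perm_apply] at hp'
    have : l = k := by
      by_contra hne
      exact (hl l hne).ne' hp'
    subst this
    rw [P.perm_perm, P.nbr_nbr]
    congr 1
    change vertexMap ⇑((P.perm i l)⁻¹) (vertexMap (P.perm i l) p) = p
    rw [← ContinuousMap.comp_apply, vertexMap_comp, ← Equiv.Perm.coe_mul, inv_mul_cancel,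
      Equiv.Perm.coe_one, vertexMap_id]
    rfl

theorem isOpenSimplex_realizationSimplex (i : Fin m) : IsOpenSimplex (P.realizationSimplex i) := by
  refine ⟨.of_continuous_injective_isOpenMap
    ((P.realizationSimplex i).continuous.comp continuous_subtype_val) ?_ ?_, ?_⟩
  · rintro ⟨p, hp⟩ ⟨q, hq⟩ h
    have := mk_eq_mk_interior hq h
    cases this
    rfl
  · intro O hO
    have hO' : IsOpen (Subtype.val '' O) := isOpen_interiorSimplex.isOpenMap_subtype_val _ hO
    rw [← isQuotientMap_quot_mk.isOpen_preimage]
    convert isOpenMap_sigmaMk (σ := fun _ : Fin m => Simplex n) (i := i) _ hO' using 1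
    ext ⟨j, p⟩
    constructor
    · rintro ⟨⟨q, hq⟩, hqO, h⟩
      have := mk_eq_mk_interior (i := i) (j := j) hq h.symm
      cases this
      exact ⟨p, ⟨⟨p, hq⟩, hqO, rfl⟩, rfl⟩
    · rintro ⟨_, ⟨⟨q, hq⟩, hqO, rfl⟩, h⟩
      cases h
      exact ⟨⟨q, hq⟩, hqO, rfl⟩
  · intro q hq p h
    have := mk_eq_mk_interior hq h
    cases this
    rfl

/-- A space homeomorphic to the realization is glued from simplices. -/
def gluing {X : Type u} [TopologicalSpace X] (e : P.Realization ≃ₜ X) :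
    SimplexGluing n (Fin m) X where
  simplex i := (e : C(P.Realization, X)).comp (P.realizationSimplex i)
  nbr := P.nbr
  perm := P.perm
  nbr_nbr := P.nbr_nbr
  perm_perm := P.perm_perm
  ne_self := P.ne_self
  glue i k p hp := congrArg e (Quot.sound (Glue.mk i k p hp)).symm
  isOpenSimplex i := ⟨e.isOpenEmbedding.comp (P.isOpenSimplex_realizationSimplex i).isOpenEmbedding,
    fun p hp p' h => (P.isOpenSimplex_realizationSimplex i).eq_of_eq p hp p' (e.injective h)⟩
  eq_of_interior i j p q hq h := congrArg Sigma.fst (mk_eq_mk_interior hq (e.injective h))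
  eq_of_facet i j k p p' hk hl h := by
    rcases mk_eq_mk_facet hk hl (e.injective h) with h | h
    · cases h
      exact Or.inl ⟨rfl, rfl⟩
    · cases h
      exact Or.inr ⟨rfl, rfl⟩
  exists_eq x := by
    obtain ⟨⟨i, p⟩, h⟩ := Quot.exists_rep (e.symm x)
    refine ⟨i, p, ?_⟩
    change e (Quot.mk _ ⟨i, p⟩) = x
    rw [h, e.apply_symm_apply]

end FacetPairing

end Realization

/-! ### Lifting a gluing along a local homeomorphism -/

section LiftGluing

theorem exists_faceMap_eq {N : ℕ} {k : Fin (N + 2)} {p : Simplex (N + 1)} (hp : p k = 0) :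
    ∃ p', faceMap k p' = p := by
  refine ⟨⟨fun l => p (k.succAbove l), fun l => p.2.1 _, ?_⟩, simplex_ext fun l => ?_⟩
  · have := stdSimplex.sum_eq_one p
    rw [Fin.sum_univ_succAbove _ k, hp, zero_add] at this
    exact this
  · obtain rfl | ⟨l, rfl⟩ := Fin.eq_self_or_eq_succAbove k l
    · rw [faceMap_self, hp]
    · rw [faceMap_succAbove]
      rfl

instance (k : ℕ) : PreconnectedSpace (Simplex k) := by
  refine ⟨?_⟩
  have : (Set.univ : Set (Simplex k)) = closure (interiorSimplex k) := by
    refine (Set.eq_univ_of_forall fun p => ?_).symm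
    exact mem_closure_iff_frequently.2 (frequently_mem_interiorSimplex p)
  rw [this]
  exact isPreconnected_interiorSimplex.closure

variable {n : ℕ} {ι : Type*} {X Z : Type u} [TopologicalSpace X] [TopologicalSpace Z]

theorem lift_unique [T2Space Z] {r : Z → X} (hr : IsLocalHomeomorph r) {g g' : C(Simplex n, Z)}
    (h : ∀ p, r (g p) = r (g' p)) {a : Simplex n} (ha : g a = g' a) : g = g' :=
  DFunLike.coe_injective ((T2Space.isSeparatedMap r).eq_of_comp_eq hr.isLocallyInjective
    g.continuous g'.continuous (funext h) a ha)

/-- The indices of the lifts of the simplices of a gluing: a simplex and a lift of its center. -/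
abbrev SimplexGluing.LiftIndex (G : SimplexGluing n ι X) (r : Z → X) : Type _ :=
  {x : ι × Z // r x.2 = G.simplex x.1 (barycenter n)}

/-- A lift of a simplex is determined by its value at one point, so lifts are indexed by the lifts
of the centers, and every point over a simplex lies on a lift. The incidence properties hold
downstairs, and uniqueness of lifts transfers them. -/
theorem SimplexGluing.nonempty_lift [T2Space Z] (G : SimplexGluing n ι X) {r : Z → X}
    (hr : IsLocalHomeomorph r) (hl : LiftsSimplices n r) :
    Nonempty (SimplexGluing n (G.LiftIndex r) Z) := by
  choose L hL hLb using fun x : G.LiftIndex r =>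
    hl (G.simplex x.1.1) (barycenter n) x.1.2 x.2
  have index_eq : ∀ (x y : G.LiftIndex r) (a : Simplex n), x.1.1 = y.1.1 → L x a = L y a →
      x = y := by
    intro x y a hxy h
    have h1 : L x = L y := lift_unique hr (fun p => by rw [hL, hL, hxy]) h
    refine Subtype.ext (Prod.ext hxy ?_)
    rw [← hLb x, ← hLb y, h1]
  have exists_index : ∀ (i : ι) (p : Simplex n) (z : Z), r z = G.simplex i p →
      ∃ x : G.LiftIndex r, x.1.1 = i ∧ L x p = z := by
    intro i p z hz
    obtain ⟨g, hg, hgp⟩ := hl (G.simplex i) p z hz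
    refine ⟨⟨(i, g (barycenter n)), hg _⟩, rfl, ?_⟩
    rw [← hgp]
    refine DFunLike.congr_fun (lift_unique hr (a := barycenter n) (fun p => ?_) ?_) p
    · rw [hL, hg]
    · rw [hLb]
  have hopen : ∀ x, IsOpenSimplex (L x) := fun x => by
    have hcomp : (r ∘ fun p : interiorSimplex n => L x p) =
        fun p : interiorSimplex n => G.simplex x.1.1 p := funext fun p => hL x p
    refine ⟨hr.isOpenEmbedding_of_comp ?_ ((L x).continuous.comp continuous_subtype_val),
      fun p hp p' h => (G.isOpenSimplex x.1.1).eq_of_eq p hp p' ?_⟩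
    · rw [hcomp]
      exact (G.isOpenSimplex x.1.1).isOpenEmbedding
    · rw [← hL, h, hL]
  have hint : ∀ x y p, ∀ q ∈ interiorSimplex n, L y p = L x q → y = x := by
    intro x y p q hq h
    have h1 := congrArg r h
    rw [hL, hL] at h1
    have h2 := G.eq_of_interior _ _ _ _ hq h1
    rw [h2] at h1
    have h3 := (G.isOpenSimplex x.1.1).eq_of_eq q hq p h1
    exact index_eq y x q h2 (h3 ▸ h)
  have hcov : ∀ z, ∃ x p, L x p = z := fun z => by
    obtain ⟨i, p, h⟩ := G.exists_eq (r z)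
    obtain ⟨x, -, hx⟩ := exists_index i p z h.symm
    exact ⟨x, p, hx⟩
  cases n with
  | zero =>
    -- A 0-simplex has only an empty facet, so the pairing is arbitrary and the conditions on facets
    -- are void.
    refine ⟨⟨L, fun x _ => x, fun _ _ => 1, fun _ _ => rfl, fun _ _ => inv_one.symm,
      fun h => absurd rfl h, fun _ _ _ _ => ?_, hopen, hint, fun x y k p p' hp => ?_, hcov⟩⟩
    · rw [Equiv.Perm.coe_one, vertexMap_id]
      rfl
    · exfalso
      have := stdSimplex.sum_eq_one p
      rw [Fin.sum_univ_succ, Fin.sum_univ_zero, add_zero, ← Fin.fin_one_eq_zero k, hp] at this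
      exact zero_ne_one this
  | succ N =>
    -- The neighbour across a facet is the lift of the neighbouring simplex through the lifted
    -- center of the facet; the two lifts then agree on the whole facet.
    have hnbr : ∀ (x : G.LiftIndex r) (k : Fin (N + 2)), ∃ y : G.LiftIndex r,
        y.1.1 = G.nbr x.1.1 k ∧ L y (vertexMap (G.perm x.1.1 k) (faceMap k (barycenter N))) =
          L x (faceMap k (barycenter N)) := fun x k =>
      exists_index _ _ _ (by rw [hL, G.glue _ _ _ (faceMap_self k _)])
    choose nb hnb hnb' using hnbr
    have hglue : ∀ x k p, p k = 0 →
        L (nb x k) (vertexMap (G.perm x.1.1 k) p) = L x p := by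
      intro x k p hp
      obtain ⟨p', rfl⟩ := exists_faceMap_eq hp
      refine DFunLike.congr_fun (lift_unique (a := barycenter N) hr
        (g := ((L (nb x k)).comp (vertexMap (G.perm x.1.1 k))).comp (faceMap k))
        (g' := (L x).comp (faceMap k)) (fun p => ?_) (hnb' x k)) p'
      simp only [ContinuousMap.comp_apply]
      rw [hL, hL, hnb, G.glue _ _ _ (faceMap_self k p)]
    refine ⟨⟨L, nb, fun x k => G.perm x.1.1 k, fun x k => ?_, fun x k => ?_,
      fun h x k hx => ?_, hglue, hopen, hint, fun x y k p p' hk hl h => ?_, hcov⟩⟩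
    · have h0 : vertexMap (G.perm x.1.1 k) (faceMap k (barycenter N)) (G.perm x.1.1 k k) = 0 := by
        rw [vertexMap_perm_apply, faceMap_self]
      have h1 := hglue (nb x k) (G.perm x.1.1 k k) _ h0
      rw [hnb' x k, hnb x k, G.perm_perm, ← ContinuousMap.comp_apply (vertexMap _),
        vertexMap_comp, ← Equiv.Perm.coe_mul, inv_mul_cancel, Equiv.Perm.coe_one,
        vertexMap_id] at h1
      refine index_eq _ x _ ?_ h1
      rw [hnb, hnb, G.nbr_nbr]
    · rw [hnb, G.perm_perm]
    · refine G.ne_self h x.1.1 k (Prod.ext ?_ (show (nb x k, G.perm x.1.1 k k).2 = k by rw [hx]))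
      rw [← hnb]
      exact congrArg (fun y : G.LiftIndex r × Fin (N + 2) => y.1.1.1) hx
    · have h1 := congrArg r h
      rw [hL, hL] at h1
      rcases G.eq_of_facet _ _ _ _ _ hk hl h1 with ⟨h2, rfl⟩ | ⟨h2, rfl⟩
      · exact Or.inl ⟨index_eq _ _ _ h2 h, rfl⟩
      · refine Or.inr ⟨index_eq _ _ _ (h2.trans (hnb x k).symm) (h.trans (hglue x k p hk).symm), rfl⟩

end LiftGluing

/-! ### Fibre products -/

section FibreProduct

variable {n : ℕ} {N M Y : Type u} [TopologicalSpace N] [TopologicalSpace M] [TopologicalSpace Y]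

/-- The fibre product of two maps. -/
abbrev FibreProduct (p : N → M) (q : Y → M) : Type _ := {x : N × Y // p x.1 = q x.2}

/-- A local inverse of q at the second coordinate gives the local section z ↦ (z, e⁻¹(p z)) of the
projection. -/
theorem isLocalHomeomorph_fst {p : N → M} (hp : Continuous p) {q : Y → M}
    (hq : IsLocalHomeomorph q) :
    IsLocalHomeomorph fun x : FibreProduct p q => x.1.1 := by
  refine IsLocalHomeomorph.mk _ fun x => ?_
  obtain ⟨e, he, rfl⟩ := hq x.1.2
  classical
  let F : OpenPartialHomeomorph (FibreProduct p e) N :=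
    { toFun := fun x => x.1.1
      -- The value x off the target is a mere default.
      invFun := fun z => if h : p z ∈ e.target then ⟨(z, e.symm (p z)), (e.right_inv h).symm⟩ else x
      source := {x | x.1.2 ∈ e.source}
      target := {z | p z ∈ e.target}
      map_source' := fun x hx => by
        change p x.1.1 ∈ e.target
        rw [x.2]
        exact e.map_source hx
      map_target' := fun z hz => by
        simp only [Set.mem_ofPred_eq] at hz ⊢
        rw [dif_pos hz]
        exact e.map_target hz
      left_inv' := fun x hx => by
        have h : p x.1.1 ∈ e.target := by
          rw [x.2]
          exact e.map_source hx
        rw [dif_pos h]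
        refine Subtype.ext (Prod.ext rfl ?_)
        change e.symm (p x.1.1) = x.1.2
        rw [x.2, e.left_inv hx]
      right_inv' := fun z hz => by
        simp only [Set.mem_ofPred_eq] at hz
        rw [dif_pos hz]
      open_source := e.open_source.preimage (continuous_snd.comp continuous_subtype_val)
      open_target := e.open_target.preimage hp
      continuousOn_toFun := (continuous_fst.comp continuous_subtype_val).continuousOn
      continuousOn_invFun := by
        rw [continuousOn_iff_continuous_domRestrict]
        refine continuous_induced_rng.2 ?_
        have h1 : Continuous fun z : {z | p z ∈ e.target} => ((z : N), e.symm (p z)) :=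
          continuous_subtype_val.prodMk (e.continuousOn_symm.comp_continuous
            (hp.comp continuous_subtype_val) fun z => z.2)
        refine h1.congr fun z => ?_
        have hz : p z ∈ e.target := z.2
        simp only [Set.domRestrict_apply, Function.comp_apply, dif_pos hz] }
  exact ⟨F, he, fun _ _ => rfl⟩

theorem isLocalHomeomorph_snd {p : N → M} (hp : IsLocalHomeomorph p) {q : Y → M}
    (hq : Continuous q) : IsLocalHomeomorph fun x : FibreProduct p q => x.1.2 := by
  let e : FibreProduct p q ≃ₜ FibreProduct q p :=
    (Homeomorph.prodComm N Y).subtype fun x => eq_comm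
  exact (isLocalHomeomorph_fst hq hp).comp e.isLocalHomeomorph

theorem liftsSimplices_fst {p : N → M} (hp : Continuous p) {q : Y → M}
    (hq : LiftsSimplices n q) : LiftsSimplices n fun x : FibreProduct p q => x.1.1 := by
  rintro f p₀ ⟨⟨z, y⟩, h⟩ (rfl : z = f p₀)
  obtain ⟨g, hg, hgy⟩ := hq ((⟨p, hp⟩ : C(N, M)).comp f) p₀ y h.symm
  refine ⟨⟨fun a => ⟨(f a, g a), (hg a).symm⟩, by fun_prop⟩, fun _ => rfl, ?_⟩
  exact Subtype.ext (Prod.ext rfl hgy)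

end FibreProduct

/-! ### Real chains -/

section RealChains

variable {n k : ℕ} {X : Type u} [TopologicalSpace X]

/-- The real chain of an integral chain. -/
def castChain : Chain ℤ X k →+ Chain ℝ X k :=
  Finsupp.mapRange.addMonoidHom (Int.castAddHom ℝ)

theorem castChain_single (s : C(Simplex k, X)) (a : ℤ) :
    castChain (Finsupp.single s a) = Finsupp.single s (a : ℝ) :=
  Finsupp.mapRange_single (hf := map_zero (Int.castAddHom ℝ))

theorem castChain_zsmul (t : ℤ) (c : Chain ℤ X k) : castChain (t • c) = (t : ℝ) • castChain c := by
  rw [map_zsmul, Int.cast_smul_eq_zsmul]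

theorem castChain_mem_chainsIn {S : Set X} {c : Chain ℤ X k} (hc : c ∈ chainsIn ℤ S k) :
    castChain c ∈ chainsIn ℝ S k :=
  fun _ hs => hc (Finsupp.support_mapRange (hf := map_zero (Int.castAddHom ℝ)) hs)

theorem boundary_castChain (c : Chain ℤ X k) :
    boundary ℝ X k (castChain c) = castChain (boundary ℤ X k c) := by
  cases k with
  | zero => exact (map_zero _).symm
  | succ k =>
    induction c using Finsupp.induction_linear with
    | zero => rw [map_zero, map_zero, map_zero, map_zero]
    | add c d hc hd => rw [map_add, map_add, map_add, map_add, hc, hd]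
    | single s a =>
      rw [castChain_single, boundary_single, boundary_single, map_sum]
      refine Finset.sum_congr rfl fun i _ => ?_
      rw [castChain_zsmul, castChain_single]
      push_cast
      rfl

theorem castChain_mem_relBoundaries {S : Set X} {c : Chain ℤ X k}
    (hc : c ∈ relBoundaries ℤ S k) : castChain c ∈ relBoundaries ℝ S k := by
  obtain ⟨a, ha, d, rfl⟩ := mem_relBoundaries.1 hc
  refine mem_relBoundaries.2 ⟨_, castChain_mem_chainsIn ha, castChain d, ?_⟩
  rw [map_add]
  exact congrArg _ (boundary_castChain d).symm

theorem l1Norm_zero : l1Norm (0 : Chain ℝ X n) = 0 := Finsupp.sum_zero_index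

theorem l1Norm_single (s : C(Simplex n, X)) (a : ℝ) :
    l1Norm (Finsupp.single s a : Chain ℝ X n) = |a| :=
  Finsupp.sum_single_index abs_zero

theorem l1Norm_add_le (c d : Chain ℝ X n) : l1Norm (c + d) ≤ l1Norm c + l1Norm d := by
  classical
  have h : ∀ e : Chain ℝ X n, e.support ⊆ c.support ∪ d.support →
      l1Norm e = ∑ s ∈ c.support ∪ d.support, |e s| := fun e he =>
    Finsupp.sum_of_support_subset _ he _ fun _ _ => abs_zero
  rw [h _ Finsupp.support_add, h c Finset.subset_union_left, h d Finset.subset_union_right,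
    ← Finset.sum_add_distrib]
  exact Finset.sum_le_sum fun s _ => abs_add_le _ _

theorem l1Norm_sum_le {κ : Type*} (F : Finset κ) (c : κ → Chain ℝ X n) :
    l1Norm (∑ i ∈ F, c i) ≤ ∑ i ∈ F, l1Norm (c i) :=
  Finset.le_sum_of_subadditive l1Norm l1Norm_zero.le l1Norm_add_le F c

theorem l1Norm_smul (r : ℝ) (c : Chain ℝ X n) : l1Norm (r • c) = |r| * l1Norm c := by
  rw [l1Norm, Finsupp.sum_of_support_subset _ (Finsupp.support_smul) _ fun _ _ => abs_zero, l1Norm,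
    Finsupp.sum, Finset.mul_sum]
  exact Finset.sum_congr rfl fun s _ => abs_mul _ _

end RealChains

/-! ### The simplicial volume of an oriented manifold over a triangulated covering -/

section Volume

theorem finite_of_forall_card_le {α : Type*} {K : ℕ} (h : ∀ F : Finset α, F.card ≤ K) :
    Finite α ∧ Nat.card α ≤ K := by
  have hf : Finite α := by
    by_contra hinf
    rw [not_finite_iff_infinite] at hinf
    obtain ⟨F, hF⟩ := Infinite.exists_subset_card_eq α (K + 1)
    have := h F
    omega
  refine ⟨hf, ?_⟩
  have := Fintype.ofFinite α
  rw [Nat.card_eq_fintype_card]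
  exact h Finset.univ

variable {n : ℕ} {N M Y : Type u} [TopologicalSpace N] [TopologicalSpace M] [TopologicalSpace Y]

theorem SimplexGluing.l1Norm_signedSum_le {X : Type u} [TopologicalSpace X] {ι : Type*} [Fintype ι]
    (G : SimplexGluing n ι X) {ε : ι → ℤ} (hε : ∀ i, ε i = 1 ∨ ε i = -1) (f : C(X, Y)) :
    l1Norm (castChain (push f n (G.signedSum ε))) ≤ Fintype.card ι * (n + 1).factorial := by
  have h1 : castChain (push f n (G.signedSum ε)) = ∑ i, ∑ π : Equiv.Perm (Fin (n + 1)),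
      Finsupp.single (f.comp ((G.simplex i).comp (vertexMap π)))
        ((ε i * (Equiv.Perm.sign π : ℤ) : ℤ) : ℝ) := by
    rw [SimplexGluing.signedSum, map_sum, map_sum]
    refine Finset.sum_congr rfl fun i _ => ?_
    rw [map_sum, map_sum]
    refine Finset.sum_congr rfl fun π _ => ?_
    rw [← castChain_single]
    exact congrArg _ (Finsupp.mapDomain_single)
  rw [h1]
  refine (l1Norm_sum_le _ _).trans ?_
  calc ∑ i, l1Norm (∑ π : Equiv.Perm (Fin (n + 1)),
        (Finsupp.single (f.comp ((G.simplex i).comp (vertexMap π)))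
          ((ε i * (Equiv.Perm.sign π : ℤ) : ℤ) : ℝ) : Chain ℝ Y n))
      ≤ ∑ i : ι, ∑ π : Equiv.Perm (Fin (n + 1)), (1 : ℝ) := by
        refine Finset.sum_le_sum fun i _ => (l1Norm_sum_le _ _).trans
          (Finset.sum_le_sum fun π _ => ?_)
        rw [l1Norm_single, ← Int.cast_abs, abs_mul]
        rcases hε i with h | h <;> rcases Int.units_eq_one_or (Equiv.Perm.sign π) with h' | h' <;>
          simp [h, h']
    _ = _ := by simp [Fintype.card_perm]

/-- The fibre product of N and Y over M is glued from at most K simplices, the lifts of those of N,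
and maps to Y with d-element fibres. Its signed sum pushes forward to d · (n + 1)! times the
fundamental class, with norm at most K · (n + 1)!. -/
theorem orientableSimplicialVolume_le [T2Space N] [T2Space Y] [HasLocalGenerators n Y]
    {p : N → M} (hp : IsLocalHomeomorph p) {d : ℕ} (hd : 0 < d)
    (hcard : ∀ x : M, Nat.card (p ⁻¹' {x}) = d) {q : Y → M} (hq : IsLocalHomeomorph q)
    (hql : LiftsSimplices n q) {ι : Type*} (G : SimplexGluing n ι N)
    (o : ManifoldOrientation n Y) {K : ℕ}
    (hK : ∀ F : Finset (ι × Y), (∀ x ∈ F, q x.2 = p (G.simplex x.1 (barycenter n))) → F.card ≤ K) :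
    orientableSimplicialVolume n Y ≤ (K : ℝ≥0∞) / d := by
  classical
  obtain ⟨γ, hγ, hγo⟩ := o.exists_isOrientationSystem
  let r : FibreProduct p q → N := fun x => x.1.1
  let f : C(FibreProduct p q, Y) := ⟨fun x => x.1.2, continuous_snd.comp continuous_subtype_val⟩
  have hr : IsLocalHomeomorph r := isLocalHomeomorph_fst hp.continuous hq
  have hf : IsLocalHomeomorph f := isLocalHomeomorph_snd hp hq.continuous
  obtain ⟨β, hβ, hβγ⟩ := exists_isOrientationSystem hf (γ := fun x => γ (f x))
    (fun x => hγ.isLocalGenerator (f x)) fun x => f.continuous.continuousAt.eventually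
      (hγ.eventually (f x))
  obtain ⟨G'⟩ := G.nonempty_lift hr (liftsSimplices_fst hp.continuous hql)
  have hfin : Finite (G.LiftIndex r) ∧ Nat.card (G.LiftIndex r) ≤ K := by
    refine finite_of_forall_card_le fun F => ?_
    -- The N-coordinate of the lifted center is the center of the simplex i, so only its
    -- Y-coordinate is free.
    have hinj : Function.Injective fun x : G.LiftIndex r => (x.1.1, f x.1.2) := by
      rintro ⟨⟨i, ⟨⟨z, y⟩, h⟩⟩, h'⟩ ⟨⟨i', ⟨⟨z', y'⟩, hz⟩⟩, hz'⟩ heq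
      simp only [f, Prod.mk.injEq, ContinuousMap.coe_mk] at heq
      obtain ⟨rfl, rfl⟩ := heq
      have h1 : z = G.simplex i (barycenter n) := h'
      have h2 : z' = G.simplex i (barycenter n) := hz'
      subst h1
      subst h2
      rfl
    rw [← Finset.card_image_of_injective F hinj]
    refine hK _ fun x hx => ?_
    obtain ⟨⟨⟨i, z⟩, h⟩, -, rfl⟩ := Finset.mem_image.1 hx
    refine z.2.symm.trans ?_
    exact congrArg p h
  obtain ⟨hfin, hcK⟩ := hfin
  have := Fintype.ofFinite (G.LiftIndex r)
  rw [Nat.card_eq_fintype_card] at hcK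
  obtain ⟨ε, hε, hbd, hcyc⟩ := G'.exists_cycle hβ
  set c := G'.signedSum ε with hc
  have hpush : ∀ y, push f n c - ((d : ℤ) * ((n + 1).factorial : ℤ)) • γ y ∈
      relBoundaries ℤ ({y}ᶜ : Set Y) n := by
    intro y
    -- The fibre over y is the fibre of p over q y.
    let e : (f ⁻¹' {y} : Set (FibreProduct p q)) ≃ (p ⁻¹' {q y} : Set N) :=
      { toFun := fun x => ⟨x.1.1.1, by
          have h1 := x.1.2
          have h2 : x.1.1.2 = y := x.2
          rw [h2] at h1
          exact h1⟩
        invFun := fun z => ⟨⟨(z.1, y), z.2⟩, rfl⟩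
        left_inv := fun x => by
          have h2 : x.1.1.2 = y := x.2
          exact Subtype.ext (Subtype.ext (Prod.ext rfl h2.symm))
        right_inv := fun z => rfl }
    have h1 : Nat.card (f ⁻¹' {y} : Set (FibreProduct p q)) = d := by
      rw [Nat.card_congr e, hcard]
    have h2 : Finite (f ⁻¹' {y} : Set (FibreProduct p q)) :=
      Nat.finite_of_card_ne_zero (by rw [h1]; exact hd.ne')
    have h3 : (f ⁻¹' {y}).Finite := h2
    have h4 : h3.toFinset.card = d := by
      rw [← h1, Nat.card_coe_set_eq, Set.ncard_eq_toFinset_card _ h3]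
    rw [← h4]
    refine push_sub_mem_relBoundaries hbd hcyc _ (fun x => h3.mem_toFinset) fun x hx => ?_
    have h5 : f x = y := h3.mem_toFinset.1 hx
    rw [← h5]
    exact hβγ x
  set D : ℤ := (d : ℤ) * ((n + 1).factorial : ℤ) with hD
  have hDpos : 0 < (D : ℝ) := by
    rw [hD]
    push_cast
    positivity
  have hfund : IsFundamentalCycle o ((D : ℝ)⁻¹ • castChain (push f n c)) := by
    refine ⟨?_, fun y => ?_⟩
    · rw [map_smul, boundary_castChain, boundary_push, hbd, map_zero, map_zero, smul_zero]
    · obtain ⟨h1, h2⟩ := hγo y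
      refine ⟨⟨γ y, h1⟩, h2, ?_⟩
      have h3 := Submodule.smul_mem _ (D : ℝ)⁻¹ (castChain_mem_relBoundaries (hpush y))
      rwa [map_sub, castChain_zsmul, smul_sub, inv_smul_smul₀ hDpos.ne'] at h3
  refine (iInf_le_of_le o (iInf₂_le _ hfund)).trans ?_
  have hnorm : l1Norm ((D : ℝ)⁻¹ • castChain (push f n c)) ≤ (K : ℝ) / d := by
    rw [l1Norm_smul, abs_of_pos (inv_pos.2 hDpos)]
    have h1 := G'.l1Norm_signedSum_le hε f
    have h2 : (Fintype.card (G.LiftIndex r) : ℝ) ≤ K := by exact_mod_cast hcK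
    have hfac : (0 : ℝ) < (n + 1).factorial := by positivity
    have hd' : (0 : ℝ) < d := by exact_mod_cast hd
    have h3 : (D : ℝ) = d * (n + 1).factorial := by
      rw [hD]
      push_cast
      rfl
    rw [h3, inv_mul_le_iff₀ (by positivity)]
    refine h1.trans ((mul_le_mul_of_nonneg_right h2 hfac.le).trans (le_of_eq ?_))
    field_simp
  refine (ENNReal.ofReal_le_ofReal hnorm).trans (le_of_eq ?_)
  rw [ENNReal.ofReal_div_of_pos (by exact_mod_cast hd), ENNReal.ofReal_natCast,
    ENNReal.ofReal_natCast]

end Volume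

/-! ### Components of a manifold -/

section Components

variable {n : ℕ} {N M Y : Type u} [TopologicalSpace N] [TopologicalSpace M] [TopologicalSpace Y]

theorem hasLocalGenerators_of_isLocalHomeomorph [ChartedSpace (EuclideanSpace ℝ (Fin n)) M]
    [T2Space Y] {q : Y → M} (hq : IsLocalHomeomorph q) : HasLocalGenerators n Y := by
  refine ⟨fun y => ?_⟩
  obtain ⟨e, he, rfl⟩ := hq y
  refine exists_isOpenSimplex (e.trans (chartAt (EuclideanSpace ℝ (Fin n)) (e y))) ?_
  rw [OpenPartialHomeomorph.trans_source]
  exact ⟨he, mem_chart_source _ _⟩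

theorem LiftsSimplices.comp {f : N → M} {g : Y → N} (hf : LiftsSimplices n f)
    (hg : LiftsSimplices n g) : LiftsSimplices n (f ∘ g) := by
  intro s p₀ y hy
  obtain ⟨t, ht, ht'⟩ := hf s p₀ (g y) hy
  obtain ⟨w, hw, hw'⟩ := hg t p₀ y ht'.symm
  exact ⟨w, fun p => (congrArg f (hw p)).trans (ht p), hw'⟩

theorem liftsSimplices_component (C : ConnectedComponents M) :
    LiftsSimplices n (Subtype.val : {x : M // ConnectedComponents.mk x = C} → M) := by
  rintro f p₀ ⟨y, rfl⟩ rfl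
  have h : ∀ p, ConnectedComponents.mk (f p) = ConnectedComponents.mk (f p₀) := fun p =>
    ConnectedComponents.coe_eq_coe'.2
      ((isPreconnected_range f.continuous).subset_connectedComponent ⟨p₀, rfl⟩ ⟨p, rfl⟩)
  exact ⟨⟨fun p => ⟨f p, h p⟩, by fun_prop⟩, fun _ => rfl, rfl⟩

theorem isOpen_component [LocallyConnectedSpace M] (C : ConnectedComponents M) :
    IsOpen {x : M | ConnectedComponents.mk x = C} := by
  obtain ⟨x, rfl⟩ := ConnectedComponents.surjective_coe C
  convert isOpen_connectedComponent (x := x) using 1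
  exact connectedComponents_preimage_singleton

theorem t2Space_of_isCoveringMap [T2Space M] {p : N → M} (hp : IsCoveringMap p) : T2Space N := by
  refine ⟨fun x x' hne => ?_⟩
  by_cases h : p x = p x'
  · exact hp.isSeparatedMap x x' h hne
  · exact separated_by_continuous hp.continuous h

open Classical in
-- The estimate is applied to the inclusion of the component or, if it is nonorientable, to its
-- orientation covering. Only the simplices of N whose center lies over C have lifts.
theorem connectedSimplicialVolume_component_le [T2Space M]
    [ChartedSpace (EuclideanSpace ℝ (Fin n)) M] {p : N → M} (hp : IsCoveringMap p) {d : ℕ}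
    (hd : 0 < d) (hcard : ∀ x : M, Nat.card (p ⁻¹' {x}) = d) {ι : Type*} [Fintype ι]
    (G : SimplexGluing n ι N) (C : ConnectedComponents M) :
    connectedSimplicialVolume n {x : M // ConnectedComponents.mk x = C} ≤
      ((Finset.univ.filter fun i =>
        ConnectedComponents.mk (p (G.simplex i (barycenter n))) = C).card : ℝ≥0∞) / d := by
  have : T2Space N := t2Space_of_isCoveringMap hp
  have : LocallyConnectedSpace M := ChartedSpace.locallyConnectedSpace (EuclideanSpace ℝ (Fin n)) M
  have hval : IsLocalHomeomorph (Subtype.val : {x : M // ConnectedComponents.mk x = C} → M) :=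
    (isOpen_component C).isOpenEmbedding_subtypeVal.isLocalHomeomorph
  have : HasLocalGenerators n {x : M // ConnectedComponents.mk x = C} :=
    hasLocalGenerators_of_isLocalHomeomorph hval
  set I := Finset.univ.filter fun i =>
    ConnectedComponents.mk (p (G.simplex i (barycenter n))) = C with hI
  -- If the fibres of q have at most e points, each simplex over C has at most e lifts.
  have count : ∀ {Y : Type u} (q : Y → M) (e : ℕ), (∀ y, ConnectedComponents.mk (q y) = C) →
      (∀ (x : M) (F : Finset Y), (∀ y ∈ F, q y = x) → F.card ≤ e) → ∀ F : Finset (ι × Y),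
        (∀ x ∈ F, q x.2 = p (G.simplex x.1 (barycenter n))) → F.card ≤ e * I.card := by
    intro Y q e hqC hq F hF
    refine Finset.card_le_mul_card_image_of_maps_to (f := Prod.fst) (t := I) (fun x hx => ?_) e
      fun i _ => ?_
    · rw [hI, Finset.mem_filter, ← hF x hx]
      exact ⟨Finset.mem_univ _, hqC _⟩
    · have hinj : Set.InjOn Prod.snd ((F.filter fun x => x.1 = i : Finset (ι × Y)) : Set (ι × Y)) :=
        fun x hx y hy h => Prod.ext (((Finset.mem_filter.1 hx).2).trans
          (Finset.mem_filter.1 hy).2.symm) h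
      rw [← Finset.card_image_of_injOn hinj]
      refine hq (p (G.simplex i (barycenter n))) _ fun y hy => ?_
      obtain ⟨x, hx, rfl⟩ := Finset.mem_image.1 hy
      rw [hF x (Finset.mem_filter.1 hx).1, (Finset.mem_filter.1 hx).2]
  rw [connectedSimplicialVolume]
  split_ifs with ho
  · obtain ⟨o⟩ := ho
    refine orientableSimplicialVolume_le hp.isLocalHomeomorph hd hcard hval
      (liftsSimplices_component C) G o fun F hF => ?_
    rw [← one_mul I.card]
    exact count _ 1 (fun y => y.2) (fun x F hF => Finset.card_le_one.2 fun y hy y' hy' =>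
      Subtype.ext ((hF y hy).trans (hF y' hy').symm)) F hF
  · let Z := OrientationCover n {x : M // ConnectedComponents.mk x = C}
    have hcov : IsCoveringMap (OrientationCover.proj : Z → _) := OrientationCover.isCoveringMap_proj
    have : T2Space Z := OrientationCover.t2Space
    have hq : IsLocalHomeomorph (Subtype.val ∘ (OrientationCover.proj : Z → _)) :=
      hval.comp hcov.isLocalHomeomorph
    have : HasLocalGenerators n Z := hasLocalGenerators_of_isLocalHomeomorph hq
    -- The orientation covering is tautologically oriented: each of its points is a local
    -- orientation below, which is pulled back to that point.
    obtain ⟨β, hβ, -⟩ := exists_isOrientationSystem (f := ⟨_, hcov.continuous⟩)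
      hcov.isLocalHomeomorph (γ := OrientationCover.rep) OrientationCover.isLocalGenerator_rep
      OrientationCover.eventually_rep
    obtain ⟨o, -⟩ := hβ.exists_manifoldOrientation
    have h := orientableSimplicialVolume_le hp.isLocalHomeomorph hd hcard hq
      ((liftsSimplices_component C).comp (liftsSimplices_of_isCoveringMap hcov)) G o
      (K := 2 * I.card) (count _ 2 (fun y => y.1.2) fun x F hF => by
        rcases F.eq_empty_or_nonempty with rfl | ⟨y, hy⟩
        · exact Nat.zero_le _
        · exact OrientationCover.card_fiber_le (OrientationCover.proj y) F fun y' hy' =>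
            Subtype.ext ((hF y' hy').trans (hF y hy).symm))
    -- The two lifts of each simplex cancel the half in the definition of the volume.
    refine ENNReal.div_le_of_le_mul (h.trans (le_of_eq ?_))
    push_cast
    rw [mul_comm 2, div_eq_mul_inv, div_eq_mul_inv]
    ring

/-- The center of each simplex lies over exactly one component, so the sum of the counts over all
components is m. -/
theorem simplicialVolume_le_div [T2Space M] [ChartedSpace (EuclideanSpace ℝ (Fin n)) M]
    {p : N → M} (hp : IsCoveringMap p) {d : ℕ} (hd : 0 < d)
    (hcard : ∀ x : M, Nat.card (p ⁻¹' {x}) = d) {m : ℕ} (G : SimplexGluing n (Fin m) N) :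
    simplicialVolume n M ≤ (m : ℝ≥0∞) / d := by
  classical
  refine (ENNReal.tsum_le_tsum fun C =>
    connectedSimplicialVolume_component_le hp hd hcard G C).trans (le_of_eq ?_)
  have h : ∀ C, ((Finset.univ.filter fun i =>
      ConnectedComponents.mk (p (G.simplex i (barycenter n))) = C).card : ℝ≥0∞) / d =
      ∑ i : Fin m, if C = ConnectedComponents.mk (p (G.simplex i (barycenter n)))
        then (d : ℝ≥0∞)⁻¹ else 0 := fun C => by
    rw [Finset.card_filter, Nat.cast_sum, div_eq_mul_inv, Finset.sum_mul]
    refine Finset.sum_congr rfl fun i _ => ?_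
    by_cases hC : ConnectedComponents.mk (p (G.simplex i (barycenter n))) = C
    · rw [if_pos hC, if_pos hC.symm, Nat.cast_one, one_mul]
    · rw [if_neg hC, if_neg (Ne.symm hC), Nat.cast_zero, zero_mul]
  rw [tsum_congr h, Summable.tsum_finsetSum fun _ _ => ENNReal.summable]
  simp only [tsum_ite_eq, Finset.sum_const, Finset.card_univ, Fintype.card_fin, nsmul_eq_mul]
  rw [div_eq_mul_inv]

end Components

/-! ### The stable complexity -/

section Stable

variable {n : ℕ} {M : Type u} [TopologicalSpace M] [ChartedSpace (EuclideanSpace ℝ (Fin n)) M]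

/-- A nonempty set of natural numbers attains its infimum, so a finite complexity comes with an
actual triangulation. -/
theorem deltaComplexity_eq_top_or (n : ℕ) (M : Type u) [TopologicalSpace M]
    [ChartedSpace (EuclideanSpace ℝ (Fin n)) M] : deltaComplexity n M = ⊤ ∨
      ∃ m : ℕ, Nonempty (Triangulation n m M) ∧ deltaComplexity n M = m := by
  by_cases h : ∃ m, Nonempty (Triangulation n m M)
  · right
    have h1 : deltaComplexity n M = sInf ((fun m : ℕ => (m : ℕ∞)) ''
        {m | Nonempty (Triangulation n m M)}) := by
      rw [sInf_image]
      rfl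
    obtain ⟨m, hm, hm'⟩ := csInf_mem (Set.Nonempty.image (fun m : ℕ => (m : ℕ∞))
      (show {m | Nonempty (Triangulation n m M)}.Nonempty from h))
    exact ⟨m, hm, h1.trans hm'.symm⟩
  · left
    exact iInf_eq_top.2 fun m => iInf_eq_top.2 fun hm => absurd ⟨m, hm⟩ h

theorem simplicialVolume_le_stableDeltaComplexity [T2Space M] :
    simplicialVolume n M ≤ stableDeltaComplexity n M := by
  refine le_iInf fun C => ?_
  rcases deltaComplexity_eq_top_or n C.total with h | ⟨m, ⟨T⟩, h⟩
  · rw [h, ENat.toENNReal_top, ENNReal.top_div_of_ne_top (ENNReal.natCast_ne_top _)]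
    exact le_top
  · rw [h, ENat.toENNReal_coe]
    exact simplicialVolume_le_div C.isCoveringMap C.degree_pos C.card_fiber (T.pairing.gluing T.homeo)

theorem isCoveringMap_id {X : Type*} [TopologicalSpace X] : IsCoveringMap (id : X → X) := fun _ =>
  IsEvenlyCovered.to_isEvenlyCovered_preimage (I := PUnit.{1}) ⟨inferInstance, Set.univ, trivial,
    isOpen_univ, isOpen_univ, (Homeomorph.prodPUnit _).symm, fun _ => rfl⟩

variable (n M) in
/-- The identity map, as a covering of degree one. -/
def FiniteCovering.refl [HasGroupoid M (plGroupoid n)] : FiniteCovering n M where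
  total := M
  proj := id
  isCoveringMap := isCoveringMap_id
  -- Read in charts, the identity is a transition map of the atlas, which is piecewise linear by
  -- compatibility.
  isPLMap := ⟨continuous_id, fun e' he' e he =>
    (mem_groupoid_of_pregroupoid.1 (HasGroupoid.compatible (G := plGroupoid n) he' he)).1⟩
  degree := 1
  degree_pos := Nat.one_pos
  card_fiber x := by
    rw [Set.preimage_id, Nat.card_unique]

theorem stableDeltaComplexity_le_deltaComplexity [HasGroupoid M (plGroupoid n)] :
    stableDeltaComplexity n M ≤ (deltaComplexity n M : ℝ≥0∞) := by
  refine (iInf_le _ (FiniteCovering.refl n M)).trans (le_of_eq ?_)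
  change (deltaComplexity n M : ℝ≥0∞) / ((1 : ℕ) : ℝ≥0∞) = _
  rw [Nat.cast_one, div_one]

end Stable

end StableDelta

end

theorem mainTheorem8 (n : ℕ) (M : Type u) [TopologicalSpace M] [T2Space M] [CompactSpace M]
    [ChartedSpace (EuclideanSpace ℝ (Fin n)) M] [HasGroupoid M (StableDelta.plGroupoid n)] :
    StableDelta.simplicialVolume n M ≤ StableDelta.stableDeltaComplexity n M ∧
      StableDelta.stableDeltaComplexity n M ≤
        (StableDelta.deltaComplexity n M : ℝ≥0∞) :=
  ⟨StableDelta.simplicialVolume_le_stableDeltaComplexity,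
    StableDelta.stableDeltaComplexity_le_deltaComplexity⟩
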